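/- All fields have characteristic $0$. A difference field $(\mathbb{F},\sigma)$ is a field $\mathbb{F}$ with an automorphism $\sigma$, and $\mathrm{const}_\sigma\mathbb{F}=\{c\in\mathbb{F}:\sigma(c)=c\}$. A difference field extension $(\mathbb{F}(t),\sigma)$ of $(\mathbb{F},\sigma)$ is a $\Sigma^*$-extension (resp. $\Pi$-extension) if $t$ is transcendental over $\mathbb{F}$, $\sigma(t)=t+a$ (resp. $\sigma(t)=a\,t$) for some $a\in\mathbb{F}\setminus\{0\}$, and $\mathrm{const}_\sigma\mathbb{F}(t)=\mathrm{const}_\sigma\mathbb{F}$. A $\Pi\Sigma^*$-extension (resp. $\Sigma^*$-extension) $(\mathbb{F}(t_1)\dots(t_e),\sigma)$ of $(\mathbb{F},\sigma)$, $e\ge 0$, is a finite tower of $\Pi$- or $\Sigma^*$-extensions (resp. of $\Sigma^*$-extensions). For a $\Pi\Sigma^*$-extension $\mathbb{G}(t_1)\dots(t_e)$ of $(\mathbb{G},\sigma)$ with $\sigma(t_i)=t_i+a_i$ or $\sigma(t_i)=a_it_i$, the depth function $\delta=\delta_{\mathbb{G}}$ is defined recursively: $\delta(t_i)=\delta(a_i)+1$,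 and $\delta(p/q)$, for coprime $p,q\in\mathbb{G}[t_1,\dots,t_e]$, is the maximum of $0$ and of all $\delta(t_i)$ such that $t_i$ occurs in $p$ or $q$. If $\mathbb{F}$ is a $\Pi\Sigma^*$-extension of $\mathbb{G}$, the extension depth of a $\Pi\Sigma^*$-extension $\mathbb{F}(x_1)\dots(x_r)$ of $\mathbb{F}$ is $\max(0,\delta(x_1),\dots,\delta(x_r))$. A $\Sigma^*$-extension $\mathbb{F}(s)$ of $\mathbb{F}$ with $\sigma(s)=s+f$, $f\in\mathbb{F}$, is depth-optimal if there are no $\Sigma^*$-extension $\mathbb{E}$ of $\mathbb{F}$ (the trivial extension $\mathbb{E}=\mathbb{F}$ included) of extension depth $\le\delta(f)$ and $g\in\mathbb{E}$ with $\sigma(g)-g=f$. A $\Pi\Sigma^{\delta}$-extension (resp. $\Sigma^{\delta}$-extension) is a $\Pi\Sigma^*$-extension (resp. $\Sigma^*$-extension) all of whose single $\Sigma^*$-extensions are depth-optimal. **Theorem.** Let $(\mathbb{F},\sigma)$ be a $\Pi\Sigma^{\delta}$-extension of a difference field $(\mathbb{G},\sigma)$, with $\delta=\delta_{\mathbb{G}}$.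 Let $f\in\mathbb{F}$, and let $(\mathbb{E},\sigma)$ be a $\Pi\Sigma^*$-extension of $(\mathbb{F},\sigma)$ with some $g\in\mathbb{E}$ such that $\sigma(g)-g=f$. Then there is a $\Sigma^{\delta}$-extension $(\mathbb{S},\sigma)$ of $(\mathbb{F},\sigma)$ with some $g'\in\mathbb{S}$ such that $\sigma(g')-g'=f$ and $\delta(g')\le\delta(g)$. -/

import Mathlib

universe u

/-- A difference field: a field of characteristic zero with a field automorphism `σ`. -/
structure DiffField where
  carrier : Type u
  [field : Field carrier]
  [charZero : CharZero carrier]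
  σ : carrier ≃+* carrier

namespace DiffField

instance : CoeSort DiffField.{u} (Type u) := ⟨DiffField.carrier⟩

instance (K : DiffField.{u}) : Field K := K.field

instance (K : DiffField.{u}) : CharZero K := K.charZero

end DiffField

/-- A single `ΠΣ*`-extension `L = K(t)` of the difference field `K`: `t` is transcendental over `K`,
`σ(t) = t + a` (a `Σ*`-extension) or `σ(t) = a t` (a `Π`-extension) for some `a ∈ K*`, and
`const L = const K`. The field `K` is regarded as a difference subfield of `L` through `emb`. -/
structure PiSigmaStep (K L : DiffField.{u}) where
  emb : K →+* L
  emb_σ : ∀ x : K, L.σ (emb x) = emb (K.σ x)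
  t : L
  transcendental : ∀ p : Polynomial K, p.eval₂ emb t = 0 → p = 0
  generates : Subfield.closure (Set.range emb ∪ {t}) = ⊤
  a : K
  a_ne_zero : a ≠ 0
  shift : L.σ t = t + emb a ∨ L.σ t = emb a * t
  const : ∀ c : L, L.σ c = c → ∃ c₀ : K, K.σ c₀ = c₀ ∧ emb c₀ = c

/-- The step is a `Σ*`-extension. (A step is never both a `Σ*`- and a `Π`-extension, since `a ≠ 0`
and `t` is transcendental.) -/
def PiSigmaStep.IsSigma {K L : DiffField.{u}} (s : PiSigmaStep K L) : Prop :=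
  L.σ s.t = s.t + s.emb s.a

/-- `PiSigmaTower G K` : a presentation of `K` as a `ΠΣ*`-extension `G(t₁)…(tₑ)` of `G`, i.e. a
finite (possibly empty) tower of single `ΠΣ*`-extensions leading from `G` to `K`. -/
inductive PiSigmaTower (G : DiffField.{u}) : DiffField.{u} → Type (u + 1)
  | base : PiSigmaTower G G
  | step {K L : DiffField.{u}} (T : PiSigmaTower G K) (s : PiSigmaStep K L) : PiSigmaTower G L

namespace PiSigmaTower

/-- The embedding of the ground field. -/
def emb {G : DiffField.{u}} : {K : DiffField.{u}} → PiSigmaTower G K → (G →+* K)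
  | _, .base => RingHom.id G
  | _, .step T s => s.emb.comp T.emb

/-- The number `e` of generators of `G(t₁)…(tₑ)`. -/
def length {G : DiffField.{u}} : {K : DiffField.{u}} → PiSigmaTower G K → ℕ
  | _, .base => 0
  | _, .step T _ => T.length + 1

/-- The generators `t₁, …, tₑ`, as elements of the top field. -/
def gen {G : DiffField.{u}} : {K : DiffField.{u}} → (T : PiSigmaTower G K) → Fin T.length → K
  | _, .base => Fin.elim0
  | _, .step T s => Fin.snoc (α := fun _ => _) (fun i => s.emb (T.gen i)) s.t

/-- A tower of towers: from `G` to `K` and from `K` to `L` gives from `G` to `L`. -/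
def comp {G K : DiffField.{u}} (T : PiSigmaTower G K) :
    {L : DiffField.{u}} → PiSigmaTower K L → PiSigmaTower G L
  | _, .base => T
  | _, .step X s => .step (T.comp X) s

/-- All steps of the tower are `Σ*`-extensions, i.e. the tower is a `Σ*`-extension. -/
def IsSigma {G : DiffField.{u}} : {K : DiffField.{u}} → PiSigmaTower G K → Prop
  | _, .base => True
  | _, .step T s => T.IsSigma ∧ s.IsSigma

/-- The depth of an element `x` when generators `t₁, …, tₙ` of depths `d₁, …, dₙ` are given: write
`x = p / q` with coprime polynomials `p, q ∈ G[t₁, …, tₙ]`; the depth is the maximum of `0` and of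
the `dᵢ` for which `tᵢ` occurs in `p` or `q`. (For algebraically independent generators of the
field, `p` and `q` exist and are unique up to a common factor in `G*`, so that the set below is a
singleton.) -/
noncomputable def elemDepth {G K : DiffField.{u}} (φ : G →+* K) {n : ℕ} (t : Fin n → K)
    (d : Fin n → ℕ) (x : K) : ℕ :=
  sInf {m : ℕ | ∃ p q : MvPolynomial (Fin n) G, IsRelPrime p q ∧ q ≠ 0 ∧
    x = p.eval₂ φ t / q.eval₂ φ t ∧ m = (p.vars ∪ q.vars).sup d}

/-- The depths of the generators: `δ(tᵢ) = δ(aᵢ) + 1`. -/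
noncomputable def genDepth {G : DiffField.{u}} :
    {K : DiffField.{u}} → (T : PiSigmaTower G K) → Fin T.length → ℕ
  | _, .base => Fin.elim0
  | _, .step T s =>
      Fin.snoc (α := fun _ => ℕ) T.genDepth (elemDepth T.emb T.gen T.genDepth s.a + 1)

/-- The depth function `δ_G : K → ℕ` of the `ΠΣ*`-extension `K` of `G`. -/
noncomputable def depth {G K : DiffField.{u}} (T : PiSigmaTower G K) (x : K) : ℕ :=
  elemDepth T.emb T.gen T.genDepth x

/-- The extension depth `max(0, δ_G(x₁), …, δ_G(x_r))` of a `ΠΣ*`-extension `X`, given by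
`L = K(x₁)…(x_r)`, of a `ΠΣ*`-extension `K` of `G`. -/
noncomputable def extDepth {G K L : DiffField.{u}} (T : PiSigmaTower G K) (X : PiSigmaTower K L) :
    ℕ :=
  Finset.univ.sup fun i => (T.comp X).depth (X.gen i)

/-- The condition on `f ∈ K` under which `K(s)` with `σ(s) = s + f` is a depth-optimal
`Σ*`-extension of `K`: there is no `Σ*`-extension `E` of `K` with extension depth `≤ δ_G(f)`
containing some `g` with `σ(g) - g = f`. -/
def IsDepthOptimalSummand {G K : DiffField.{u}} (T : PiSigmaTower G K) (f : K) : Prop :=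
  ¬ ∃ (E : DiffField.{u}) (X : PiSigmaTower K E),
    X.IsSigma ∧ T.extDepth X ≤ T.depth f ∧ ∃ g : E, E.σ g - g = X.emb f

/-- Given a `ΠΣ*`-extension `K` of `G`, the `ΠΣ*`-extension `L` of `K` is depth-optimal (a
`ΠΣ^δ`-extension) with respect to `δ_G`: all its `Σ*`-steps are depth-optimal. -/
def IsDepthOptimal {G K : DiffField.{u}} (T : PiSigmaTower G K) :
    {L : DiffField.{u}} → PiSigmaTower K L → Prop
  | _, .base => True
  | _, .step X s => T.IsDepthOptimal X ∧ (s.IsSigma → (T.comp X).IsDepthOptimalSummand s.a)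

end PiSigmaTower

/-! Write Δh = σ(h) - h. The field `E` embeds into a difference field `U` with the same constants in
which every element is summable (`exists_summable_closure`), and inside `U` depth is replaced by a
filtration. `sumFilt` starts with `G`, and level n+1 adjoins to level n all sums over level n
together with prescribed products. Let W_n be the filtration built with all Π-generators of `E`,
placed according to their depth, and V_n the one built only with those of `F`. Since δ(t) = δ(a) +
1, elements of `E` of depth at most n lie in W_n, and elements of `F` of depth at most n lie in V_n
(`depthField_le_sumFilt`).

Three facts carry the proof. First, foreign products do not help summation: if h ∈ W_n and Δh ∈ V_n,
then h ∈ V_n (`Realizes.descends`). The induction needs the larger package `Descends`, which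
survives the adjunction of a sum or product transcendental over M W_n (`Descends.adj`). This is seen
by expanding at infinity in the new variable, where each coefficient solves a possibly twisted
summation problem.

Second, depth-optimality makes generators independent of the filtration. If x is a sum of a
depth-optimal summand a ∈ K and n ≤ δ(a), then x is transcendental over W_n K
(`LevelReachable.transOver`). Otherwise x would lie in W_n K, by descent in V_n K, and hence in a
Σ*-extension of K of depth at most δ(a). For products, `transOver_of_pi` gives the analogous
statement. Consequently the elements of K in W_n are those of depth at most n
(`Realizes.fieldRange_inf_le`).

Third, every element of V_n occurs, with depth at most n, in some Σ^δ-extension (`levelReachable`).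
For a sum y over V_n, first reach a = Δy. If a is a depth-optimal summand, adjoin y, unless y is
already present. If it is not, a has a sum in a Σ*-extension of depth at most δ(a) ≤ n. That
extension embeds into `U`, its sum differs from y by a constant, and an earlier level suffices.

For d = δ(g), both g and Δg lie in W_d. As Δg comes from `F`, the second fact puts it in V_d, the
first puts g in V_d, and the third produces the required extension. -/

namespace DiffAlg

open Polynomial

/-! ### Polynomials over a subfield and simple extensions -/

section Coefficients

variable {U : Type*} [Field U] {L M N : Subfield U} {P Q D : U[X]} {x y : U}

/-- The polynomial `P` has all its coefficients in the subfield `L`. -/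
def CoeffIn (L : Subfield U) (P : U[X]) : Prop := ∀ i, P.coeff i ∈ L

/-- The element `x` is transcendental over the subfield `L`. -/
def TransOver (L : Subfield U) (x : U) : Prop := ∀ P : U[X], CoeffIn L P → P.eval x = 0 → P = 0

/-- The field `L(x)`. -/
abbrev adj (L : Subfield U) (x : U) : Subfield U := L ⊔ Subfield.closure {x}

theorem CoeffIn.mono (h : L ≤ M) (hP : CoeffIn L P) : CoeffIn M P := fun i => h (hP i)

theorem TransOver.anti (h : L ≤ M) (hx : TransOver M x) : TransOver L x :=
  fun P hP => hx P (hP.mono h)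

theorem coeffIn_iff : CoeffIn L P ↔ ∃ p : L[X], p.map L.subtype = P := by
  have := Polynomial.mem_map_range L.subtype (p := P)
  simp only [RingHom.mem_range, coe_mapRingHom] at this
  rw [this]
  simp [CoeffIn]

theorem coeffIn_map (p : L[X]) : CoeffIn L (p.map L.subtype) := coeffIn_iff.2 ⟨p, rfl⟩

theorem coeffIn_C {a : U} (ha : a ∈ L) : CoeffIn L (C a) := by
  intro i
  rw [coeff_C]
  split_ifs
  exacts [ha, L.zero_mem]

theorem coeffIn_X : CoeffIn L (X : U[X]) := coeffIn_iff.2 ⟨X, by simp⟩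

theorem coeffIn_one : CoeffIn L (1 : U[X]) := coeffIn_iff.2 ⟨1, by simp⟩

theorem coeffIn_zero : CoeffIn L (0 : U[X]) := coeffIn_iff.2 ⟨0, by simp⟩

theorem CoeffIn.add (hP : CoeffIn L P) (hQ : CoeffIn L Q) : CoeffIn L (P + Q) := fun i => by
  rw [coeff_add]; exact L.add_mem (hP i) (hQ i)

theorem CoeffIn.sub (hP : CoeffIn L P) (hQ : CoeffIn L Q) : CoeffIn L (P - Q) := fun i => by
  rw [coeff_sub]; exact L.sub_mem (hP i) (hQ i)

theorem CoeffIn.mul (hP : CoeffIn L P) (hQ : CoeffIn L Q) : CoeffIn L (P * Q) := by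
  obtain ⟨p, rfl⟩ := coeffIn_iff.1 hP
  obtain ⟨q, rfl⟩ := coeffIn_iff.1 hQ
  exact coeffIn_iff.2 ⟨p * q, by simp⟩

theorem CoeffIn.pow (hP : CoeffIn L P) (n : ℕ) : CoeffIn L (P ^ n) := by
  obtain ⟨p, rfl⟩ := coeffIn_iff.1 hP
  exact coeffIn_iff.2 ⟨p ^ n, by simp⟩

theorem CoeffIn.comp (hP : CoeffIn L P) (hQ : CoeffIn L Q) : CoeffIn L (P.comp Q) := by
  obtain ⟨p, rfl⟩ := coeffIn_iff.1 hP
  obtain ⟨q, rfl⟩ := coeffIn_iff.1 hQ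
  exact coeffIn_iff.2 ⟨p.comp q, by simp [Polynomial.map_comp]⟩

theorem CoeffIn.eval_mem (hP : CoeffIn L P) (hx : x ∈ L) : P.eval x ∈ L := by
  rw [eval_eq_sum_range]
  exact sum_mem fun i _ => L.mul_mem (hP i) (L.pow_mem hx i)

theorem CoeffIn.exists_div_mod (hP : CoeffIn L P) (hD : CoeffIn L D) (hm : D.Monic) :
    ∃ Q R : U[X], CoeffIn L Q ∧ CoeffIn L R ∧ P = D * Q + R ∧ R.degree < D.degree := by
  obtain ⟨p, rfl⟩ := coeffIn_iff.1 hP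
  obtain ⟨d, rfl⟩ := coeffIn_iff.1 hD
  have hd : d.Monic := monic_of_injective L.subtype.injective hm
  refine ⟨_, _, coeffIn_map (p /ₘ d), coeffIn_map (p %ₘ d), ?_, ?_⟩
  · rw [← Polynomial.map_mul, ← Polynomial.map_add, add_comm, modByMonic_add_div]
  · rw [degree_map, degree_map]
    exact degree_modByMonic_lt _ hd

theorem le_adj : L ≤ adj L x := le_sup_left

theorem self_mem_adj : x ∈ adj L x :=
  (le_sup_right : _ ≤ adj L x) (Subfield.subset_closure rfl)

theorem adj_le (h : L ≤ M) (hx : x ∈ M) : adj L x ≤ M :=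
  sup_le h ((Subfield.closure_le).2 (by simpa using hx))

theorem adj_mono (h : L ≤ M) : adj L x ≤ adj M x := sup_le_sup_right h _

theorem adj_eq_self (hx : x ∈ L) : adj L x = L := le_antisymm (adj_le le_rfl hx) le_adj

theorem CoeffIn.eval_mem_adj (hP : CoeffIn L P) : P.eval x ∈ adj L x :=
  (hP.mono le_adj).eval_mem self_mem_adj

theorem adj_le_adjoin : adj L x ≤ (IntermediateField.adjoin L {x}).toSubfield := by
  refine adj_le (fun a ha => ?_) ?_
  · exact (IntermediateField.adjoin L {x}).algebraMap_mem ⟨a, ha⟩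
  · exact IntermediateField.mem_adjoin_simple_self L x

theorem eval_map_subtype (p : L[X]) : (p.map L.subtype).eval x = aeval x p := by
  rw [eval_map, aeval_def]; rfl

theorem exists_eq_div_of_mem_adj {h : U} (hh : h ∈ adj L x) :
    ∃ A D : U[X], CoeffIn L A ∧ CoeffIn L D ∧ D.Monic ∧ D.eval x ≠ 0 ∧
      h = A.eval x / D.eval x := by
  obtain ⟨r, s, hrs⟩ := (IntermediateField.mem_adjoin_simple_iff L h).1 (adj_le_adjoin hh)
  by_cases hs : aeval x s = 0
  · refine ⟨0, 1, coeffIn_zero, coeffIn_one, monic_one, by simp, ?_⟩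
    simp [hrs, hs]
  · have hs0 : s.leadingCoeff ≠ 0 := by
      intro h0
      rw [leadingCoeff_eq_zero] at h0
      simp [h0] at hs
    refine ⟨(C s.leadingCoeff⁻¹ * r).map L.subtype, (C s.leadingCoeff⁻¹ * s).map L.subtype,
      coeffIn_map _, coeffIn_map _, Monic.map _ ?_, ?_, ?_⟩
    · rw [mul_comm]; exact monic_mul_leadingCoeff_inv (by simpa using hs0)
    · rw [eval_map_subtype, map_mul, aeval_C]
      refine mul_ne_zero ?_ hs
      simpa using hs0
    · rw [eval_map_subtype, eval_map_subtype, map_mul, map_mul, aeval_C, mul_div_mul_left _ _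
        (by simpa using hs0), hrs]

theorem exists_minpoly_of_not_transOver (hx : ¬ TransOver L x) :
    ∃ m : U[X], CoeffIn L m ∧ m.Monic ∧ m.eval x = 0 ∧
      (∀ P : U[X], CoeffIn L P → P.eval x = 0 → P.degree < m.degree → P = 0) ∧
      ∀ h ∈ adj L x, ∃ Q : U[X], CoeffIn L Q ∧ Q.degree < m.degree ∧ h = Q.eval x := by
  have hint : IsIntegral L x := by
    simp only [TransOver, not_forall] at hx
    obtain ⟨P, hP, h0, hne⟩ := hx
    obtain ⟨p, rfl⟩ := coeffIn_iff.1 hP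
    refine IsAlgebraic.isIntegral ⟨p, ?_, ?_⟩
    · rintro rfl; simp at hne
    · rwa [← eval_map_subtype]
  have hmon := minpoly.monic hint
  refine ⟨(minpoly L x).map L.subtype, coeffIn_map _, hmon.map _, ?_, ?_, ?_⟩
  · rw [eval_map_subtype, minpoly.aeval]
  · intro P hP h0 hdeg
    obtain ⟨p, rfl⟩ := coeffIn_iff.1 hP
    by_contra hne
    rw [degree_map, degree_map] at hdeg
    rw [eval_map_subtype] at h0
    have hp : p ≠ 0 := by rintro rfl; simp at hne
    exact absurd (minpoly.degree_le_of_ne_zero L x hp h0) (not_le.2 hdeg)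
  · intro h hh
    have h1 := adj_le_adjoin hh
    have h2 : h ∈ (IntermediateField.adjoin L {x}).toSubalgebra := h1
    rw [IntermediateField.adjoin_simple_toSubalgebra_of_isAlgebraic hint.isAlgebraic,
      Algebra.adjoin_singleton_eq_range_aeval] at h2
    obtain ⟨p, hp⟩ := h2
    refine ⟨(p %ₘ minpoly L x).map L.subtype, coeffIn_map _, ?_, ?_⟩
    · rw [degree_map, degree_map]; exact degree_modByMonic_lt _ hmon
    · rw [eval_map_subtype, ← hp]
      conv_lhs => rw [← modByMonic_add_div p (minpoly L x)]
      simp [minpoly.aeval]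

/-- A transcendental element over a larger field does not enlarge intersections. -/
theorem adj_inf_le (hMN : M ≤ N) (hx : TransOver N x) : adj M x ⊓ N ≤ M := by
  rintro h ⟨hh, hN⟩
  obtain ⟨A, D, hA, hD, hDm, hD0, rfl⟩ := exists_eq_div_of_mem_adj hh
  set h := A.eval x / D.eval x with hdef
  have hN : h ∈ N := hN
  have h1 : A - C h * D = 0 := by
    refine hx _ ((hA.mono hMN).sub ((coeffIn_C hN).mul (hD.mono hMN))) ?_
    simp [hdef, hD0]
  have h2 := congrArg (fun P => P.coeff D.natDegree) h1
  simp only [coeff_sub, coeff_C_mul, hDm.coeff_natDegree, coeff_zero, mul_one] at h2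
  have h3 : A.coeff D.natDegree ∈ M := hA _
  rwa [sub_eq_zero.1 h2] at h3

end Coefficients

end DiffAlg

namespace DiffAlg

open Polynomial

/-! ### The action of σ on polynomials; splitting off the polynomial part -/

section Action

variable {U : Type*} [Field U] {σ : U ≃+* U} {L M N : Subfield U} {P Q D : U[X]} {x y α β γ : U}

/-- The subfield `L` is a difference subfield with respect to the automorphism `σ`. -/
def IsStable (σ : U ≃+* U) (L : Subfield U) : Prop := ∀ x, σ x ∈ L ↔ x ∈ L

theorem IsStable.map_mem (hL : IsStable σ L) {a : U} (ha : a ∈ L) : σ a ∈ L := (hL a).2 ha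

theorem IsStable.sub_mem (hL : IsStable σ L) {a : U} (ha : a ∈ L) : σ a - a ∈ L :=
  L.sub_mem (hL.map_mem ha) ha

/-- If `P` has the value `v` at `y` and `σ y = α y + β`, then `act σ α β P` has the value `σ v`
at `y`. -/
noncomputable def act (σ : U ≃+* U) (α β : U) (P : U[X]) : U[X] :=
  (P.map (σ : U →+* U)).comp (C α * X + C β)

theorem eval_act (hy : σ y = α * y + β) : (act σ α β P).eval y = σ (P.eval y) := by
  rw [act, eval_comp, eval_add, eval_mul, eval_C, eval_X, eval_C, ← hy]
  have := eval_map_apply (f := (σ : U →+* U)) (p := P) y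
  simpa using this

theorem CoeffIn.act (hL : IsStable σ L) (hα : α ∈ L) (hβ : β ∈ L) (hP : CoeffIn L P) :
    CoeffIn L (act σ α β P) := by
  refine CoeffIn.comp (fun i => ?_) (((coeffIn_C hα).mul coeffIn_X).add (coeffIn_C hβ))
  rw [coeff_map]
  exact hL.map_mem (hP i)

theorem natDegree_act (hα : α ≠ 0) : (act σ α β P).natDegree = P.natDegree := by
  rw [act, natDegree_comp, natDegree_linear hα, mul_one,
    natDegree_map_eq_of_injective σ.injective]

theorem coeff_act_natDegree (hα : α ≠ 0) :
    (act σ α β P).coeff P.natDegree = α ^ P.natDegree * σ P.leadingCoeff := by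
  have h1 : (C α * X + C β).natDegree = 1 := natDegree_linear hα
  have h2 : (P.map (σ : U →+* U)).natDegree = P.natDegree :=
    natDegree_map_eq_of_injective σ.injective _
  have h := coeff_comp_degree_mul_degree (p := P.map (σ : U →+* U)) (q := C α * X + C β)
    (by rw [h1]; exact one_ne_zero)
  rw [h1, h2, mul_one, leadingCoeff_linear hα, leadingCoeff, h2, coeff_map] at h
  rw [act, h, mul_comm]
  rfl

theorem act_eq_zero_iff (hα : α ≠ 0) : act σ α β P = 0 ↔ P = 0 := by
  constructor
  · intro h
    have := coeff_act_natDegree (σ := σ) (β := β) (P := P) hα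
    rw [h, coeff_zero] at this
    have h2 := (mul_eq_zero.1 this.symm).resolve_left (pow_ne_zero _ hα)
    simpa using h2
  · rintro rfl; simp [act]

theorem degree_act (hα : α ≠ 0) : (act σ α β P).degree = P.degree := by
  by_cases h : P = 0
  · subst h; simp [act]
  · rw [degree_eq_natDegree h, degree_eq_natDegree (by rwa [Ne, act_eq_zero_iff hα]),
      natDegree_act hα]

theorem coeff_act_of_le (hα : α ≠ 0) {n : ℕ} (hn : P.natDegree ≤ n) :
    (act σ α β P).coeff n = α ^ n * σ (P.coeff n) := by
  rcases hn.eq_or_lt with h | h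
  · rw [← h, coeff_act_natDegree hα]; rfl
  · rw [coeff_eq_zero_of_natDegree_lt (by rwa [natDegree_act hα]), coeff_eq_zero_of_natDegree_lt h]
    simp

theorem coeff_act_zero_right (i : ℕ) : (act σ α 0 P).coeff i = α ^ i * σ (P.coeff i) := by
  rw [act, C_0, add_zero, comp_C_mul_X_coeff, coeff_map, mul_comm]
  rfl

/-- For α = 1 the action is σ on coefficients followed by the Taylor shift by β, and the degree
bound leaves only two terms. -/
theorem coeff_act_one_left {n : ℕ} (hn : P.natDegree ≤ n + 1) :
    (act σ 1 β P).coeff n = σ (P.coeff n) + (n + 1) * σ (P.coeff (n + 1)) * β := by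
  have h1 : act σ 1 β P = taylor β (P.map (σ : U →+* U)) := by
    rw [act, taylor_apply, C_1, one_mul]
  have h2 : (hasseDeriv n (P.map (σ : U →+* U))).natDegree < 2 := by
    have := natDegree_hasseDeriv_le (P.map (σ : U →+* U)) n
    rw [natDegree_map_eq_of_injective σ.injective] at this
    omega
  rw [h1, taylor_coeff, eval_eq_sum_range' h2, Finset.sum_range_succ, Finset.sum_range_one,
    hasseDeriv_coeff, hasseDeriv_coeff]
  simp only [coeff_map, zero_add, add_comm 1 n, Nat.choose_self, Nat.choose_succ_self_right]
  simp

theorem degree_C_mul_le' (a : U) (P : U[X]) : (C a * P).degree ≤ P.degree := by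
  by_cases h : a = 0
  · simp [h]
  · rw [degree_C_mul h]

/-- An element `h` of `L(y)` with `γ σ(h) - h ∈ L` is the sum of a polynomial in `y` with the same
property and of a proper fraction `r` with `γ σ(r) = r`. -/
theorem exists_poly_add (hL : IsStable σ L) (hy : σ y = α * y + β) (hα : α ∈ L) (hα0 : α ≠ 0)
    (hβ : β ∈ L) (hγ : γ ∈ L) {h f : U} (hh : h ∈ adj L y) (hf : f ∈ L) (he : γ * σ h - h = f) :
    ∃ (Q : U[X]) (r : U), CoeffIn L Q ∧ h = Q.eval y + r ∧ γ * σ r = r ∧ r ∈ adj L y ∧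
      C γ * act σ α β Q - Q = C f ∧ (r = 0 ∨ ∃ R D : U[X], CoeffIn L R ∧ CoeffIn L D ∧ D.Monic ∧
        R.degree < D.degree ∧ D.eval y ≠ 0 ∧ r = R.eval y / D.eval y ∧ TransOver L y) := by
  by_cases hT : TransOver L y
  · obtain ⟨A, D, hA, hD, hDm, hD0, rfl⟩ := exists_eq_div_of_mem_adj hh
    obtain ⟨Q, R, hQ, hR, rfl, hdeg⟩ := hA.exists_div_mod hD hDm
    have hsplit : (D * Q + R).eval y / D.eval y = Q.eval y + R.eval y / D.eval y := by
      rw [eval_add, eval_mul]; field_simp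
    set P := C γ * act σ α β Q - Q - C f with hP
    have hPin : CoeffIn L P :=
      (((coeffIn_C hγ).mul (hQ.act hL hα hβ)).sub hQ).sub (coeffIn_C hf)
    have hσD : σ (D.eval y) ≠ 0 := by simpa using hD0
    have hPev : P.eval y = R.eval y / D.eval y - γ * σ (R.eval y / D.eval y) := by
      rw [hsplit, map_add] at he
      rw [hP, eval_sub, eval_sub, eval_mul, eval_C, eval_C, eval_act hy, ← he]
      ring
    have h0 : P * (D * act σ α β D) - (R * act σ α β D - C γ * act σ α β R * D) = 0 := by
      refine hT _ ((hPin.mul (hD.mul (hD.act hL hα hβ))).sub ((hR.mul (hD.act hL hα hβ)).sub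
        (((coeffIn_C hγ).mul (hR.act hL hα hβ)).mul hD))) ?_
      simp only [eval_sub, eval_mul, hPev, eval_act hy, eval_C, map_div₀]
      field_simp
      ring
    -- In `h0` the subtracted term has degree below that of D · act(D), because R/D is proper and
    -- `act` preserves degrees. A nonzero P would make the first term at least that large.
    have hP0 : P = 0 := by
      by_contra hne
      have hD' : act σ α β D ≠ 0 := by rw [Ne, act_eq_zero_iff hα0]; exact hDm.ne_zero
      have hlt : (R * act σ α β D - C γ * act σ α β R * D).degree < (D * act σ α β D).degree := by
        refine (degree_sub_le _ _).trans_lt (max_lt ?_ ?_)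
        · rw [degree_mul, degree_mul]
          exact WithBot.add_lt_add_right (by rwa [Ne, degree_eq_bot]) hdeg
        · rw [mul_assoc]
          refine (degree_C_mul_le' _ _).trans_lt ?_
          rw [degree_mul, degree_mul, add_comm, degree_act hα0, degree_act hα0]
          exact WithBot.add_lt_add_left (by rw [Ne, degree_eq_bot]; exact hDm.ne_zero) hdeg
      have hle : (D * act σ α β D).degree ≤ (P * (D * act σ α β D)).degree := by
        rw [degree_mul (p := P)]
        exact le_add_of_nonneg_left (zero_le_degree_iff.2 hne)
      rw [sub_eq_zero.1 h0] at hle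
      exact absurd hlt (not_lt.2 hle)
    refine ⟨Q, R.eval y / D.eval y, hQ, hsplit, ?_, ?_, sub_eq_zero.1 hP0,
      Or.inr ⟨R, D, hR, hD, hDm, hdeg, hD0, rfl, hT⟩⟩
    · rw [hP0, eval_zero] at hPev
      exact (sub_eq_zero.1 hPev.symm).symm
    · exact (adj L y).div_mem hR.eval_mem_adj hD.eval_mem_adj
  -- For algebraic y take the representative reduced modulo the minimal polynomial, with no
  -- fractional part. The defect of the equation keeps degree below that of m and vanishes at y, so
  -- it is zero as a polynomial.
  · obtain ⟨m, hm, hmm, hm0, hmin, hrep⟩ := exists_minpoly_of_not_transOver hT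
    obtain ⟨Q, hQ, hdeg, rfl⟩ := hrep h hh
    refine ⟨Q, 0, hQ, by simp, by simp, (adj L y).zero_mem, ?_, Or.inl rfl⟩
    rw [← sub_eq_zero]
    refine hmin _ ((((coeffIn_C hγ).mul (hQ.act hL hα hβ)).sub hQ).sub (coeffIn_C hf)) ?_ ?_
    · rw [eval_sub, eval_sub, eval_mul, eval_C, eval_C, eval_act hy, ← he]
      ring
    · have hm1 : 0 < m.degree := by
        rw [← natDegree_pos_iff_degree_pos]
        by_contra hcon
        rw [hmm.natDegree_eq_zero.1 (by omega)] at hm0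
        simp at hm0
      refine (degree_sub_le _ _).trans_lt (max_lt ((degree_sub_le _ _).trans_lt (max_lt ?_ hdeg))
        (degree_C_le.trans_lt hm1))
      exact (degree_C_mul_le' _ _).trans_lt (by rwa [degree_act hα0])

end Action

end DiffAlg

namespace DiffAlg

open Polynomial

/-! ### Summation and homogeneous equations in a single extension L(y) -/

section SingleStep

variable {U : Type*} [Field U] {σ : U ≃+* U} {L M N : Subfield U} {P Q D : U[X]} {x y α β γ : U}

/-- `r` is the value at `y` of a fraction over `L` whose numerator has smaller degree than its
denominator. -/
def IsProper (L : Subfield U) (y r : U) : Prop :=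
  ∃ R D : U[X], CoeffIn L R ∧ CoeffIn L D ∧ D.Monic ∧ R.degree < D.degree ∧ D.eval y ≠ 0 ∧
    r = R.eval y / D.eval y

theorem IsProper.zero : IsProper L y 0 :=
  ⟨0, 1, coeffIn_zero, coeffIn_one, monic_one, by simp, by simp, by simp⟩

/-- A nonzero proper fraction vanishes at y = ∞, so its inverse has a pole there, whereas q + s is
finite. -/
theorem IsProper.inv_ne (hy : TransOver L y) {r s q : U} (hr : IsProper L y r) (hr0 : r ≠ 0)
    (hs : IsProper L y s) (hq : q ∈ L) : r⁻¹ ≠ q + s := by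
  obtain ⟨R, D, hR, hD, hDm, hdeg, hD0, rfl⟩ := hr
  obtain ⟨S, E, hS, hE, hEm, hdeg', hE0, rfl⟩ := hs
  intro h
  have hR0 : R.eval y ≠ 0 := fun h0 => hr0 (by simp [h0])
  have h1 : D * E - (C q * E + S) * R = 0 := by
    refine hy _ ((hD.mul hE).sub ((((coeffIn_C hq).mul hE).add hS).mul hR)) ?_
    simp only [eval_sub, eval_mul, eval_add, eval_C]
    field_simp at h
    linear_combination h
  have hRne : R ≠ 0 := by rintro rfl; simp at hR0
  have h2 : ((C q * E + S) * R).degree < (D * E).degree := by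
    rw [degree_mul, degree_mul, add_comm]
    refine lt_of_le_of_lt (b := R.degree + E.degree) ?_ ?_
    · refine add_le_add le_rfl ((degree_add_le _ _).trans (max_le (degree_C_mul_le' _ _) hdeg'.le))
    · exact WithBot.add_lt_add_right (by rw [Ne, degree_eq_bot]; exact hEm.ne_zero) hdeg
  rw [sub_eq_zero.1 h1] at h2
  exact lt_irrefl _ h2

/-- Over the difference field `L` the element `y` satisfies `σ y = α y` or `σ y = y + β`. -/
def IsStep (σ : U ≃+* U) (L : Subfield U) (y : U) : Prop :=
  ∃ α ∈ L, ∃ β ∈ L, α ≠ 0 ∧ σ y = α * y + β ∧ (α = 1 ∨ β = 0)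

/-- Over the difference field `L` the element `y` satisfies `σ y = α y` with `α ≠ 0`. -/
def IsPi (σ : U ≃+* U) (L : Subfield U) (y : U) : Prop := ∃ α ∈ L, α ≠ 0 ∧ σ y = α * y

theorem IsPi.isStep (h : IsPi σ L y) : IsStep σ L y := by
  obtain ⟨α, hα, hα0, h⟩ := h
  exact ⟨α, hα, 0, L.zero_mem, hα0, by simpa using h, Or.inr rfl⟩

theorem isStep_of_sub_mem (h : σ y - y ∈ L) : IsStep σ L y :=
  ⟨1, L.one_mem, _, h, one_ne_zero, by ring, Or.inl rfl⟩

theorem IsStep.mono (h : L ≤ M) (hy : IsStep σ L y) : IsStep σ M y := by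
  obtain ⟨α, hα, β, hβ, h1⟩ := hy
  exact ⟨α, h hα, β, h hβ, h1⟩

theorem IsPi.mono (h : L ≤ M) (hy : IsPi σ L y) : IsPi σ M y := by
  obtain ⟨α, hα, h1⟩ := hy
  exact ⟨α, h hα, h1⟩

theorem isStable_closure {Z : Set U} (hL : IsStable σ L) (h1 : ∀ z ∈ Z, IsStep σ L z) :
    IsStable σ (L ⊔ Subfield.closure Z) := by
  have hσ : L ⊔ Subfield.closure Z ≤ (L ⊔ Subfield.closure Z).comap (σ : U →+* U) := by
    refine sup_le (fun a ha => ?_) (Subfield.closure_le.2 fun z hz => ?_)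
    · exact (le_sup_left : L ≤ _) (hL.map_mem ha)
    · obtain ⟨α, hα, β, hβ, -, h, -⟩ := h1 z hz
      change σ z ∈ L ⊔ Subfield.closure Z
      rw [h]
      exact add_mem (mul_mem ((le_sup_left : L ≤ _) hα)
        ((le_sup_right : _ ≤ L ⊔ _) (Subfield.subset_closure hz))) ((le_sup_left : L ≤ _) hβ)
  have hσ' : L ⊔ Subfield.closure Z ≤
      (L ⊔ Subfield.closure Z).comap (σ.symm : U →+* U) := by
    have hs : ∀ {a}, a ∈ L → σ.symm a ∈ L := fun {a} ha => by
      rw [← hL]; simpa using ha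
    refine sup_le (fun a ha => ?_) (Subfield.closure_le.2 fun z hz => ?_)
    · exact (le_sup_left : L ≤ _) (hs ha)
    · obtain ⟨α, hα, β, hβ, hα0, h, -⟩ := h1 z hz
      change σ.symm z ∈ L ⊔ Subfield.closure Z
      have h2 : σ.symm z = (z - σ.symm β) / σ.symm α := by
        have h3 := congrArg σ.symm h
        rw [σ.symm_apply_apply, map_add, map_mul] at h3
        have h4 : σ.symm α ≠ 0 := by simpa using hα0
        field_simp
        linear_combination -h3
      rw [h2]
      exact div_mem (sub_mem ((le_sup_right : _ ≤ L ⊔ _) (Subfield.subset_closure hz))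
        ((le_sup_left : L ≤ _) (hs hβ))) ((le_sup_left : L ≤ _) (hs hα))
  intro a
  refine ⟨fun h => ?_, fun h => hσ h⟩
  have := hσ' h
  simpa using this

theorem IsStep.isStable_adj (hL : IsStable σ L) (hy : IsStep σ L y) : IsStable σ (adj L y) :=
  isStable_closure hL (by simpa using hy)

/-- A twisted summation problem over `L` without homogeneous solutions is solvable in `L(y)` only if
it is solvable in `L`. -/
theorem mem_of_twisted (hL : IsStable σ L) (hy : IsStep σ L y) (hγ : γ ∈ L)
    (hno : ∀ u ∈ adj L y, γ * σ u = u → u = 0) {h : U} (hh : h ∈ adj L y)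
    (he : γ * σ h - h ∈ L) : h ∈ L := by
  by_cases hy0 : y = 0
  · subst hy0; rwa [adj_eq_self L.zero_mem] at hh
  obtain ⟨α, hα, β, hβ, hα0, hσ, hαβ⟩ := hy
  obtain ⟨Q, r, hQ, rfl, hr, hr', hpoly, -⟩ := exists_poly_add hL hσ hα hα0 hβ hγ hh he rfl
  rw [hno r hr' hr, add_zero] at *
  by_cases hN : Q.natDegree = 0
  · rw [eq_C_of_natDegree_eq_zero hN, eval_C]; exact hQ 0
  exfalso
  have h1 := congrArg (fun P => P.coeff Q.natDegree) hpoly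
  simp only [coeff_sub, coeff_C_mul, coeff_act_natDegree hα0, coeff_C, hN, if_false,
    coeff_natDegree] at h1
  -- The leading coefficient (if α = 1), or the whole leading term (if β = 0), is a homogeneous
  -- solution, hence zero by `hno`.
  have hlc : Q.leadingCoeff = 0 := by
    rcases hαβ with rfl | rfl
    · refine hno _ (le_adj (hQ _)) ?_
      linear_combination h1
    · have := hno (Q.leadingCoeff * y ^ Q.natDegree) (mul_mem (le_adj (hQ _))
        (pow_mem self_mem_adj _)) (by rw [map_mul, map_pow, hσ]; linear_combination y ^ _ * h1)
      simpa [hy0] using this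
  rw [leadingCoeff_eq_zero] at hlc
  simp [hlc] at hN

/-- The ratio of two solutions of the same homogeneous equation is a constant. -/
theorem const_div {u v : U} (hu : γ * σ u = u) (hv : γ * σ v = v) (hv0 : v ≠ 0) :
    σ (u / v) = u / v := by
  have hσv : σ v ≠ 0 := by simpa using hv0
  have hγ : γ ≠ 0 := by rintro rfl; simp at hv; exact hv0 hv.symm
  rw [map_div₀]
  conv_rhs => rw [← hu, ← hv]
  rw [mul_div_mul_left _ _ hγ]

/-- By `IsProper.inv_ne`, u and u⁻¹ cannot both be proper fractions, so one of them has a nonzero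
polynomial part. That part solves the same homogeneous equation as a polynomial. -/
theorem exists_poly_of_homogeneous (hL : IsStable σ L) (hy : σ y = α * y + β) (hα : α ∈ L)
    (hα0 : α ≠ 0) (hβ : β ∈ L) (hγ : γ ∈ L) {u : U} (hu : u ∈ adj L y) (hu0 : u ≠ 0)
    (he : γ * σ u = u) :
    ∃ (Q : U[X]) (v δ : U), CoeffIn L Q ∧ δ ∈ L ∧ (v = u ∨ v = u⁻¹) ∧ δ * σ v = v ∧
      C δ * act σ α β Q = Q ∧ Q ≠ 0 := by
  have hσu : σ u ≠ 0 := by simpa using hu0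
  have hγ0 : γ ≠ 0 := by rintro rfl; simp at he; exact hu0 he.symm
  have he' : γ⁻¹ * σ u⁻¹ = u⁻¹ := by rw [map_inv₀, ← mul_inv, he]
  obtain ⟨Q, r, hQ, hQr, hr, hr', hpoly, hrp⟩ :=
    exists_poly_add hL hy hα hα0 hβ hγ hu L.zero_mem (by rw [he, sub_self])
  rw [C_0] at hpoly
  by_cases hQ0 : Q = 0
  swap
  · exact ⟨Q, u, γ, hQ, hγ, Or.inl rfl, he, sub_eq_zero.1 hpoly, hQ0⟩
  obtain ⟨Q', r', hQ', hQr', -, -, hpoly', hrp'⟩ :=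
    exists_poly_add hL hy hα hα0 hβ (L.inv_mem hγ) (inv_mem hu) L.zero_mem
      (by rw [he', sub_self])
  rw [C_0] at hpoly'
  by_cases hQ0' : Q' = 0
  swap
  · exact ⟨Q', u⁻¹, γ⁻¹, hQ', L.inv_mem hγ, Or.inr rfl, he', sub_eq_zero.1 hpoly', hQ0'⟩
  exfalso
  rw [hQ0, eval_zero, zero_add] at hQr
  rw [hQ0', eval_zero] at hQr'
  subst hQr
  rcases hrp with h | ⟨R, D, hR, hD, hDm, hdeg, hD0, hr1, hT⟩
  · exact hu0 h
  refine IsProper.inv_ne hT ⟨R, D, hR, hD, hDm, hdeg, hD0, hr1⟩ hu0 ?_ L.zero_mem hQr'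
  rcases hrp' with h | ⟨R', D', hR', hD', hDm', hdeg', hD0', hr1', -⟩
  · rw [h]; exact IsProper.zero
  · exact ⟨R', D', hR', hD', hDm', hdeg', hD0', hr1'⟩

/-- Homogeneous solutions in `L(y)`, where `y` is a sum over `L`. -/
theorem mem_of_homogeneous_of_sum (hL : IsStable σ L) (hC : ∀ c ∈ adj L y, σ c = c → c ∈ L)
    (hy : σ y - y ∈ L) {u : U} (hu : u ∈ adj L y) (hγ : γ ∈ L) (he : γ * σ u = u) : u ∈ L := by
  by_cases hu0 : u = 0
  · rw [hu0]; exact L.zero_mem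
  obtain ⟨Q, v, δ, hQ, hδ, hvu, hv, hQδ, hQ0⟩ := exists_poly_of_homogeneous hL
    (show σ y = 1 * y + (σ y - y) by ring) L.one_mem one_ne_zero hy hγ hu hu0 he
  -- The leading coefficient satisfies the equation of v, so v is a constant times an element of L.
  have hlc : δ * σ Q.leadingCoeff = Q.leadingCoeff := by
    have := congrArg (fun P => P.coeff Q.natDegree) hQδ
    simpa [coeff_act_natDegree one_ne_zero] using this
  have hlc0 : Q.leadingCoeff ≠ 0 := by simpa using hQ0
  have hvm : v ∈ adj L y := by
    rcases hvu with rfl | rfl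
    exacts [hu, inv_mem hu]
  have hc := hC _ (div_mem hvm (le_adj (hQ _))) (const_div hv hlc hlc0)
  have hvL : v ∈ L := by
    rw [← div_mul_cancel₀ v hlc0]
    exact mul_mem hc (hQ _)
  rcases hvu with rfl | rfl
  exacts [hvL, by simpa using inv_mem hvL]

/-- Summation in `L(y)` of elements of `L`, where `y` is a product over `L`. -/
theorem mem_of_sub_mem_of_pi (hL : IsStable σ L) (hC : ∀ c ∈ adj L y, σ c = c → c ∈ L)
    (hy : IsPi σ L y) {h : U} (hh : h ∈ adj L y) (he : σ h - h ∈ L) : h ∈ L := by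
  obtain ⟨α, hα, hα0, hσ⟩ := hy
  obtain ⟨Q, r, hQ, rfl, hr, hr', hpoly, -⟩ := exists_poly_add hL (show σ y = α * y + 0 by
    rw [hσ, add_zero]) hα hα0 L.zero_mem L.one_mem hh he (by rw [one_mul])
  refine add_mem ?_ (hC _ hr' (by simpa using hr))
  rw [eval_eq_sum_range]
  refine sum_mem fun i _ => ?_
  by_cases hi : i = 0
  · simpa [hi] using hQ 0
  refine hC _ (mul_mem (le_adj (hQ _)) (pow_mem self_mem_adj _)) ?_
  have h1 := congrArg (fun P => P.coeff i) hpoly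
  simp only [coeff_sub, coeff_C_mul, coeff_act_zero_right, coeff_C, hi, if_false] at h1
  rw [map_mul, map_pow, hσ]
  linear_combination y ^ i * h1

section CharZero

variable [CharZero U]

/-- Compare the two top coefficients. The leading coefficient q is a constant, and the next one
satisfies Δ(q_n) = -(n+1) q β, which characteristic zero allows to be solved for β. The hypothesis
`hf` ensures that f does not contribute in degree n. -/
theorem act_second_coeff {f : U} {n : ℕ} (hQ : act σ 1 β Q - Q = C f) (hn : Q.natDegree = n + 1)
    (hf : n ≠ 0 ∨ f = 0) :
    σ (-(Q.coeff n / (Q.natDegree * Q.leadingCoeff))) -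
      -(Q.coeff n / (Q.natDegree * Q.leadingCoeff)) = β := by
  have hlc0 : Q.leadingCoeff ≠ 0 := by
    rw [Ne, leadingCoeff_eq_zero]; rintro rfl; simp at hn
  have h1 := congrArg (fun P => P.coeff Q.natDegree) hQ
  have h2 := congrArg (fun P => P.coeff n) hQ
  have hf' : (C f).coeff n = 0 := by
    rw [coeff_C]
    split_ifs with h
    exacts [hf.resolve_left (not_not.2 h), rfl]
  simp only [coeff_sub, coeff_act_natDegree one_ne_zero, coeff_C, one_pow, one_mul,
    show Q.natDegree ≠ 0 by omega, if_false, coeff_natDegree] at h1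
  simp only [coeff_sub, coeff_act_one_left hn.le, hf', ← hn, coeff_natDegree] at h2
  rw [sub_eq_zero] at h1
  have hn0 : (n + 1 : U) ≠ 0 := by exact_mod_cast Nat.succ_ne_zero n
  rw [map_neg, map_div₀, map_mul, map_natCast, h1, hn]
  rw [h1] at h2
  push_cast
  field_simp
  linear_combination -h2

/-- Summation in `L(y)` of elements of `L`, where `y` is a sum over `L`. -/
theorem exists_eq_mul_add_of_sub_mem (hL : IsStable σ L)
    (hC : ∀ c ∈ adj L y, σ c = c → c ∈ L) (hy : σ y - y ∈ L) {h : U} (hh : h ∈ adj L y)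
    (he : σ h - h ∈ L) : ∃ c ∈ L, σ c = c ∧ ∃ l ∈ L, h = c * y + l := by
  by_cases hyL : y ∈ L
  · rw [adj_eq_self hyL] at hh
    exact ⟨0, L.zero_mem, map_zero _, h, hh, by ring⟩
  obtain ⟨Q, r, hQ, rfl, hr, hr', hpoly, -⟩ := exists_poly_add hL
    (show σ y = 1 * y + (σ y - y) by ring) L.one_mem one_ne_zero hy L.one_mem hh he
      (by rw [one_mul])
  rw [C_1, one_mul] at hpoly
  have hN : Q.natDegree ≤ 1 := by
    by_contra hcon
    obtain ⟨n, hn⟩ : ∃ n, Q.natDegree = n + 1 := ⟨Q.natDegree - 1, by omega⟩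
    have h2 := act_second_coeff hpoly hn (Or.inl (by omega))
    set w := -(Q.coeff n / (Q.natDegree * Q.leadingCoeff))
    have hw : w ∈ L := neg_mem (div_mem (hQ _) (mul_mem (natCast_mem _ _) (hQ _)))
    have := hC (y - w) (sub_mem self_mem_adj (le_adj hw)) (by rw [map_sub]; linear_combination -h2)
    exact hyL (by simpa using add_mem this hw)
  have hQ1 : Q.eval y = Q.coeff 1 * y + Q.coeff 0 := by
    rw [eval_eq_sum_range' (Nat.lt_succ_of_le hN), Finset.sum_range_succ, Finset.sum_range_one]
    ring
  refine ⟨Q.coeff 1, hQ 1, ?_, Q.coeff 0 + r, add_mem (hQ 0) (hC _ hr' (by simpa using hr)), ?_⟩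
  · have h1 := congrArg (fun P => P.coeff 1) hpoly
    simp only [coeff_sub, coeff_act_of_le one_ne_zero hN, coeff_C, one_pow, one_mul,
      one_ne_zero, if_false] at h1
    exact sub_eq_zero.1 h1
  · rw [hQ1]; ring

/-- If `σ y - y` is not summable in `L`, then `L(y)` has no new constants. -/
theorem const_mem_of_not_summable (hL : IsStable σ L) (hy : σ y - y ∈ L)
    (hns : ∀ w ∈ L, σ w - w ≠ σ y - y) {c : U} (hc : c ∈ adj L y) (hσc : σ c = c) : c ∈ L := by
  have key : ∀ {c}, c ∈ adj L y → σ c = c → ∃ q ∈ L, ∃ r, c = q + r ∧ σ r = r ∧ r ∈ adj L y ∧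
      (r = 0 ∨ TransOver L y ∧ IsProper L y r) := by
    intro c hc hσc
    obtain ⟨Q, r, hQ, rfl, hr, hr', hpoly, hrp⟩ := exists_poly_add hL
      (show σ y = 1 * y + (σ y - y) by ring) L.one_mem one_ne_zero hy L.one_mem hc L.zero_mem
        (by rw [one_mul, hσc, sub_self])
    have hN : Q.natDegree = 0 := by
      by_contra hcon
      rw [C_1, one_mul] at hpoly
      obtain ⟨n, hn⟩ : ∃ n, Q.natDegree = n + 1 := ⟨Q.natDegree - 1, by omega⟩
      exact hns _ (neg_mem (div_mem (hQ n) (mul_mem (natCast_mem _ _) (hQ _))))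
        (act_second_coeff hpoly hn (Or.inr rfl))
    refine ⟨Q.coeff 0, hQ 0, r, ?_, by simpa using hr, hr', ?_⟩
    · conv_lhs => rw [eq_C_of_natDegree_eq_zero hN, eval_C]
    · rcases hrp with h | ⟨R, D, hR, hD, hDm, hdeg, hD0, hr1, hT⟩
      exacts [Or.inl h, Or.inr ⟨hT, R, D, hR, hD, hDm, hdeg, hD0, hr1⟩]
  obtain ⟨q, hq, r, rfl, hr, hr', hrp⟩ := key hc hσc
  by_cases hr0 : r = 0
  · rwa [hr0, add_zero]
  -- Since r⁻¹ is again a constant, `key` writes it as an element of L plus a proper fraction or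
  -- zero, contradicting `IsProper.inv_ne`.
  obtain ⟨hT, hprop⟩ := hrp.resolve_left hr0
  obtain ⟨q', hq', r', h', -, -, hrp'⟩ := key (inv_mem hr') (by rw [map_inv₀, hr])
  refine absurd h' (hprop.inv_ne hT hr0 ?_ hq')
  rcases hrp' with rfl | h
  exacts [IsProper.zero, h.2]

/-- A sum over `L` which is algebraic over `L` differs from an element of `L` by a constant. -/
theorem exists_summable_of_not_transOver (hL : IsStable σ L) (hy : σ y - y ∈ L)
    (hT : ¬ TransOver L y) : ∃ w ∈ L, σ w - w = σ y - y := by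
  obtain ⟨m, hm, hmm, hm0, hmin, -⟩ := exists_minpoly_of_not_transOver hT
  have hσ : σ y = 1 * y + (σ y - y) := by ring
  have hN : m.natDegree ≠ 0 := fun h => by simp [hmm.natDegree_eq_zero.1 h] at hm0
  obtain ⟨n, hn⟩ : ∃ n, m.natDegree = n + 1 := ⟨m.natDegree - 1, by omega⟩
  -- Both polynomials are monic of the same degree and vanish at y, so minimality of m makes them
  -- equal; the second coefficient then exhibits a sum.
  have hzero : act σ 1 (σ y - y) m - m = 0 := by
    refine hmin _ ((hm.act hL L.one_mem hy).sub hm) ?_ ?_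
    · rw [eval_sub, eval_act hσ, hm0, map_zero, sub_zero]
    · refine (degree_sub_lt_left (degree_act one_ne_zero) ?_ ?_).trans_le (degree_act one_ne_zero).le
      · rw [Ne, act_eq_zero_iff one_ne_zero]; exact hmm.ne_zero
      · rw [leadingCoeff, natDegree_act one_ne_zero, coeff_act_natDegree one_ne_zero,
          hmm.leadingCoeff]
        simp
  have h2 := congrArg (fun P => P.coeff n) hzero
  simp only [coeff_sub, coeff_act_one_left hn.le, ← hn, hmm.coeff_natDegree, coeff_zero,
    map_one, mul_one] at h2
  have hn0 : (n + 1 : U) ≠ 0 := by exact_mod_cast Nat.succ_ne_zero n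
  refine ⟨-(m.coeff n / (n + 1 : ℕ)), neg_mem (div_mem (hm _) (natCast_mem _ _)), ?_⟩
  rw [map_neg, map_div₀, map_natCast]
  push_cast
  field_simp
  linear_combination -h2

theorem mem_or_transOver (hL : IsStable σ L) (hC : ∀ c, σ c = c → c ∈ L) (hy : σ y - y ∈ L) :
    y ∈ L ∨ TransOver L y := by
  by_cases hT : TransOver L y
  · exact Or.inr hT
  obtain ⟨w, hw, h⟩ := exists_summable_of_not_transOver hL hy hT
  have := hC (y - w) (by rw [map_sub]; linear_combination -h)
  exact Or.inl (by simpa using add_mem this hw)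

end CharZero

/-- With m the minimal polynomial and k its degree, uniqueness gives act(m) = α^k m. The constant
term m₀ is nonzero and satisfies σ(m₀) = α^k m₀, so y^k / m₀ is a constant. -/
theorem exists_pow_mem_of_not_transOver (hL : IsStable σ L) (hC : ∀ c, σ c = c → c ∈ L)
    (hy : IsPi σ L y) (hy0 : y ≠ 0) (hT : ¬ TransOver L y) : ∃ k : ℕ, k ≠ 0 ∧ y ^ k ∈ L := by
  obtain ⟨α, hα, hα0, hσ⟩ := hy
  obtain ⟨m, hm, hmm, hm0, hmin, -⟩ := exists_minpoly_of_not_transOver hT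
  have hσ' : σ y = α * y + 0 := by rw [hσ, add_zero]
  have hN : m.natDegree ≠ 0 := fun h => by simp [hmm.natDegree_eq_zero.1 h] at hm0
  have hzero : act σ α 0 m - C (α ^ m.natDegree) * m = 0 := by
    refine hmin _ ((hm.act hL hα L.zero_mem).sub ((coeffIn_C (pow_mem hα _)).mul hm)) ?_ ?_
    · rw [eval_sub, eval_mul, eval_act hσ', hm0, map_zero, mul_zero, sub_zero]
    · refine (degree_sub_lt_left ?_ ?_ ?_).trans_le (degree_act hα0).le
      · rw [degree_act hα0, degree_C_mul (pow_ne_zero _ hα0)]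
      · rw [Ne, act_eq_zero_iff hα0]; exact hmm.ne_zero
      · rw [leadingCoeff, natDegree_act hα0, coeff_act_natDegree hα0, hmm.leadingCoeff,
          leadingCoeff_mul, leadingCoeff_C, hmm.leadingCoeff]
        simp
  have hm00 : m.coeff 0 ≠ 0 := by
    intro h0
    obtain ⟨q, hq⟩ := X_dvd_iff.2 h0
    have hqm : q.Monic := by
      rw [hq] at hmm
      exact Monic.of_mul_monic_left monic_X hmm
    have hqin : CoeffIn L q := fun i => by
      have := hm (i + 1)
      rwa [hq, coeff_X_mul] at this
    have hq0 : q = 0 := by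
      refine hmin q hqin ?_ ?_
      · rw [hq, eval_mul, eval_X] at hm0
        exact (mul_eq_zero.1 hm0).resolve_left hy0
      · rw [hq, degree_mul, degree_X, degree_eq_natDegree hqm.ne_zero]
        exact_mod_cast (by omega : q.natDegree < 1 + q.natDegree)
    exact hqm.ne_zero hq0
  have h2 := congrArg (fun P => P.coeff 0) hzero
  simp only [coeff_sub, coeff_act_zero_right, coeff_C_mul, pow_zero, one_mul, coeff_zero] at h2
  refine ⟨m.natDegree, hN, ?_⟩
  have h3 := hC (y ^ m.natDegree / m.coeff 0) (by
    rw [map_div₀, map_pow, hσ, sub_eq_zero.1 h2, mul_pow]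
    exact mul_div_mul_left _ _ (pow_ne_zero _ hα0))
  simpa [hm00] using mul_mem h3 (hm 0)

end SingleStep

end DiffAlg

namespace DiffAlg

open Polynomial

/-! ### Adjoining arbitrary sets of sums and products -/

section Sets

variable {U : Type*} [Field U] {σ : U ≃+* U} {L M N B : Subfield U} {Z : Set U} {x y α β γ : U}

theorem exists_finset_of_mem_sup_closure {h : U} (hh : h ∈ L ⊔ Subfield.closure Z) :
    ∃ t : Finset U, (t : Set U) ⊆ Z ∧ h ∈ L ⊔ Subfield.closure (t : Set U) := by
  classical
  rw [← Subfield.closure_eq L, ← Subfield.closure_union] at hh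
  have mono : ∀ {s t : Finset U}, s ⊆ t → L ⊔ Subfield.closure (s : Set U) ≤
      L ⊔ Subfield.closure (t : Set U) := fun h =>
    sup_le_sup_left (Subfield.closure_mono (by exact_mod_cast h)) _
  induction hh using Subfield.closure_induction with
  | mem a ha =>
    rcases ha with ha | ha
    · exact ⟨∅, by simp, (le_sup_left : L ≤ _) ha⟩
    · exact ⟨{a}, by simpa using ha, (le_sup_right : _ ≤ L ⊔ _) (Subfield.subset_closure (by simp))⟩
  | one => exact ⟨∅, by simp, one_mem _⟩
  | add a b _ _ iha ihb =>
    obtain ⟨s, hs, ha⟩ := iha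
    obtain ⟨t, ht, hb⟩ := ihb
    exact ⟨s ∪ t, by simp [hs, ht], add_mem (mono Finset.subset_union_left ha)
      (mono Finset.subset_union_right hb)⟩
  | neg a _ iha =>
    obtain ⟨s, hs, ha⟩ := iha
    exact ⟨s, hs, neg_mem ha⟩
  | inv a _ iha =>
    obtain ⟨s, hs, ha⟩ := iha
    exact ⟨s, hs, inv_mem ha⟩
  | mul a b _ _ iha ihb =>
    obtain ⟨s, hs, ha⟩ := iha
    obtain ⟨t, ht, hb⟩ := ihb
    exact ⟨s ∪ t, by simp [hs, ht], mul_mem (mono Finset.subset_union_left ha)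
      (mono Finset.subset_union_right hb)⟩

theorem sup_closure_insert : L ⊔ Subfield.closure (insert x Z) = adj (L ⊔ Subfield.closure Z) x := by
  rw [Set.insert_eq, Subfield.closure_union, sup_comm (Subfield.closure {x}), ← sup_assoc]

theorem sup_adj : M ⊔ adj N x = adj (M ⊔ N) x := (sup_assoc _ _ _).symm

theorem isStep_of_sub_mem_or_isPi (h : σ x - x ∈ L ∨ IsPi σ L x) : IsStep σ L x :=
  h.elim isStep_of_sub_mem IsPi.isStep

theorem mem_of_twisted_closure (hL : IsStable σ L) (hZ : ∀ z ∈ Z, IsStep σ L z) (hγ : γ ∈ L)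
    (hno : ∀ u ∈ L ⊔ Subfield.closure Z, γ * σ u = u → u = 0) {h : U}
    (hh : h ∈ L ⊔ Subfield.closure Z) (he : γ * σ h - h ∈ L) : h ∈ L := by
  classical
  obtain ⟨t, ht, hh⟩ := exists_finset_of_mem_sup_closure hh
  induction t using Finset.induction_on with
  | empty => simpa using hh
  | insert z t _ ih =>
    rw [Finset.coe_insert, Set.insert_subset_iff] at ht
    rw [Finset.coe_insert, sup_closure_insert] at hh
    refine ih ht.2 (mem_of_twisted (isStable_closure hL fun z hz => hZ z (ht.2 hz))
      ((hZ z ht.1).mono le_sup_left) ((le_sup_left : L ≤ _) hγ) (fun u hu => hno u ?_) hh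
      ((le_sup_left : L ≤ _) he))
    rw [← sup_closure_insert] at hu
    exact sup_le_sup_left (Subfield.closure_mono (Set.insert_subset ht.1 ht.2)) L hu

/-- Removing one generator z at a time, a sum contributes c z with c constant and a product
contributes nothing. All constants lie in B, so Δ(c z) stays in B when Δz is there. -/
theorem exists_eq_add_of_sub_mem_closure [CharZero U] (hL : IsStable σ L) (hBL : B ≤ L)
    (hC : ∀ c, σ c = c → c ∈ B) (hZ : ∀ z ∈ Z, σ z - z ∈ B ∨ IsPi σ L z) {h : U}
    (hh : h ∈ L ⊔ Subfield.closure Z) (he : σ h - h ∈ L) :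
    ∃ l ∈ L, ∃ y, σ y - y ∈ B ∧ h = l + y := by
  classical
  obtain ⟨t, ht, hh'⟩ := exists_finset_of_mem_sup_closure hh
  clear hh
  have hst : ∀ {z}, z ∈ Z → IsStep σ L z := fun hz =>
    isStep_of_sub_mem_or_isPi ((hZ _ hz).imp_left fun h => hBL h)
  induction t using Finset.induction_on generalizing h with
  | empty => exact ⟨h, by simpa using hh', 0, by simp, by simp⟩
  | insert z t _ ih =>
    rw [Finset.coe_insert, Set.insert_subset_iff] at ht
    rw [Finset.coe_insert, sup_closure_insert] at hh'
    have hLt := isStable_closure hL fun z hz => hst (ht.2 hz)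
    have hCt : ∀ c ∈ adj (L ⊔ Subfield.closure (t : Set U)) z, σ c = c →
        c ∈ L ⊔ Subfield.closure (t : Set U) := fun c _ h => (le_sup_left : L ≤ _) (hBL (hC c h))
    rcases hZ z ht.1 with hz | hz
    · obtain ⟨c, -, hc, l, hl, rfl⟩ := exists_eq_mul_add_of_sub_mem hLt hCt
        ((le_sup_left : L ≤ _) (hBL hz)) hh' ((le_sup_left : L ≤ _) he)
      have hcz : σ (c * z) - c * z ∈ B := by
        rw [map_mul, hc, ← mul_sub]; exact mul_mem (hC c hc) hz
      obtain ⟨l', hl', y, hy, rfl⟩ := ih (h := l) (by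
        have := sub_mem he (hBL hcz)
        rw [map_add] at this
        convert this using 1; ring) ht.2 hl
      refine ⟨l', hl', c * z + y, ?_, by ring⟩
      have := add_mem hcz hy
      rw [map_add]
      convert this using 1; ring
    · exact ih he ht.2 (mem_of_sub_mem_of_pi hLt hCt (hz.mono le_sup_left) hh'
        ((le_sup_left : L ≤ _) he))

theorem mem_of_homogeneous_closure [CharZero U] (hL : IsStable σ L) (hC : ∀ c, σ c = c → c ∈ L)
    (hZ : ∀ z ∈ Z, σ z - z ∈ L) (hγ : γ ∈ L) {u : U} (hu : u ∈ L ⊔ Subfield.closure Z)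
    (he : γ * σ u = u) : u ∈ L := by
  classical
  obtain ⟨t, ht, hu⟩ := exists_finset_of_mem_sup_closure hu
  induction t using Finset.induction_on with
  | empty => simpa using hu
  | insert z t _ ih =>
    rw [Finset.coe_insert, Set.insert_subset_iff] at ht
    rw [Finset.coe_insert, sup_closure_insert] at hu
    exact ih ht.2 (mem_of_homogeneous_of_sum
      (isStable_closure hL fun z hz => isStep_of_sub_mem (hZ z (ht.2 hz)))
      (fun c _ h => (le_sup_left : L ≤ _) (hC c h)) ((le_sup_left : L ≤ _) (hZ z ht.1)) hu
      ((le_sup_left : L ≤ _) hγ) he)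

end Sets

/-! ### Values and expansions at infinity -/

section Residue

variable {U : Type*} [Field U] {σ : U ≃+* U} {L M N : Subfield U} {x y α β γ h k u v : U}

/-- The element `h` of `N(x)` has no pole at `x = ∞`, and its value there is `u`. -/
def Res (N : Subfield U) (x h u : U) : Prop :=
  ∃ A D : U[X], CoeffIn N A ∧ CoeffIn N D ∧ D.Monic ∧ D.eval x ≠ 0 ∧
    A.natDegree ≤ D.natDegree ∧ h = A.eval x / D.eval x ∧ u = A.coeff D.natDegree

theorem Res.mem (hr : Res N x h u) : u ∈ N := by
  obtain ⟨A, D, hA, -, -, -, -, -, rfl⟩ := hr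
  exact hA _

theorem Res.const (hu : u ∈ N) : Res N x u u :=
  ⟨C u, 1, coeffIn_C hu, coeffIn_one, monic_one, by simp, by simp, by simp, by simp⟩

theorem Res.sub (hr : Res N x h u) (hs : Res N x k v) : Res N x (h - k) (u - v) := by
  obtain ⟨A, D, hA, hD, hDm, hD0, hAD, rfl, rfl⟩ := hr
  obtain ⟨A', D', hA', hD', hDm', hD0', hAD', rfl, rfl⟩ := hs
  refine ⟨A * D' - D * A', D * D', (hA.mul hD').sub (hD.mul hA'), hD.mul hD', hDm.mul hDm',
    by simp [hD0, hD0'], ?_, ?_, ?_⟩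
  · rw [hDm.natDegree_mul hDm']
    exact (natDegree_sub_le _ _).trans (max_le (natDegree_mul_le.trans (by gcongr))
      (natDegree_mul_le.trans (by gcongr)))
  · rw [eval_sub, eval_mul, eval_mul, eval_mul, div_sub_div _ _ hD0 hD0']
  · rw [hDm.natDegree_mul hDm', coeff_sub, coeff_mul_add_eq_of_natDegree_le hAD le_rfl,
      coeff_mul_add_eq_of_natDegree_le le_rfl hAD', hDm.coeff_natDegree, hDm'.coeff_natDegree,
      one_mul, mul_one]

theorem Res.mul (hr : Res N x h u) (hs : Res N x k v) : Res N x (h * k) (u * v) := by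
  obtain ⟨A, D, hA, hD, hDm, hD0, hAD, rfl, rfl⟩ := hr
  obtain ⟨A', D', hA', hD', hDm', hD0', hAD', rfl, rfl⟩ := hs
  refine ⟨A * A', D * D', hA.mul hA', hD.mul hD', hDm.mul hDm', by simp [hD0, hD0'], ?_, ?_, ?_⟩
  · rw [hDm.natDegree_mul hDm']
    exact natDegree_mul_le.trans (by gcongr)
  · rw [eval_mul, eval_mul, div_mul_div_comm]
  · rw [hDm.natDegree_mul hDm', coeff_mul_add_eq_of_natDegree_le hAD hAD']

theorem Res.inv (hx : TransOver N x) (hr : Res N x h u) (hu : u ≠ 0) : Res N x h⁻¹ u⁻¹ := by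
  obtain ⟨A, D, hA, hD, hDm, hD0, hAD, rfl, rfl⟩ := hr
  have hdeg : A.natDegree = D.natDegree := le_antisymm hAD (le_natDegree_of_ne_zero hu)
  rw [← hdeg, coeff_natDegree] at hu ⊢
  have hA0 : A ≠ 0 := by rintro rfl; simp at hu
  have hAe : A.eval x ≠ 0 := fun h0 => hA0 (hx _ hA h0)
  have hlc : A.leadingCoeff⁻¹ ∈ N := inv_mem (hA _)
  have hnd : (C A.leadingCoeff⁻¹ * A).natDegree = A.natDegree :=
    natDegree_C_mul (inv_ne_zero hu)
  refine ⟨C A.leadingCoeff⁻¹ * D, C A.leadingCoeff⁻¹ * A, (coeffIn_C hlc).mul hD,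
    (coeffIn_C hlc).mul hA, ?_, ?_, ?_, ?_, ?_⟩
  · rw [mul_comm]; exact monic_mul_leadingCoeff_inv hA0
  · simp [hAe, hA0]
  · rw [hnd, hdeg]; exact natDegree_C_mul_le _ _
  · rw [eval_mul, eval_mul, eval_C, mul_div_mul_left _ _ (inv_ne_zero hu), inv_div]
  · rw [hnd, coeff_C_mul, hdeg, hDm.coeff_natDegree, mul_one]

theorem Res.pow (hr : Res N x h u) (n : ℕ) : Res N x (h ^ n) (u ^ n) := by
  induction n with
  | zero => simpa using Res.const N.one_mem
  | succ n ih => rw [pow_succ, pow_succ]; exact ih.mul hr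

theorem Res.zpow (hx : TransOver N x) (hr : Res N x h u) (hu : u ≠ 0) (n : ℤ) :
    Res N x (h ^ n) (u ^ n) := by
  obtain ⟨m, rfl | rfl⟩ := n.eq_nat_or_neg
  · simpa using hr.pow m
  · simpa using (hr.pow m).inv hx (pow_ne_zero m hu)

theorem TransOver.ne_zero (hx : TransOver N x) : x ≠ 0 := by
  intro h
  exact X_ne_zero (hx X coeffIn_X (by simp [h]))

theorem Res.self_mul (hr : Res N x h 0) : ∃ v, Res N x (x * h) v := by
  obtain ⟨A, D, hA, hD, hDm, hD0, hAD, rfl, h0⟩ := hr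
  refine ⟨_, X * A, D, coeffIn_X.mul hA, hD, hDm, hD0, ?_, by simp [mul_div_assoc], rfl⟩
  rcases hAD.eq_or_lt with h | h
  · have hA0 : A = 0 := by
      rw [← h, coeff_natDegree] at h0
      exact leadingCoeff_eq_zero.1 h0.symm
    simp [hA0]
  · refine natDegree_mul_le.trans ?_
    rw [natDegree_X]; omega

theorem exists_res_zpow (hx : TransOver N x) (hh : h ∈ adj N x) :
    ∃ (m : ℕ) (u : U), Res N x (x ^ (-(m : ℤ)) * h) u := by
  obtain ⟨A, D, hA, hD, hDm, hD0, rfl⟩ := exists_eq_div_of_mem_adj hh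
  refine ⟨A.natDegree, _, A, X ^ A.natDegree * D, hA, (coeffIn_X.pow _).mul hD,
    (monic_X_pow _).mul hDm, by simp [hx.ne_zero, hD0], ?_, ?_, rfl⟩
  · rw [(monic_X_pow _).natDegree_mul hDm, natDegree_X_pow]; omega
  · rw [eval_mul, eval_pow, eval_X, zpow_neg, zpow_natCast]
    field_simp

theorem Res.map (hN : IsStable σ N) (hα : α ∈ N) (hα0 : α ≠ 0) (hβ : β ∈ N)
    (hσ : σ x = α * x + β) (hr : Res N x h u) : Res N x (σ h) (σ u) := by
  obtain ⟨A, D, hA, hD, hDm, hD0, hAD, rfl, rfl⟩ := hr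
  have hp : (α ^ D.natDegree)⁻¹ ∈ N := inv_mem (pow_mem hα _)
  have hp0 : (α ^ D.natDegree)⁻¹ ≠ 0 := inv_ne_zero (pow_ne_zero _ hα0)
  refine ⟨C (α ^ D.natDegree)⁻¹ * act σ α β A, C (α ^ D.natDegree)⁻¹ * act σ α β D,
    (coeffIn_C hp).mul (hA.act hN hα hβ), (coeffIn_C hp).mul (hD.act hN hα hβ), ?_, ?_, ?_, ?_, ?_⟩
  · rw [Monic, leadingCoeff_mul, leadingCoeff_C, leadingCoeff, natDegree_act hα0,
      coeff_act_natDegree hα0, hDm.leadingCoeff, map_one, mul_one,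
      inv_mul_cancel₀ (pow_ne_zero _ hα0)]
  · rw [eval_mul, eval_C, eval_act hσ]
    exact mul_ne_zero hp0 (by simpa using hD0)
  · rw [natDegree_C_mul hp0, natDegree_C_mul hp0, natDegree_act hα0, natDegree_act hα0]
    exact hAD
  · rw [eval_mul, eval_mul, eval_act hσ, eval_act hσ, eval_C, mul_div_mul_left _ _ hp0, map_div₀]
  · rw [natDegree_C_mul hp0, natDegree_act hα0, coeff_C_mul, coeff_act_of_le hα0 hAD,
      inv_mul_cancel_left₀ (pow_ne_zero _ hα0)]

/-- Transcendence makes the value at infinity independent of the chosen fraction, so it may be read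
off a fraction over M. -/
theorem Res.mem_of_mem_adj (hMN : M ≤ N) (hx : TransOver N x) (hr : Res N x h u)
    (hh : h ∈ adj M x) : u ∈ M := by
  obtain ⟨A, D, hA, hD, hDm, hD0, hAD, rfl, rfl⟩ := hr
  obtain ⟨P, E, hP, hE, hEm, hE0, he⟩ := exists_eq_div_of_mem_adj hh
  have h1 : A * E = P * D := by
    rw [← sub_eq_zero]
    refine hx _ ((hA.mul (hE.mono hMN)).sub ((hP.mono hMN).mul hD)) ?_
    rw [div_eq_div_iff hD0 hE0] at he
    rw [eval_sub, eval_mul, eval_mul, he, sub_self]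
  have hPE : P.natDegree ≤ E.natDegree := by
    have h2 : (A * E).natDegree ≤ D.natDegree + E.natDegree :=
      natDegree_mul_le.trans (by gcongr)
    by_cases hP0 : P = 0
    · simp [hP0]
    rw [h1, natDegree_mul hP0 hDm.ne_zero] at h2
    omega
  have h3 := congrArg (fun Q => Q.coeff (D.natDegree + E.natDegree)) h1
  rw [coeff_mul_add_eq_of_natDegree_le hAD le_rfl, add_comm D.natDegree,
    coeff_mul_add_eq_of_natDegree_le hPE le_rfl, hEm.coeff_natDegree, hDm.coeff_natDegree, mul_one,
    mul_one] at h3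
  rw [h3]
  exact hP _

theorem exists_retraction (M : Subfield U) :
    ∃ μ : U →+ U, μ 1 = 1 ∧ (∀ u, μ u ∈ M) ∧ ∀ a ∈ M, ∀ u, μ (a * u) = a * μ u := by
  obtain ⟨g, hg⟩ := LinearMap.exists_leftInverse_of_injective (Algebra.linearMap M U)
    (LinearMap.ker_eq_bot.2 (algebraMap M U).injective)
  refine ⟨M.subtype.toAddMonoidHom.comp g.toAddMonoidHom, ?_, fun u => (g u).2, fun a ha u => ?_⟩
  · have := LinearMap.congr_fun hg 1
    simp only [LinearMap.comp_apply, Algebra.linearMap_apply, map_one, LinearMap.id_apply] at this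
    simp [this]
  · have : g ((⟨a, ha⟩ : M) • u) = (⟨a, ha⟩ : M) • g u := map_smul g _ _
    exact congrArg M.subtype this

theorem exists_coeff_map (μ : U →+ U) (P : U[X]) : ∃ P' : U[X], ∀ i, P'.coeff i = μ (P.coeff i) := by
  refine ⟨∑ i ∈ Finset.range (P.natDegree + 1), monomial i (μ (P.coeff i)), fun i => ?_⟩
  simp only [finsetSum_coeff, coeff_monomial]
  rw [Finset.sum_ite_eq']
  split_ifs with h
  · rfl
  · rw [coeff_eq_zero_of_natDegree_lt (by simpa [Nat.lt_succ_iff] using h), map_zero]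

/-- If the expansion at `x = ∞` of `h ∈ N(x)` has its coefficients in `M`, then `h ∈ M(x)`. -/
theorem mem_adj_of_approx (hMN : M ≤ N) (hx : TransOver N x) (hh : h ∈ adj N x)
    (happ : ∀ K : ℕ, ∃ S : U[X], CoeffIn M S ∧ ∃ u, Res N x (x ^ K * h - S.eval x) u) :
    h ∈ adj M x := by
  obtain ⟨R, D, hR, hD, hDm, hD0, rfl⟩ := exists_eq_div_of_mem_adj hh
  set n := D.natDegree with hn
  obtain ⟨S, hS, u, A, E, hA, hE, hEm, hE0, hAE, he, -⟩ := happ (2 * n + 1)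
  set K := 2 * n + 1
  have h1 : (X ^ K * R - D * S) * E = A * D := by
    rw [← sub_eq_zero]
    refine hx _ (((((coeffIn_X.pow _).mul hR).sub (hD.mul (hS.mono hMN))).mul hE).sub
      (hA.mul hD)) ?_
    field_simp at he
    simp only [eval_sub, eval_mul, eval_pow, eval_X]
    linear_combination he
  have hdeg : (X ^ K * R - D * S).natDegree ≤ n := by
    by_cases h0 : X ^ K * R - D * S = 0
    · simp [h0]
    have h2 : (A * D).natDegree ≤ E.natDegree + n := natDegree_mul_le.trans (by gcongr)
    rw [← h1, natDegree_mul h0 hEm.ne_zero] at h2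
    omega
  -- Project the coefficients of numerator and denominator to M by an M-linear map. As S already has
  -- coefficients in M, the same S approximates the projected fraction equally well.
  obtain ⟨μ, hμ1, hμM, hμ⟩ := exists_retraction M
  obtain ⟨R', hR'⟩ := exists_coeff_map μ R
  obtain ⟨D', hD'⟩ := exists_coeff_map μ D
  have hR'in : CoeffIn M R' := fun i => hR' i ▸ hμM _
  have hD'in : CoeffIn M D' := fun i => hD' i ▸ hμM _
  have hD'n : D'.natDegree ≤ n := natDegree_le_iff_coeff_eq_zero.2 fun i hi => by
    rw [hD', coeff_eq_zero_of_natDegree_lt hi, map_zero]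
  have hD'm : D'.Monic := monic_of_natDegree_le_of_coeff_eq_one n hD'n (by
    rw [hD', hn, hDm.coeff_natDegree, hμ1])
  have hcoeff : ∀ i, (X ^ K * R' - D' * S).coeff i = μ ((X ^ K * R - D * S).coeff i) := by
    intro i
    rw [coeff_sub, coeff_sub, map_sub, coeff_X_pow_mul', coeff_X_pow_mul', coeff_mul, coeff_mul,
      map_sum]
    congr 1
    · split_ifs
      exacts [hR' _, (map_zero μ).symm]
    · refine Finset.sum_congr rfl fun p _ => ?_
      rw [hD', mul_comm, mul_comm (D.coeff _), hμ _ (hS _)]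
  have hdeg' : (X ^ K * R' - D' * S).natDegree ≤ n := natDegree_le_iff_coeff_eq_zero.2 fun i hi => by
    rw [hcoeff, coeff_eq_zero_of_natDegree_lt (hdeg.trans_lt hi), map_zero]
  have h2 : X ^ K * (D' * R - D * R') =
      D' * (X ^ K * R - D * S) - D * (X ^ K * R' - D' * S) := by ring
  -- By `h2` the product of this difference with X^K has degree at most 2n, which is less than K =
  -- 2n + 1.
  have h3 : D' * R - D * R' = 0 := by
    by_contra h0
    have h4 := congrArg natDegree h2
    rw [natDegree_mul (pow_ne_zero _ X_ne_zero) h0, natDegree_X_pow] at h4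
    have h5 : (D' * (X ^ K * R - D * S) - D * (X ^ K * R' - D' * S)).natDegree ≤ n + n :=
      (natDegree_sub_le _ _).trans (max_le (natDegree_mul_le.trans (by gcongr))
        (natDegree_mul_le.trans (by gcongr)))
    omega
  have hD'0 : D'.eval x ≠ 0 := fun h0 => hD'm.ne_zero (hx _ (hD'in.mono hMN) h0)
  have h4 : R.eval x / D.eval x = R'.eval x / D'.eval x := by
    rw [div_eq_div_iff hD0 hD'0]
    have := congrArg (eval x) h3
    simp only [eval_sub, eval_mul, eval_zero] at this
    linear_combination this
  rw [h4]
  exact div_mem hR'in.eval_mem_adj hD'in.eval_mem_adj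

end Residue

end DiffAlg

namespace DiffAlg

open Polynomial

/-! ### Descent through a transcendental variable -/

section Descent

variable {U : Type*} [Field U] {σ : U ≃+* U} {L M N W : Subfield U} {Z : Set U}
  {x y α β γ h u v : U}

/-- The quotient σ(x)/x has value α at infinity, so applying σ turns the coefficient u of x^k into
α^k σ(u). -/
theorem Res.zpow_mul_map (hN : IsStable σ N) (hx : TransOver N x) (hα : α ∈ N) (hα0 : α ≠ 0)
    (hβ : β ∈ N) (hσ : σ x = α * x + β) {k : ℤ} (hr : Res N x (x ^ (-k) * h) u) :
    Res N x (x ^ (-k) * σ h) (α ^ k * σ u) := by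
  have hx0 := hx.ne_zero
  have hσx : σ x ≠ 0 := by simpa using hx0
  have h1 : Res N x (σ x / x) α := by
    refine ⟨C α * X + C β, X, ((coeffIn_C hα).mul coeffIn_X).add (coeffIn_C hβ), coeffIn_X, monic_X,
      by simpa, ?_, by simp [hσ], by simp⟩
    rw [natDegree_linear hα0, natDegree_X]
  have h2 := (h1.zpow hx hα0 k).mul (hr.map hN hα hα0 hβ hσ)
  convert h2 using 1
  rw [map_mul, map_zpow₀, div_zpow, zpow_neg, zpow_neg]
  have := zpow_ne_zero k hσx
  field_simp

/-- If u x^k bounds the expansion of h at infinity, then α^k σ(u) - u is the corresponding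
coefficient of Δh, hence in M, and `hk` puts u in M. Subtract u x^k and repeat: all coefficients lie
in M, and `mem_adj_of_approx` applies. -/
theorem mem_adj_of_sub_mem (hM : IsStable σ M) (hN : IsStable σ N) (hMN : M ≤ N)
    (hx : TransOver N x) (hα : α ∈ M) (hα0 : α ≠ 0) (hβ : β ∈ M) (hσ : σ x = α * x + β)
    (hαβ : α = 1 ∨ β = 0) (hk : ∀ k : ℤ, ∀ u ∈ N, α ^ k * σ u - u ∈ M → u ∈ M)
    (hh : h ∈ adj N x) (he : σ h - h ∈ adj M x) : h ∈ adj M x := by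
  have hx0 := hx.ne_zero
  have hst : IsStable σ (adj M x) := IsStep.isStable_adj hM ⟨α, hα, β, hβ, hα0, hσ, hαβ⟩
  -- The expansion is to be matched down to order -K, and m counts the coefficients still to be
  -- removed.
  have key : ∀ (K m : ℕ) (h u : U), σ h - h ∈ adj M x →
      Res N x (x ^ (-((m : ℤ) - K)) * h) u →
      ∃ S : U[X], CoeffIn M S ∧ ∃ v, Res N x (x ^ K * h - S.eval x) v := by
    intro K m
    induction m with
    | zero =>
      intro h u _ hr
      exact ⟨0, coeffIn_zero, u, by simpa using hr⟩
    | succ m ih =>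
      intro h u he hr
      set k : ℤ := ((m + 1 : ℕ) : ℤ) - K with hkdef
      have hu : u ∈ M := by
        refine hk k u hr.mem (Res.mem_of_mem_adj hMN hx
          ((hr.zpow_mul_map hN hx (hMN hα) hα0 (hMN hβ) hσ).sub hr) ?_)
        rw [← mul_sub]
        exact mul_mem (zpow_mem self_mem_adj _) he
      have hux : u * x ^ k ∈ adj M x := mul_mem (le_adj hu) (zpow_mem self_mem_adj _)
      have hr' : Res N x (x ^ (-k) * (h - u * x ^ k)) 0 := by
        have := hr.sub (Res.const (x := x) (hMN hu))
        rw [sub_self] at this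
        convert this using 1
        rw [mul_sub, zpow_neg]
        have := zpow_ne_zero k hx0
        field_simp
      obtain ⟨v, hv⟩ := hr'.self_mul
      obtain ⟨S, hS, w, hw⟩ := ih (h - u * x ^ k) v
        (by rw [map_sub, sub_sub_sub_comm]; exact sub_mem he (hst.sub_mem hux)) (by
          convert hv using 1
          rw [← mul_assoc, ← zpow_one_add₀ hx0]
          congr 2
          rw [hkdef]; push_cast; ring)
      refine ⟨S + C u * X ^ (m + 1), hS.add ((coeffIn_C hu).mul (coeffIn_X.pow _)), w, ?_⟩
      convert hw using 1
      have h1 : x ^ K * x ^ k = x ^ (m + 1) := by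
        rw [← zpow_natCast, ← zpow_natCast, ← zpow_add₀ hx0]
        congr 1
        rw [hkdef]; ring
      simp only [eval_add, eval_mul, eval_C, eval_pow, eval_X]
      rw [← h1]
      ring
  obtain ⟨m, u, hr⟩ := exists_res_zpow hx hh
  refine mem_adj_of_approx hMN hx hh fun K => key K (m + K) h u he ?_
  convert hr using 3
  push_cast; ring

/-- The term w has degree zero in x and does not disturb positive powers, which are removed as in
`mem_adj_of_sub_mem`. At order zero, `hk'` supplies the correction w' for the value u at infinity.
Then w - Δw' lies in M and h - u falls under `mem_adj_of_sub_mem`. -/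
theorem exists_sub_mem_adj_of_sub_mem (hM : IsStable σ M) (hN : IsStable σ N) (hMN : M ≤ N)
    (hW : IsStable σ W) (hWN : W ≤ N)
    (hx : TransOver N x) (hα : α ∈ M) (hα0 : α ≠ 0) (hβ : β ∈ M) (hσ : σ x = α * x + β)
    (hαβ : α = 1 ∨ β = 0) (hk : ∀ k : ℤ, ∀ u ∈ N, α ^ k * σ u - u ∈ M → u ∈ M)
    (hk' : ∀ u ∈ N, ∀ w ∈ W, σ u - u - w ∈ M → ∃ w' ∈ W, u - w' ∈ M)
    (hh : h ∈ adj N x) {w : U} (hw : w ∈ W) (he : σ h - h - w ∈ adj M x) :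
    ∃ w' ∈ W, h - w' ∈ adj M x := by
  have hx0 := hx.ne_zero
  have hst : IsStable σ (adj M x) := IsStep.isStable_adj hM ⟨α, hα, β, hβ, hα0, hσ, hαβ⟩
  have hstN : IsStable σ (adj N x) :=
    IsStep.isStable_adj hN ⟨α, hMN hα, β, hMN hβ, hα0, hσ, hαβ⟩
  obtain ⟨m, u, hr⟩ := exists_res_zpow hx hh
  induction m generalizing h u with
  | zero =>
    have h0 : ∀ {h u}, Res N x h u → Res N x (σ h - h) (σ u - u) := fun {h u} hr => by
      have h1 : Res N x (x ^ (-(0 : ℤ)) * h) u := by simpa using hr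
      have := (h1.zpow_mul_map hN hx (hMN hα) hα0 (hMN hβ) hσ).sub h1
      simpa using this
    have hr0 : Res N x h u := by simpa using hr
    obtain ⟨w', hw', huw⟩ := hk' u hr.mem w hw
      (Res.mem_of_mem_adj hMN hx ((h0 hr0).sub (Res.const (hWN hw))) he)
    refine ⟨w', hw', ?_⟩
    have hr1 : Res N x (h - u) 0 := by
      have := hr0.sub (Res.const (x := x) hr.mem)
      rwa [sub_self] at this
    have hw0 : w - (σ w' - w') ∈ W := sub_mem hw (hW.sub_mem hw')
    have h1 : σ (h - u) - (h - u) - (w - (σ w' - w')) ∈ adj M x := by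
      have := sub_mem he (le_adj (x := x) (hM.sub_mem huw))
      convert this using 1
      simp only [map_sub]; ring
    have h2 : w - (σ w' - w') ∈ M := by
      have := Res.mem_of_mem_adj hMN hx ((h0 hr1).sub (Res.const (hWN hw0))) h1
      simpa using neg_mem this
    have h3 : h - u ∈ adj M x := by
      refine mem_adj_of_sub_mem hM hN hMN hx hα hα0 hβ hσ hαβ hk
        (sub_mem hh (le_adj hr.mem)) ?_
      simpa using add_mem h1 (le_adj (x := x) h2)
    have := add_mem h3 (le_adj (x := x) huw)
    simpa using this
  | succ m ih =>
    set k : ℤ := ((m + 1 : ℕ) : ℤ) with hkdef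
    have hrw : Res N x (x ^ (-k) * w) 0 := by
      have h1 : Res N x (x ^ (-k)) 0 := by
        refine ⟨1, X ^ (m + 1), coeffIn_one, coeffIn_X.pow _, monic_X_pow _, by simpa using hx0,
          by simp, ?_, ?_⟩
        · rw [hkdef, zpow_neg, zpow_natCast]; simp
        · rw [natDegree_X_pow, coeff_one]; simp
      simpa using h1.mul (Res.const (hWN hw))
    have hu : u ∈ M := by
      refine hk k u hr.mem ?_
      have := Res.mem_of_mem_adj hMN hx
        (((hr.zpow_mul_map hN hx (hMN hα) hα0 (hMN hβ) hσ).sub hr).sub hrw)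
        (by rw [← mul_sub, ← mul_sub]; exact mul_mem (zpow_mem self_mem_adj _) he)
      simpa using this
    have hux : u * x ^ k ∈ adj M x := mul_mem (le_adj hu) (zpow_mem self_mem_adj _)
    have hr' : Res N x (x ^ (-k) * (h - u * x ^ k)) 0 := by
      have := hr.sub (Res.const (x := x) (hMN hu))
      rw [sub_self] at this
      convert this using 1
      rw [mul_sub, zpow_neg]
      have := zpow_ne_zero k hx0
      field_simp
    obtain ⟨v, hv⟩ := hr'.self_mul
    obtain ⟨w', hw', hmem⟩ := ih (h := h - u * x ^ k) (u := v)
      (sub_mem hh (adj_mono hMN hux))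
      (by
        have := sub_mem he (hst.sub_mem hux)
        convert this using 1
        rw [map_sub]; ring) (by
        convert hv using 1
        rw [← mul_assoc, ← zpow_one_add₀ hx0]
        congr 2
        rw [hkdef]; push_cast; ring)
    refine ⟨w', hw', ?_⟩
    convert add_mem hmem hux using 1
    ring

theorem TransOver.zpow_notMem (hx : TransOver N x) {k : ℤ} (hk : k ≠ 0) : x ^ k ∉ N := by
  have hnat : ∀ n : ℕ, n ≠ 0 → x ^ n ∉ N := fun n hn hmem => by
    have := hx (X ^ n - C (x ^ n)) ((coeffIn_X.pow n).sub (coeffIn_C hmem)) (by simp)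
    exact X_pow_sub_C_ne_zero (Nat.pos_of_ne_zero hn) _ this
  intro hmem
  obtain ⟨m, rfl | rfl⟩ := k.eq_nat_or_neg
  · exact hnat m (by simpa using hk) (by simpa using hmem)
  · exact hnat m (by simpa using hk) (by simpa using inv_mem hmem)

end Descent

/-! ### The filtration by sums and the removal of foreign products -/

section Filtration

variable {U : Type*} [Field U] {σ : U ≃+* U} {G L M N V W : Subfield U} {Z : Set U}
  {x y α β γ h u v : U}

theorem IsStable.sup (hM : IsStable σ M) (hN : IsStable σ N) : IsStable σ (M ⊔ N) := by
  have h1 : M ⊔ N ≤ (M ⊔ N).comap (σ : U →+* U) :=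
    sup_le (fun a ha => (le_sup_left : M ≤ M ⊔ N) (hM.map_mem ha))
      (fun a ha => (le_sup_right : N ≤ M ⊔ N) (hN.map_mem ha))
  have h2 : M ⊔ N ≤ (M ⊔ N).comap (σ.symm : U →+* U) :=
    sup_le (fun a ha => (le_sup_left : M ≤ M ⊔ N) (by
        change σ.symm a ∈ M
        rw [← hM]; simpa using ha))
      (fun a ha => (le_sup_right : N ≤ M ⊔ N) (by
        change σ.symm a ∈ N
        rw [← hN]; simpa using ha))
  intro a
  refine ⟨fun h => ?_, fun h => h1 h⟩
  have := h2 h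
  simpa using this

/-- The descent properties of the difference field `M` relative to `M W`. -/
structure Descends (σ : U ≃+* U) (V W M : Subfield U) : Prop where
  stable : IsStable σ M
  descent : ∀ h ∈ M ⊔ W, σ h - h ∈ M → h ∈ M
  descent_add : ∀ h ∈ M ⊔ W, ∀ w ∈ W, σ h - h - w ∈ M → ∃ w' ∈ W, h - w' ∈ M
  inf_le : M ⊓ W ≤ V

/-- Twisted summation problems without homogeneous solutions over difference fields `M ≥ G` have
solutions in `M W` only if they have solutions in `M`. -/
def TwistedDescent (σ : U ≃+* U) (G W : Subfield U) : Prop :=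
  ∀ M, IsStable σ M → G ≤ M → ∀ γ ∈ M, (∀ u ∈ M ⊔ W, γ * σ u = u → u = 0) →
    ∀ h ∈ M ⊔ W, γ * σ h - h ∈ M → h ∈ M

/-- The expansion argument at infinity needs descent for α^k σ(u) - u. For α = 1 or k = 0 this is
ordinary descent. Otherwise x is a product, and a nonzero w with α^k σ(w) = w would make x^k w a
constant, forcing x^k into M W. So there are no homogeneous solutions and `TwistedDescent` applies.
-/
theorem Descends.adj (hd : Descends σ V W M) (hW : IsStable σ W) (hT : TwistedDescent σ G W)
    (hC : ∀ c, σ c = c → c ∈ G) (hGM : G ≤ M) (hx : TransOver (M ⊔ W) x) (hst : IsStep σ M x) :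
    Descends σ V W (adj M x) := by
  have hstep := hst
  obtain ⟨α, hα, β, hβ, hα0, hσ, hαβ⟩ := hst
  have hN := hd.stable.sup hW
  have hMN : M ≤ M ⊔ W := le_sup_left
  have hsup : DiffAlg.adj M x ⊔ W = DiffAlg.adj (M ⊔ W) x := sup_right_comm _ _ _
  have hk : ∀ k : ℤ, ∀ u ∈ M ⊔ W, α ^ k * σ u - u ∈ M → u ∈ M := by
    intro k u hu he
    by_cases hα1 : α = 1
    · rw [hα1, one_zpow, one_mul] at he
      exact hd.descent u hu he
    by_cases hk0 : k = 0
    · rw [hk0, zpow_zero, one_mul] at he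
      exact hd.descent u hu he
    have hβ0 := hαβ.resolve_left hα1
    rw [hβ0, add_zero] at hσ
    refine hT M hd.stable hGM (α ^ k) (zpow_mem hα k) (fun w hw hhom => ?_) u hu he
    by_contra hw0
    have h1 : x ^ k * w ∈ M ⊔ W := hMN (hGM (hC _ (by
      rw [map_mul, map_zpow₀, hσ, mul_zpow]
      linear_combination x ^ k * hhom)))
    refine hx.zpow_notMem hk0 ?_
    have := div_mem h1 hw
    rwa [mul_div_cancel_right₀ _ hw0] at this
  refine ⟨hstep.isStable_adj hd.stable, fun h hh he => ?_, fun h hh w hw he => ?_, ?_⟩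
  · rw [hsup] at hh
    exact mem_adj_of_sub_mem hd.stable hN hMN hx hα hα0 hβ hσ hαβ hk hh he
  · rw [hsup] at hh
    exact exists_sub_mem_adj_of_sub_mem hd.stable hN hMN hW le_sup_right hx hα hα0 hβ hσ hαβ hk
      hd.descent_add hh hw he
  · exact fun a ha => hd.inf_le ⟨adj_inf_le hMN hx ⟨ha.1, (le_sup_right : W ≤ M ⊔ W) ha.2⟩, ha.2⟩

/-- The filtration obtained from `G` by adjoining at level `n + 1` all sums over level `n` and the
elements of `Q (n + 1)`. -/
def sumFilt (σ : U ≃+* U) (G : Subfield U) (Q : ℕ → Set U) : ℕ → Subfield U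
  | 0 => G
  | n + 1 => sumFilt σ G Q n ⊔
      Subfield.closure ({y | σ y - y ∈ sumFilt σ G Q n} ∪ Q (n + 1))

variable {Q P : ℕ → Set U}

theorem sumFilt_succ (n : ℕ) : sumFilt σ G Q (n + 1) = sumFilt σ G Q n ⊔
      Subfield.closure ({y | σ y - y ∈ sumFilt σ G Q n} ∪ Q (n + 1)) := rfl

theorem sumFilt_mono : Monotone (sumFilt σ G Q) := monotone_nat_of_le_succ fun _ => le_sup_left

theorem le_sumFilt (n : ℕ) : G ≤ sumFilt σ G Q n := sumFilt_mono (Nat.zero_le n)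

theorem sum_mem_sumFilt {n : ℕ} (hy : σ y - y ∈ sumFilt σ G Q n) : y ∈ sumFilt σ G Q (n + 1) :=
  (le_sup_right : _ ≤ sumFilt σ G Q n ⊔ _) (Subfield.subset_closure (Or.inl hy))

theorem mem_sumFilt_of_mem {n : ℕ} (hy : y ∈ Q (n + 1)) : y ∈ sumFilt σ G Q (n + 1) :=
  (le_sup_right : _ ≤ sumFilt σ G Q n ⊔ _) (Subfield.subset_closure (Or.inr hy))

theorem sumFilt_le {F : ℕ → Subfield U} {n : ℕ} (h0 : G ≤ F 0) (hF : Monotone F)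
    (hsum : ∀ m < n, ∀ y, σ y - y ∈ F m → y ∈ F (m + 1))
    (hQ : ∀ m < n, Q (m + 1) ⊆ F (m + 1)) : sumFilt σ G Q n ≤ F n := by
  induction n with
  | zero => exact h0
  | succ n ih =>
    have ih := ih (fun m hm => hsum m (by omega)) (fun m hm => hQ m (by omega))
    refine sup_le (ih.trans (hF (Nat.le_succ n))) (Subfield.closure_le.2 ?_)
    rintro y (hy | hy)
    exacts [hsum n (Nat.lt_succ_self n) y (ih hy), hQ n (Nat.lt_succ_self n) hy]

theorem sumFilt_le_sumFilt {G' : Subfield U} (hG : G ≤ G') (hPQ : ∀ n, P n ⊆ Q n) (n : ℕ) :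
    sumFilt σ G P n ≤ sumFilt σ G' Q n :=
  sumFilt_le (F := sumFilt σ G' Q) hG sumFilt_mono (fun _ _ _ h => sum_mem_sumFilt h)
    fun _ _ _ h => mem_sumFilt_of_mem (hPQ _ h)

/-- The elements of `Q (n + 1)` are products over level `n` of the filtration. -/
def PiAdmissible (σ : U ≃+* U) (G : Subfield U) (Q : ℕ → Set U) : Prop :=
  ∀ n, ∀ q ∈ Q (n + 1), IsPi σ (sumFilt σ G Q n) q

theorem sub_mem_or_isPi_of_admissible (hQ : PiAdmissible σ G Q) {n : ℕ} :
    ∀ z ∈ {y | σ y - y ∈ sumFilt σ G Q n} ∪ Q (n + 1),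
      σ z - z ∈ sumFilt σ G Q n ∨ IsPi σ (sumFilt σ G Q n) z := by
  rintro z (hz | hz)
  exacts [Or.inl hz, Or.inr (hQ n z hz)]

theorem isStable_sumFilt (hG : IsStable σ G) (hQ : PiAdmissible σ G Q) (n : ℕ) :
    IsStable σ (sumFilt σ G Q n) := by
  induction n with
  | zero => exact hG
  | succ n ih =>
    exact isStable_closure ih fun z hz =>
      isStep_of_sub_mem_or_isPi (sub_mem_or_isPi_of_admissible hQ z hz)

theorem twistedDescent_sumFilt (hG : IsStable σ G) (hQ : PiAdmissible σ G Q) (n : ℕ) :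
    TwistedDescent σ G (sumFilt σ G Q n) := by
  induction n with
  | zero =>
    intro M hM hGM γ _ _ h hh _
    rwa [sumFilt, sup_eq_left.2 hGM] at hh
  | succ n ih =>
    intro M hM hGM γ hγ hno h hh he
    rw [sumFilt_succ, ← sup_assoc] at hh hno
    refine ih M hM hGM γ hγ (fun u hu => hno u ((le_sup_left : M ⊔ _ ≤ _) hu)) h
      (mem_of_twisted_closure (hM.sup (isStable_sumFilt hG hQ n)) (fun z hz => ?_)
        ((le_sup_left : M ≤ _) hγ) hno hh ((le_sup_left : M ≤ _) he)) he
    exact (isStep_of_sub_mem_or_isPi (sub_mem_or_isPi_of_admissible hQ z hz)).mono le_sup_right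

variable [CharZero U]

/-- A sum is either transcendental over M W or already there, and in the latter case descent puts it
in M. -/
theorem Descends.adj_sum (hd : Descends σ V W M) (hW : IsStable σ W) (hT : TwistedDescent σ G W)
    (hC : ∀ c, σ c = c → c ∈ G) (hGM : G ≤ M) (hx : σ x - x ∈ M) :
    Descends σ V W (DiffAlg.adj M x) := by
  rcases mem_or_transOver (hd.stable.sup hW)
    (fun c hc => (le_sup_left : M ≤ M ⊔ W) (hGM (hC c hc)))
    ((le_sup_left : M ≤ M ⊔ W) hx) with h | h
  · rw [adj_eq_self (hd.descent x h hx)]; exact hd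
  · exact hd.adj hW hT hC hGM h (isStep_of_sub_mem hx)

/-- Each descent property involves only finitely many of the adjoined sums. -/
theorem Descends.closure_sums (hd : Descends σ V W M) (hW : IsStable σ W)
    (hT : TwistedDescent σ G W) (hC : ∀ c, σ c = c → c ∈ G) (hGM : G ≤ M)
    (hZ : ∀ z ∈ Z, σ z - z ∈ M) : Descends σ V W (M ⊔ Subfield.closure Z) := by
  classical
  have hfin : ∀ t : Finset U, (t : Set U) ⊆ Z →
      Descends σ V W (M ⊔ Subfield.closure (t : Set U)) := by
    intro t
    induction t using Finset.induction_on with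
    | empty => intro _; simpa using hd
    | insert z t _ ih =>
      intro ht
      rw [Finset.coe_insert, Set.insert_subset_iff] at ht
      rw [Finset.coe_insert, sup_closure_insert]
      exact (ih ht.2).adj_sum hW hT hC (hGM.trans le_sup_left)
        ((le_sup_left : M ≤ _) (hZ z ht.1))
  have hmono : ∀ {s t : Set U}, s ⊆ t → M ⊔ Subfield.closure s ≤ M ⊔ Subfield.closure t :=
    fun h => sup_le_sup_left (Subfield.closure_mono h) _
  have hsub : ∀ {s t : Finset U}, (s : Set U) ⊆ Z → (t : Set U) ⊆ Z →
      ((s ∪ t : Finset U) : Set U) ⊆ Z := fun hs ht => by simp [hs, ht]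
  have hl : ∀ s t : Finset U, (s : Set U) ⊆ ((s ∪ t : Finset U) : Set U) := fun s t => by simp
  have hr : ∀ s t : Finset U, (t : Set U) ⊆ ((s ∪ t : Finset U) : Set U) := fun s t => by simp
  refine ⟨isStable_closure hd.stable fun z hz => isStep_of_sub_mem (hZ z hz),
    fun h hh he => ?_, fun h hh w hw he => ?_, fun a ha => ?_⟩
  · rw [sup_right_comm] at hh
    obtain ⟨s, hs, hh⟩ := exists_finset_of_mem_sup_closure hh
    obtain ⟨t, ht, he⟩ := exists_finset_of_mem_sup_closure he
    rw [← sup_right_comm] at hh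
    exact hmono (hsub hs ht) ((hfin _ (hsub hs ht)).descent h
      (sup_le_sup_right (hmono (hl s t)) W hh) (hmono (hr s t) he))
  · rw [sup_right_comm] at hh
    obtain ⟨s, hs, hh⟩ := exists_finset_of_mem_sup_closure hh
    obtain ⟨t, ht, he⟩ := exists_finset_of_mem_sup_closure he
    rw [← sup_right_comm] at hh
    obtain ⟨w', hw', h1⟩ := (hfin _ (hsub hs ht)).descent_add h
      (sup_le_sup_right (hmono (hl s t)) W hh) w hw (hmono (hr s t) he)
    exact ⟨w', hw', hmono (hsub hs ht) h1⟩
  · obtain ⟨s, hs, h1⟩ := exists_finset_of_mem_sup_closure ha.1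
    exact (hfin s hs).inf_le ⟨h1, ha.2⟩

/-- Summation in `M W`, where `W` is the next level of the filtration. -/
theorem Descends.exists_eq_add (hG : IsStable σ G) (hC : ∀ c, σ c = c → c ∈ G)
    (hQ : PiAdmissible σ G Q) {n : ℕ} (hd : Descends σ V (sumFilt σ G Q n) M)
    (hh : h ∈ M ⊔ sumFilt σ G Q (n + 1)) (he : σ h - h ∈ M) :
    ∃ m ∈ M, ∃ y, σ y - y ∈ V ∧ h = m + y := by
  have hW := isStable_sumFilt hG hQ n
  rw [sumFilt_succ, ← sup_assoc] at hh
  obtain ⟨l, hl, y, hy, rfl⟩ := exists_eq_add_of_sub_mem_closure (hd.stable.sup hW)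
    le_sup_right (fun c hc => le_sumFilt n (hC c hc))
    (fun z hz => (sub_mem_or_isPi_of_admissible hQ z hz).imp_right fun h => h.mono le_sup_right)
    hh ((le_sup_left : M ≤ _) he)
  obtain ⟨w, hw, hlw⟩ := hd.descent_add l hl (-(σ y - y)) (neg_mem hy) (by
    convert he using 1
    rw [map_add]; ring)
  -- Moving w from l to y leaves l - w in M, so Δ(y + w) lies in both M and W, hence in V.
  have h1 : σ (y + w) - (y + w) ∈ M := by
    convert sub_mem he (hd.stable.sub_mem hlw) using 1
    simp only [map_add, map_sub]; ring
  have h2 : σ (y + w) - (y + w) ∈ sumFilt σ G Q n := by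
    convert add_mem hy (hW.sub_mem hw) using 1
    rw [map_add]; ring
  exact ⟨_, hlw, y + w, hd.inf_le ⟨h1, h2⟩, by ring⟩

/-- First V_{n+1} descends relative to W_n, by adjoining to V_n its products (`hind`) and then all
its sums. By `Descends.exists_eq_add`, an element of W_{n+1} with difference in V_{n+1} is then m +
y with m ∈ V_{n+1} and Δy ∈ V_n, and y itself belongs to V_{n+1}. -/
theorem descends_sumFilt (hG : IsStable σ G) (hC : ∀ c, σ c = c → c ∈ G)
    (hP : PiAdmissible σ G P) (hQ : PiAdmissible σ G Q) (hPQ : ∀ n, P n ⊆ Q n)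
    (hind : ∀ n, Descends σ (sumFilt σ G P n) (sumFilt σ G Q n) (sumFilt σ G P n) →
      Descends σ (sumFilt σ G P n) (sumFilt σ G Q n)
        (sumFilt σ G P n ⊔ Subfield.closure (P (n + 1)))) (n : ℕ) :
    Descends σ (sumFilt σ G P n) (sumFilt σ G Q n) (sumFilt σ G P n) := by
  have hle : ∀ n, sumFilt σ G P n ≤ sumFilt σ G Q n := sumFilt_le_sumFilt le_rfl hPQ
  induction n with
  | zero =>
    refine ⟨hG, fun h hh _ => ?_, fun h hh w _ _ => ⟨h, ?_, ?_⟩, inf_le_left⟩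
    · simpa [sumFilt] using hh
    · simpa [sumFilt] using hh
    · rw [sub_self]; exact zero_mem _
  | succ n ih =>
    have h1 : Descends σ (sumFilt σ G P n) (sumFilt σ G Q n) (sumFilt σ G P (n + 1)) := by
      have := (hind n ih).closure_sums (Z := {y | σ y - y ∈ sumFilt σ G P n})
        (isStable_sumFilt hG hQ n) (twistedDescent_sumFilt hG hQ n) hC
        ((le_sumFilt n).trans le_sup_left) (fun z hz => (le_sup_left : sumFilt σ G P n ≤ _) hz)
      rwa [sup_assoc, ← Subfield.closure_union, Set.union_comm, ← sumFilt_succ] at this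
    refine ⟨isStable_sumFilt hG hP _, fun h hh he => ?_, fun h hh w _ _ => ⟨h, ?_, ?_⟩,
      inf_le_left⟩
    · obtain ⟨m, hm, y, hy, rfl⟩ := h1.exists_eq_add hG hC hQ hh he
      exact add_mem hm (sum_mem_sumFilt hy)
    · rwa [sup_eq_right.2 (hle _)] at hh
    · rw [sub_self]; exact zero_mem _

end Filtration

end DiffAlg

namespace PiSigmaTower

/-! ### Depth as membership in subfields -/

section ElementDepth

variable {G K : DiffField.{u}} {φ : G →+* K} {n : ℕ} {t : Fin n → K} {d : Fin n → ℕ}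

open MvPolynomial in
theorem vars_subset_of_mul_left {p q : MvPolynomial (Fin n) G} (h : p * q ≠ 0) :
    q.vars ⊆ (p * q).vars := by
  intro i hi
  rw [mem_vars_iff_degreeOf_ne_zero] at hi ⊢
  rw [degreeOf_mul_eq (left_ne_zero_of_mul h) (right_ne_zero_of_mul h)]
  omega

open MvPolynomial in
theorem exists_coprime_of_mem_closure {I : Set (Fin n)} {x : K}
    (hx : x ∈ Subfield.closure (Set.range φ ∪ t '' I)) :
    ∃ p q : MvPolynomial (Fin n) G, IsRelPrime p q ∧ q ≠ 0 ∧
      x = p.eval₂ φ t / q.eval₂ φ t ∧ (p.vars : Set (Fin n)) ⊆ I ∧ (q.vars : Set (Fin n)) ⊆ I := by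
  have h1 : ∃ p ∈ supported G I, ∃ q ∈ supported G I, eval₂ φ t q ≠ 0 ∧
      x = eval₂ φ t p / eval₂ φ t q := by
    induction hx using Subfield.closure_induction with
    | mem a ha =>
      rcases ha with ⟨c, rfl⟩ | ⟨i, hi, rfl⟩
      · exact ⟨C c, (supported G I).algebraMap_mem c, 1, one_mem _, by simp, by simp⟩
      · exact ⟨X i, X_mem_supported.2 hi, 1, one_mem _, by simp, by simp⟩
    | one => exact ⟨1, one_mem _, 1, one_mem _, by simp, by simp⟩
    | add a b _ _ iha ihb =>
      obtain ⟨p, hp, q, hq, h0, rfl⟩ := iha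
      obtain ⟨p', hp', q', hq', h0', rfl⟩ := ihb
      refine ⟨p * q' + q * p', add_mem (mul_mem hp hq') (mul_mem hq hp'), q * q', mul_mem hq hq',
        ?_, ?_⟩
      · rw [eval₂_mul]; exact mul_ne_zero h0 h0'
      · rw [eval₂_add, eval₂_mul, eval₂_mul, eval₂_mul, div_add_div _ _ h0 h0']
    | neg a _ iha =>
      obtain ⟨p, hp, q, hq, h0, rfl⟩ := iha
      exact ⟨-p, neg_mem hp, q, hq, h0, by rw [← coe_eval₂Hom, map_neg, neg_div]⟩
    | inv a _ iha =>
      obtain ⟨p, hp, q, hq, h0, rfl⟩ := iha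
      by_cases hp0 : eval₂ φ t p = 0
      · exact ⟨0, zero_mem _, 1, one_mem _, by simp, by simp [hp0]⟩
      · exact ⟨q, hq, p, hp, hp0, by rw [inv_div]⟩
    | mul a b _ _ iha ihb =>
      obtain ⟨p, hp, q, hq, h0, rfl⟩ := iha
      obtain ⟨p', hp', q', hq', h0', rfl⟩ := ihb
      refine ⟨p * p', mul_mem hp hp', q * q', mul_mem hq hq', ?_, ?_⟩
      · rw [eval₂_mul]; exact mul_ne_zero h0 h0'
      · rw [eval₂_mul, eval₂_mul, div_mul_div_comm]
  obtain ⟨p, hp, q, hq, h0, rfl⟩ := h1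
  have hq0 : q ≠ 0 := by rintro rfl; simp at h0
  obtain ⟨p', q', c, hrel, rfl, rfl⟩ := UniqueFactorizationMonoid.exists_reduced_factors' p q hq0
  rw [mem_supported] at hp hq
  have hc0 := left_ne_zero_of_mul hq0
  rw [eval₂_mul] at h0
  refine ⟨p', q', hrel, right_ne_zero_of_mul hq0, ?_, ?_, ?_⟩
  · rw [eval₂_mul, eval₂_mul, mul_div_mul_left _ _ (left_ne_zero_of_mul h0)]
  · by_cases hp0 : p' = 0
    · simp [hp0]
    · exact (Finset.coe_subset.2 (vars_subset_of_mul_left (mul_ne_zero hc0 hp0))).trans hp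
  · exact (Finset.coe_subset.2 (vars_subset_of_mul_left hq0)).trans hq

-- Cancelling common factors introduces no variables, so any fraction in generators of depth at most
-- k has a coprime form in the same generators. Only generation of the field is needed, not
-- uniqueness of the coprime form.
open MvPolynomial in
theorem elemDepth_le_iff (htop : Subfield.closure (Set.range φ ∪ Set.range t) = ⊤) {x : K} {k : ℕ} :
    elemDepth φ t d x ≤ k ↔ x ∈ Subfield.closure (Set.range φ ∪ t '' {i | d i ≤ k}) := by
  classical
  constructor
  · intro h
    have hne : {m : ℕ | ∃ p q : MvPolynomial (Fin n) G, IsRelPrime p q ∧ q ≠ 0 ∧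
        x = p.eval₂ φ t / q.eval₂ φ t ∧ m = (p.vars ∪ q.vars).sup d}.Nonempty := by
      have hx : x ∈ Subfield.closure (Set.range φ ∪ t '' Set.univ) := by
        rw [Set.image_univ, htop]; trivial
      obtain ⟨p, q, h1, h2, h3, -⟩ := exists_coprime_of_mem_closure hx
      exact ⟨_, p, q, h1, h2, h3, rfl⟩
    obtain ⟨p, q, -, -, hpq, hm⟩ := Nat.sInf_mem hne
    have hle : (p.vars ∪ q.vars).sup d ≤ k := hm.symm.trans_le h
    rw [Finset.sup_le_iff] at hle
    rw [hpq]
    set F := Subfield.closure (Set.range φ ∪ t '' {i | d i ≤ k})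
    have hφ : ∀ c, φ c ∈ F := fun c => Subfield.subset_closure (Or.inl ⟨c, rfl⟩)
    have ht : ∀ i, d i ≤ k → t i ∈ F := fun i hi => Subfield.subset_closure (Or.inr ⟨i, hi, rfl⟩)
    have hev : ∀ r : MvPolynomial (Fin n) G, (∀ i ∈ r.vars, d i ≤ k) → eval₂ φ t r ∈ F := by
      intro r hr
      rw [eval₂_eq]
      exact sum_mem fun e he => mul_mem (hφ _) (prod_mem fun i hi => pow_mem
        (ht i (hr i ((mem_vars_iff_mem_support i).2 ⟨e, he, hi⟩))) _)
    exact div_mem (hev p fun i hi => hle i (Finset.mem_union_left _ hi))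
      (hev q fun i hi => hle i (Finset.mem_union_right _ hi))
  · intro h
    obtain ⟨p, q, h1, h2, h3, hp, hq⟩ := exists_coprime_of_mem_closure h
    have hle : elemDepth φ t d x ≤ (p.vars ∪ q.vars).sup d :=
      Nat.sInf_le ⟨p, q, h1, h2, h3, rfl⟩
    refine hle.trans (Finset.sup_le fun i hi => ?_)
    rcases Finset.mem_union.1 hi with hi | hi
    exacts [hp hi, hq hi]

end ElementDepth

section DepthField

variable {U : Type*} [Field U] {G : DiffField.{u}}

/-- The image under `j` of the subfield generated by the ground field and all generators of depth at
most `n`. -/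
noncomputable def depthField : {K : DiffField.{u}} → PiSigmaTower G K → (K →+* U) → ℕ → Subfield U
  | _, .base, j, _ => j.fieldRange
  | _, .step T s, j, n =>
      T.depthField (j.comp s.emb) n ⊔ Subfield.closure {z | z = j s.t ∧ T.depth s.a + 1 ≤ n}

theorem depthField_base (j : G →+* U) (n : ℕ) : (base : PiSigmaTower G G).depthField j n =
  j.fieldRange := rfl

theorem depthField_step {K L : DiffField.{u}} (T : PiSigmaTower G K) (s : PiSigmaStep K L)
    (j : L →+* U) (n : ℕ) : (T.step s).depthField j n = T.depthField (j.comp s.emb) n ⊔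
      Subfield.closure {z | z = j s.t ∧ T.depth s.a + 1 ≤ n} := rfl

theorem closure_gen : ∀ {K : DiffField.{u}} (T : PiSigmaTower G K),
    Subfield.closure (Set.range T.emb ∪ Set.range T.gen) = ⊤
  | _, .base => by
    rw [eq_top_iff]
    exact fun x _ => Subfield.subset_closure (Or.inl ⟨x, rfl⟩)
  | _, .step T s => by
    rw [eq_top_iff, ← s.generates, Subfield.closure_le]
    rintro x (⟨y, rfl⟩ | rfl)
    · have hy : y ∈ Subfield.closure (Set.range T.emb ∪ Set.range T.gen) := by
        rw [closure_gen T]; trivial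
      have h := Subfield.mem_map.2 ⟨y, hy, (rfl : s.emb y = s.emb y)⟩
      rw [RingHom.map_field_closure] at h
      refine Subfield.closure_mono ?_ h
      rintro _ ⟨_, ⟨z, rfl⟩ | ⟨i, rfl⟩, rfl⟩
      · exact Or.inl ⟨z, rfl⟩
      · refine Or.inr ⟨i.castSucc, ?_⟩
        exact Fin.snoc_castSucc (α := fun _ => _) _ _ i
    · refine Subfield.subset_closure (Or.inr ⟨Fin.last _, ?_⟩)
      exact Fin.snoc_last (α := fun _ => _) _ _

theorem depthField_eq : ∀ {K : DiffField.{u}} (T : PiSigmaTower G K) (j : K →+* U) (n : ℕ),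
    T.depthField j n =
      (Subfield.closure (Set.range T.emb ∪ T.gen '' {i | T.genDepth i ≤ n})).map j
  | _, .base, j, n => by
    have : Subfield.closure (Set.range (base : PiSigmaTower G G).emb ∪
        (base : PiSigmaTower G G).gen '' {i | (base : PiSigmaTower G G).genDepth i ≤ n}) = ⊤ := by
      rw [eq_top_iff]
      exact fun x _ => Subfield.subset_closure (Or.inl ⟨x, rfl⟩)
    rw [this, depthField_base, RingHom.fieldRange_eq_map]
  | _, .step T s, j, n => by
    rw [depthField_step, depthField_eq T, ← Subfield.map_map, RingHom.map_field_closure s.emb,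
      RingHom.map_field_closure j, RingHom.map_field_closure j, ← Subfield.closure_union]
    congr 1
    have hg : ∀ i : Fin T.length, (T.step s).gen i.castSucc = s.emb (T.gen i) :=
      fun i => Fin.snoc_castSucc (α := fun _ => _) _ _ i
    have hl : (T.step s).gen (Fin.last _) = s.t := Fin.snoc_last (α := fun _ => _) _ _
    have hg' : ∀ i : Fin T.length, (T.step s).genDepth i.castSucc = T.genDepth i :=
      fun i => Fin.snoc_castSucc (α := fun _ => ℕ) _ _ i
    have hl' : (T.step s).genDepth (Fin.last _) = T.depth s.a + 1 :=
      Fin.snoc_last (α := fun _ => ℕ) _ _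
    ext z
    constructor
    · rintro (⟨_, ⟨_, ⟨y, rfl⟩ | ⟨i, hi, rfl⟩, rfl⟩, rfl⟩ | ⟨rfl, h⟩)
      · exact ⟨_, Or.inl ⟨y, rfl⟩, rfl⟩
      · exact ⟨_, Or.inr ⟨i.castSucc, (hg' i).trans_le hi, hg i⟩, rfl⟩
      · exact ⟨_, Or.inr ⟨Fin.last _, hl'.trans_le h, hl⟩, rfl⟩
    · rintro ⟨_, ⟨y, rfl⟩ | ⟨i, hi, rfl⟩, rfl⟩
      · exact Or.inl ⟨_, ⟨_, Or.inl ⟨y, rfl⟩, rfl⟩, rfl⟩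
      · induction i using Fin.lastCases with
        | last => exact Or.inr ⟨congrArg j hl, hl'.symm.trans_le hi⟩
        | cast i =>
          exact Or.inl ⟨_, ⟨_, Or.inr ⟨i, (hg' i).symm.trans_le hi, rfl⟩, rfl⟩,
            congrArg j (hg i).symm⟩

theorem depth_le_iff {K : DiffField.{u}} (T : PiSigmaTower G K) (j : K →+* U) {x : K} {n : ℕ} :
    T.depth x ≤ n ↔ j x ∈ T.depthField j n := by
  rw [depthField_eq, depth, elemDepth_le_iff T.closure_gen]
  constructor
  · exact fun h => ⟨x, h, rfl⟩
  · rintro ⟨y, hy, h⟩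
    rwa [← j.injective h]

theorem depthField_le_fieldRange {K : DiffField.{u}} (T : PiSigmaTower G K) (j : K →+* U) (n : ℕ) :
    T.depthField j n ≤ j.fieldRange := by
  rw [depthField_eq]
  rintro _ ⟨y, -, rfl⟩
  exact ⟨y, rfl⟩

theorem depthField_mono {K : DiffField.{u}} (T : PiSigmaTower G K) (j : K →+* U) :
    Monotone (T.depthField j) := by
  intro m n h
  rw [depthField_eq, depthField_eq]
  rintro _ ⟨y, hy, rfl⟩
  refine ⟨y, Subfield.closure_mono (Set.union_subset_union_right _ (Set.image_mono ?_)) hy, rfl⟩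
  exact fun i hi => le_trans hi h

theorem ground_le_depthField : ∀ {K : DiffField.{u}} (T : PiSigmaTower G K) (j : K →+* U) (n : ℕ),
    (j.comp T.emb).fieldRange ≤ T.depthField j n
  | _, .base, _, _ => le_rfl
  | _, .step T s, j, n => (ground_le_depthField T (j.comp s.emb) n).trans le_sup_left

end DepthField

end PiSigmaTower

namespace PiSigmaTower

open DiffAlg

/-! ### Towers, their composition and their images in an ambient field -/

section Composition

variable {G K : DiffField.{u}}

theorem base_comp : ∀ {K : DiffField.{u}} (T : PiSigmaTower G K),
    (base : PiSigmaTower G G).comp T = T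
  | _, .base => rfl
  | _, .step T s => by rw [comp, base_comp T]

theorem comp_assoc (T : PiSigmaTower G K) {L : DiffField.{u}} (X : PiSigmaTower K L) :
    ∀ {M : DiffField.{u}} (Y : PiSigmaTower L M), T.comp (X.comp Y) = (T.comp X).comp Y
  | _, .base => rfl
  | _, .step Y s => by simp only [comp]; rw [comp_assoc T X Y]

theorem emb_comp (T : PiSigmaTower G K) : ∀ {L : DiffField.{u}} (X : PiSigmaTower K L),
    (T.comp X).emb = X.emb.comp T.emb
  | _, .base => rfl
  | _, .step X s => by simp only [comp, emb]; rw [emb_comp T X]; rfl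

theorem isSigma_comp (X : PiSigmaTower G K) : ∀ {L : DiffField.{u}} (Y : PiSigmaTower K L),
    (X.comp Y).IsSigma ↔ X.IsSigma ∧ Y.IsSigma
  | _, .base => by simp [comp, IsSigma]
  | _, .step Y s => by simp only [comp, IsSigma]; rw [isSigma_comp X Y, and_assoc]

theorem isDepthOptimal_comp (T : PiSigmaTower G K) {L : DiffField.{u}} (X : PiSigmaTower K L) :
    ∀ {M : DiffField.{u}} (Y : PiSigmaTower L M),
      T.IsDepthOptimal (X.comp Y) ↔ T.IsDepthOptimal X ∧ (T.comp X).IsDepthOptimal Y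
  | _, .base => by simp [comp, IsDepthOptimal]
  | _, .step Y s => by
    simp only [comp, IsDepthOptimal]
    rw [isDepthOptimal_comp T X Y, comp_assoc, and_assoc]

theorem emb_σ : ∀ {K : DiffField.{u}} (T : PiSigmaTower G K) (x : G),
    K.σ (T.emb x) = T.emb (G.σ x)
  | _, .base, _ => rfl
  | _, .step T s, x => by
    change _ = s.emb (T.emb (G.σ x))
    rw [← emb_σ T x, ← s.emb_σ]; rfl

/-- Every generator of the extension `X` of `K` has depth at most `n`. -/
def ExtLE (T : PiSigmaTower G K) : {L : DiffField.{u}} → PiSigmaTower K L → ℕ → Prop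
  | _, .base, _ => True
  | _, .step X s, n => T.ExtLE X n ∧ (T.comp X).depth s.a + 1 ≤ n

theorem extLE_comp (T : PiSigmaTower G K) {L : DiffField.{u}} (X : PiSigmaTower K L) {n : ℕ} :
    ∀ {M : DiffField.{u}} (Y : PiSigmaTower L M),
      T.ExtLE (X.comp Y) n ↔ T.ExtLE X n ∧ (T.comp X).ExtLE Y n
  | _, .base => by simp [comp, ExtLE]
  | _, .step Y s => by
    simp only [comp, ExtLE]
    rw [extLE_comp T X Y, comp_assoc, and_assoc]

theorem ExtLE.mono {T : PiSigmaTower G K} {m n : ℕ} (h : m ≤ n) :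
    ∀ {L : DiffField.{u}} {X : PiSigmaTower K L}, T.ExtLE X m → T.ExtLE X n
  | _, .base, _ => trivial
  | _, .step _ _, hX => ⟨ExtLE.mono h hX.1, hX.2.trans h⟩

end Composition

section Step

variable {K L U : DiffField.{u}} (s : PiSigmaStep K L) (j : L →+* U)

theorem fieldRange_step : j.fieldRange = adj (j.comp s.emb).fieldRange (j s.t) := by
  rw [RingHom.fieldRange_eq_map, ← s.generates, RingHom.map_field_closure]
  refine le_antisymm (Subfield.closure_le.2 ?_) (adj_le ?_ ?_)
  · rintro _ ⟨_, ⟨x, rfl⟩ | rfl, rfl⟩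
    · exact le_adj ⟨x, rfl⟩
    · exact self_mem_adj
  · rintro _ ⟨x, rfl⟩
    exact Subfield.subset_closure ⟨_, Or.inl ⟨x, rfl⟩, rfl⟩
  · exact Subfield.subset_closure ⟨_, Or.inr rfl, rfl⟩

theorem transOver_step : TransOver (j.comp s.emb).fieldRange (j s.t) := by
  intro P hP h0
  have hP' : ∃ p : Polynomial K, p.map (j.comp s.emb) = P := by
    have := Polynomial.mem_map_range (j.comp s.emb) (p := P)
    rw [RingHom.mem_range] at this
    exact this.2 hP
  obtain ⟨p, rfl⟩ := hP'
  rw [Polynomial.eval_map, ← Polynomial.hom_eval₂, map_eq_zero_iff j j.injective] at h0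
  rw [s.transcendental p h0, Polynomial.map_zero]

variable {s j}

theorem isStep_step (hj : ∀ x, U.σ (j x) = j (L.σ x)) :
    IsStep U.σ (j.comp s.emb).fieldRange (j s.t) := by
  rcases s.shift with h | h
  · exact ⟨1, one_mem _, j (s.emb s.a), ⟨s.a, rfl⟩, one_ne_zero, by rw [hj, h, map_add, one_mul],
      Or.inl rfl⟩
  · refine ⟨j (s.emb s.a), ⟨s.a, rfl⟩, 0, zero_mem _, ?_, by rw [hj, h, map_mul, add_zero],
      Or.inr rfl⟩
    exact (map_ne_zero _).2 ((map_ne_zero _).2 s.a_ne_zero)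

theorem sub_step (hj : ∀ x, U.σ (j x) = j (L.σ x)) (hs : s.IsSigma) :
    U.σ (j s.t) - j s.t = (j.comp s.emb) s.a := by
  rw [hj, hs, map_add, add_sub_cancel_left]; rfl

theorem isPi_step (hj : ∀ x, U.σ (j x) = j (L.σ x)) (hs : ¬ s.IsSigma) {V : Subfield U}
    (ha : (j.comp s.emb) s.a ∈ V) : IsPi U.σ V (j s.t) := by
  refine ⟨_, ha, (map_ne_zero _).2 s.a_ne_zero, ?_⟩
  rw [hj, s.shift.resolve_left hs, map_mul]; rfl

theorem equivariant_step (hj : ∀ x, U.σ (j x) = j (L.σ x)) (x : K) :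
    U.σ ((j.comp s.emb) x) = (j.comp s.emb) (K.σ x) := by
  rw [RingHom.comp_apply, hj, s.emb_σ]; rfl

theorem isStable_fieldRange (hj : ∀ x, U.σ (j x) = j (L.σ x)) : IsStable U.σ j.fieldRange := by
  intro x
  constructor
  · rintro ⟨y, hy⟩
    refine ⟨L.σ.symm y, U.σ.injective ?_⟩
    rw [hj, L.σ.apply_symm_apply, hy]
  · rintro ⟨y, rfl⟩
    exact ⟨L.σ y, (hj y).symm⟩

end Step

/-! ### Towers realized inside the ambient filtration -/

section Realization

variable {G : DiffField.{u}} {U : DiffField.{u}}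

/-- The images under `j` of the `Π`-generators of depth `n`. -/
def piGens : {K : DiffField.{u}} → PiSigmaTower G K → (K →+* U) → ℕ → Set U
  | _, .base, _, _ => ∅
  | _, .step T s, j, n =>
      T.piGens (j.comp s.emb) n ∪ {z | z = j s.t ∧ ¬ s.IsSigma ∧ T.depth s.a + 1 = n}

/-- Over the `n`-th level of the filtration `W`, the generators of depth greater than `n` are
algebraically independent. -/
def IndepOver (W : ℕ → Subfield U) : {K : DiffField.{u}} → PiSigmaTower G K → (K →+* U) → Prop
  | _, .base, _ => True
  | _, .step T s, j => IndepOver W T (j.comp s.emb) ∧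
      ∀ n ≤ T.depth s.a, TransOver (W n ⊔ (j.comp s.emb).fieldRange) (j s.t)

theorem piGens_subset_fieldRange : ∀ {K : DiffField.{u}} (T : PiSigmaTower G K) (j : K →+* U)
    (n : ℕ), T.piGens j n ⊆ j.fieldRange
  | _, .base, _, _ => Set.empty_subset _
  | _, .step T s, j, n => by
    rintro z (hz | ⟨rfl, -⟩)
    · obtain ⟨x, rfl⟩ := piGens_subset_fieldRange T (j.comp s.emb) n hz
      exact ⟨s.emb x, rfl⟩
    · exact ⟨_, rfl⟩

theorem piGens_comp_of_isSigma {K : DiffField.{u}} (T : PiSigmaTower G K) (n : ℕ) :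
    ∀ {L : DiffField.{u}} (X : PiSigmaTower K L) (j : L →+* U), X.IsSigma →
      (T.comp X).piGens j n = T.piGens (j.comp X.emb) n
  | _, .base, _, _ => rfl
  | _, .step X s, j, h => by
    simp only [comp, piGens, h.2, not_true_eq_false, false_and, and_false, Set.ofPred_false,
      Set.union_empty]
    exact piGens_comp_of_isSigma T n X (j.comp s.emb) h.1

theorem piGens_subset_comp {K : DiffField.{u}} (T : PiSigmaTower G K) (n : ℕ) :
    ∀ {L : DiffField.{u}} (X : PiSigmaTower K L) (j : L →+* U),
      T.piGens (j.comp X.emb) n ⊆ (T.comp X).piGens j n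
  | _, .base, _ => subset_rfl
  | _, .step X s, j => (piGens_subset_comp T n X (j.comp s.emb)).trans Set.subset_union_left

/-- The rule δ(t) = δ(a) + 1 matches the filtration: a sum or product over one level enters at the
next. -/
theorem depthField_le_sumFilt : ∀ {K : DiffField.{u}} (T : PiSigmaTower G K) (j : K →+* U)
    (_ : ∀ x, U.σ (j x) = j (K.σ x)) (n : ℕ),
    T.depthField j n ≤ sumFilt U.σ (j.comp T.emb).fieldRange (T.piGens j) n
  | _, .base, _, _, n => le_sumFilt n
  | _, .step T s, j, hj, n => by
    have hle : ∀ n, sumFilt U.σ ((j.comp s.emb).comp T.emb).fieldRange (T.piGens (j.comp s.emb)) n ≤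
        sumFilt U.σ (j.comp (T.step s).emb).fieldRange ((T.step s).piGens j) n :=
      sumFilt_le_sumFilt le_rfl fun _ => Set.subset_union_left
    have ih := depthField_le_sumFilt T (j.comp s.emb) (equivariant_step hj)
    refine sup_le ((ih n).trans (hle n)) (Subfield.closure_le.2 ?_)
    rintro _ ⟨rfl, hn⟩
    refine sumFilt_mono hn ?_
    by_cases hs : s.IsSigma
    · refine sum_mem_sumFilt ?_
      rw [sub_step hj hs]
      exact hle _ (ih _ ((T.depth_le_iff (j.comp s.emb)).1 le_rfl))
    · exact mem_sumFilt_of_mem (Or.inr ⟨rfl, hs, rfl⟩)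

theorem piAdmissible_piGens : ∀ {K : DiffField.{u}} (T : PiSigmaTower G K) (j : K →+* U)
    (_ : ∀ x, U.σ (j x) = j (K.σ x)), PiAdmissible U.σ (j.comp T.emb).fieldRange (T.piGens j)
  | _, .base, _, _ => fun _ _ h => h.elim
  | _, .step T s, j, hj => by
    have hle : ∀ n, sumFilt U.σ ((j.comp s.emb).comp T.emb).fieldRange (T.piGens (j.comp s.emb)) n ≤
        sumFilt U.σ (j.comp (T.step s).emb).fieldRange ((T.step s).piGens j) n :=
      sumFilt_le_sumFilt le_rfl fun _ => Set.subset_union_left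
    rintro n q (hq | ⟨rfl, hs, hn⟩)
    · exact (piAdmissible_piGens T (j.comp s.emb) (equivariant_step hj) n q hq).mono (hle n)
    · refine isPi_step hj hs (hle n (depthField_le_sumFilt T _ (equivariant_step hj) n ?_))
      exact (T.depth_le_iff _).1 (Nat.succ.inj hn).le

/-- Generators of depth at most n are already in V. Each deeper one is transcendental over W_n and
the generators below it, so `adj_inf_le` removes it. -/
theorem inf_le_of_indepOver {W : ℕ → Subfield U} {V : Subfield U} {n : ℕ} (hVW : V ≤ W n) :
    ∀ {K : DiffField.{u}} (T : PiSigmaTower G K) (j : K →+* U), IndepOver W T j →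
      T.depthField j n ≤ V → (V ⊔ j.fieldRange) ⊓ W n ≤ V
  | _, .base, j, _, hD => by
    rw [sup_eq_left.2 (show j.fieldRange ≤ V from hD)]; exact inf_le_left
  | _, .step T s, j, hI, hD => by
    have ih := inf_le_of_indepOver hVW T (j.comp s.emb) hI.1 (le_sup_left.trans hD)
    rw [fieldRange_step s j, sup_adj]
    by_cases hn : T.depth s.a + 1 ≤ n
    · have ht : j s.t ∈ V := hD ((le_sup_right : _ ≤ T.depthField (j.comp s.emb) n ⊔ _)
        (Subfield.subset_closure ⟨rfl, hn⟩))
      rw [adj_eq_self ((le_sup_left : V ≤ _) ht)]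
      exact ih
    · rintro a ⟨ha, haW⟩
      refine ih ⟨adj_inf_le (sup_le_sup_right hVW _) (hI.2 n (by omega)) ⟨ha, ?_⟩, haW⟩
      exact (le_sup_left : W n ≤ _) haW

/-- The ambient field `U`, in which everything is summable, together with the generating products
of a filtration. -/
structure Ambient (U : DiffField.{u}) (G₀ : Subfield U) (Q : ℕ → Set U) : Prop where
  stable : IsStable U.σ G₀
  const : ∀ c, U.σ c = c → c ∈ G₀
  adm : PiAdmissible U.σ G₀ Q
  summable : ∀ a : U, ∃ y, U.σ y - y = a

/-- The tower `T` is realized in `U` by `j`, compatibly with the filtration given by `Q`. -/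
structure Realizes (G₀ : Subfield U) (Q : ℕ → Set U) {K : DiffField.{u}} (T : PiSigmaTower G K)
    (j : K →+* U) : Prop where
  equivariant : ∀ x, U.σ (j x) = j (K.σ x)
  ground : (j.comp T.emb).fieldRange = G₀
  pi : ∀ n, T.piGens j n ⊆ Q n
  indep : IndepOver (sumFilt U.σ G₀ Q) T j

theorem descends_sup_fieldRange {G₀ V : Subfield U} {Q : ℕ → Set U} (hA : Ambient U G₀ Q) {n : ℕ}
    (hd : Descends U.σ V (sumFilt U.σ G₀ Q n) V) (hVW : V ≤ sumFilt U.σ G₀ Q n) (hGV : G₀ ≤ V) :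
    ∀ {K : DiffField.{u}} (T : PiSigmaTower G K) (j : K →+* U)
      (_ : ∀ x, U.σ (j x) = j (K.σ x)), IndepOver (sumFilt U.σ G₀ Q) T j →
      T.depthField j n ≤ V → Descends U.σ V (sumFilt U.σ G₀ Q n) (V ⊔ j.fieldRange)
  | _, .base, j, _, _, hD => by rwa [sup_eq_left.2 (show j.fieldRange ≤ V from hD)]
  | _, .step T s, j, hj, hI, hD => by
    have ih := descends_sup_fieldRange hA hd hVW hGV T (j.comp s.emb) (equivariant_step hj) hI.1
      (le_sup_left.trans hD)
    rw [fieldRange_step s j, sup_adj]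
    by_cases hn : T.depth s.a + 1 ≤ n
    · have ht : j s.t ∈ V := hD ((le_sup_right : _ ≤ T.depthField (j.comp s.emb) n ⊔ _)
        (Subfield.subset_closure ⟨rfl, hn⟩))
      rw [adj_eq_self ((le_sup_left : V ≤ _) ht)]
      exact ih
    · refine ih.adj (isStable_sumFilt hA.stable hA.adm n)
        (twistedDescent_sumFilt hA.stable hA.adm n) hA.const (hGV.trans le_sup_left) ?_
        ((isStep_step hj).mono le_sup_right)
      rw [sup_right_comm, sup_eq_right.2 hVW]
      exact hI.2 n (by omega)

/-- A product of depth n + 1 has its multiplier in V and is independent of W_n and the earlier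
generators, so `Descends.adj` adjoins these products one by one. -/
theorem descends_sup_piGens {G₀ V : Subfield U} {Q : ℕ → Set U} (hA : Ambient U G₀ Q) {n : ℕ}
    (hd : Descends U.σ V (sumFilt U.σ G₀ Q n) V) (hVW : V ≤ sumFilt U.σ G₀ Q n) (hGV : G₀ ≤ V) :
    ∀ {K : DiffField.{u}} (T : PiSigmaTower G K) (j : K →+* U)
      (_ : ∀ x, U.σ (j x) = j (K.σ x)), IndepOver (sumFilt U.σ G₀ Q) T j →
      T.depthField j n ≤ V →
      Descends U.σ V (sumFilt U.σ G₀ Q n) (V ⊔ Subfield.closure (T.piGens j (n + 1)))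
  | _, .base, j, _, _, _ => by simpa [piGens] using hd
  | _, .step T s, j, hj, hI, hD => by
    have ih := descends_sup_piGens hA hd hVW hGV T (j.comp s.emb) (equivariant_step hj) hI.1
      (le_sup_left.trans hD)
    by_cases hs : ¬ s.IsSigma ∧ T.depth s.a + 1 = n + 1
    · simp only [piGens, hs.1, hs.2, not_false_eq_true, and_true, Set.ofPred_eq_eq_singleton,
        Subfield.closure_union]
      rw [← sup_assoc]
      have ha : T.depth s.a = n := Nat.succ.inj hs.2
      have haV : (j.comp s.emb) s.a ∈ V :=
        (le_sup_left.trans hD) ((T.depth_le_iff (j.comp s.emb)).1 ha.le)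
      refine ih.adj (isStable_sumFilt hA.stable hA.adm n)
        (twistedDescent_sumFilt hA.stable hA.adm n) hA.const (hGV.trans le_sup_left) ?_
        (isPi_step hj hs.1 ((le_sup_left : V ≤ _) haV)).isStep
      refine (hI.2 n ha.ge).anti (sup_le (sup_le (hVW.trans le_sup_left) ?_) le_sup_left)
      exact (Subfield.closure_le.2 (piGens_subset_fieldRange T _ _)).trans le_sup_right
    · have : {z | z = j s.t ∧ ¬ s.IsSigma ∧ T.depth s.a + 1 = n + 1} = ∅ := by
        ext z; simp only [Set.mem_ofPred_eq, hs, and_false, Set.mem_empty_iff_false]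
      simpa only [piGens, this, Set.union_empty] using ih

variable {G₀ : Subfield U} {Q : ℕ → Set U} {K : DiffField.{u}} {T : PiSigmaTower G K} {j : K →+* U}

theorem Realizes.depthField_le (hR : Realizes G₀ Q T j) (n : ℕ) :
    T.depthField j n ≤ sumFilt U.σ G₀ (T.piGens j) n := by
  rw [← hR.ground]; exact depthField_le_sumFilt T j hR.equivariant n

theorem Realizes.adm (hR : Realizes G₀ Q T j) : PiAdmissible U.σ G₀ (T.piGens j) := by
  rw [← hR.ground]; exact piAdmissible_piGens T j hR.equivariant

theorem Realizes.sumFilt_le (hR : Realizes G₀ Q T j) (n : ℕ) :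
    sumFilt U.σ G₀ (T.piGens j) n ≤ sumFilt U.σ G₀ Q n :=
  sumFilt_le_sumFilt le_rfl hR.pi n

theorem Realizes.descends (hA : Ambient U G₀ Q) (hR : Realizes G₀ Q T j) (n : ℕ) :
    Descends U.σ (sumFilt U.σ G₀ (T.piGens j) n) (sumFilt U.σ G₀ Q n)
      (sumFilt U.σ G₀ (T.piGens j) n) :=
  descends_sumFilt hA.stable hA.const hR.adm hA.adm hR.pi
    (fun n hd => descends_sup_piGens hA hd (hR.sumFilt_le n) (le_sumFilt n) T j hR.equivariant
      hR.indep (hR.depthField_le n)) n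

/-- Products are not needed to sum elements of `K` at a given level of the filtration. -/
theorem Realizes.mem_sup_of_sub_mem (hA : Ambient U G₀ Q) (hR : Realizes G₀ Q T j) {n : ℕ} {h : U}
    (hh : h ∈ sumFilt U.σ G₀ Q n ⊔ j.fieldRange) (he : U.σ h - h ∈ j.fieldRange) :
    h ∈ sumFilt U.σ G₀ (T.piGens j) n ⊔ j.fieldRange := by
  cases n with
  | zero => exact hh
  | succ n =>
    have hd := descends_sup_fieldRange hA (hR.descends hA n) (hR.sumFilt_le n) (le_sumFilt n) T j
      hR.equivariant hR.indep (hR.depthField_le n)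
    obtain ⟨m, hm, y, hy, rfl⟩ := hd.exists_eq_add hA.stable hA.const hA.adm (h := h) (by
      rw [sup_comm] at hh
      exact (sup_le_sup_right le_sup_right _ : j.fieldRange ⊔ _ ≤ _) hh) ((le_sup_right : j.fieldRange ≤ _) he)
    exact add_mem (sup_le_sup_right (sumFilt_mono (Nat.le_succ n)) _ hm)
      ((le_sup_left : sumFilt U.σ G₀ (T.piGens j) (n + 1) ≤ _) (sum_mem_sumFilt hy))

/-- Membership in the filtration bounds the depth. -/
theorem Realizes.fieldRange_inf_le (hR : Realizes G₀ Q T j) (n : ℕ) :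
    j.fieldRange ⊓ sumFilt U.σ G₀ Q n ≤ T.depthField j n :=
  (inf_le_inf_right _ le_sup_right).trans (inf_le_of_indepOver
    ((hR.depthField_le n).trans (hR.sumFilt_le n)) T j hR.indep le_rfl)

end Realization

end PiSigmaTower

namespace PiSigmaTower

open DiffAlg

/-! ### Depth of generators and extension depth -/

section StepDepth

variable {G K L : DiffField.{u}} (T : PiSigmaTower G K) (s : PiSigmaStep K L)

theorem depthField_step_of_le {U : Type*} [Field U] (j : L →+* U) {n : ℕ}
    (hn : T.depth s.a + 1 ≤ n) :
    (T.step s).depthField j n = adj (T.depthField (j.comp s.emb) n) (j s.t) := by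
  rw [depthField_step]
  simp only [hn, and_true, Set.ofPred_eq_eq_singleton]

theorem depthField_step_of_not_le {U : Type*} [Field U] (j : L →+* U) {n : ℕ}
    (hn : ¬ T.depth s.a + 1 ≤ n) :
    (T.step s).depthField j n = T.depthField (j.comp s.emb) n := by
  have : {z | z = j s.t ∧ T.depth s.a + 1 ≤ n} = ∅ := by
    ext z; simp only [Set.mem_ofPred_eq, hn, and_false, Set.mem_empty_iff_false]
  rw [depthField_step, this, Subfield.closure_empty, sup_bot_eq]

theorem depth_step_emb_le_iff {x : K} {n : ℕ} : (T.step s).depth (s.emb x) ≤ n ↔ T.depth x ≤ n := by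
  rw [depth_le_iff _ (RingHom.id L), depth_le_iff T ((RingHom.id L).comp s.emb)]
  by_cases hn : T.depth s.a + 1 ≤ n
  · rw [depthField_step_of_le T s _ hn]
    refine ⟨fun h => ?_, fun h => le_adj h⟩
    exact adj_inf_le (depthField_le_fieldRange T _ n) (transOver_step s (RingHom.id L))
      ⟨h, ⟨x, rfl⟩⟩
  · rw [depthField_step_of_not_le T s _ hn]; rfl

theorem depth_step_t_le_iff {n : ℕ} : (T.step s).depth s.t ≤ n ↔ T.depth s.a + 1 ≤ n := by
  rw [depth_le_iff _ (RingHom.id L)]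
  refine ⟨fun h => ?_, fun hn => ?_⟩
  · by_contra hn
    rw [depthField_step_of_not_le T s _ hn] at h
    have h1 := depthField_le_fieldRange T _ n h
    have := (transOver_step s (RingHom.id L)).zpow_notMem one_ne_zero
    rw [zpow_one] at this
    exact this h1
  · rw [depthField_step_of_le T s _ hn]
    exact self_mem_adj

theorem extDepth_le_iff {n : ℕ} : ∀ {L : DiffField.{u}} (X : PiSigmaTower K L),
    T.extDepth X ≤ n ↔ T.ExtLE X n
  | _, .base => by
    simp only [ExtLE, iff_true, extDepth]
    exact Finset.sup_le fun i _ => i.elim0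
  | _, .step X s => by
    have ih := extDepth_le_iff (n := n) X
    rw [extDepth, Finset.sup_le_iff] at ih ⊢
    simp only [Finset.mem_univ, true_imp_iff] at ih ⊢
    have hg : ∀ i : Fin X.length, (X.step s).gen i.castSucc = s.emb (X.gen i) :=
      fun i => Fin.snoc_castSucc (α := fun _ => _) _ _ i
    have hl : (X.step s).gen (Fin.last _) = s.t := Fin.snoc_last (α := fun _ => _) _ _
    rw [ExtLE, ← ih, ← depth_step_t_le_iff (T.comp X) s]
    constructor
    · refine fun h => ⟨fun i => ?_, ?_⟩
      · rw [← depth_step_emb_le_iff (T.comp X) s, ← hg i]; exact h _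
      · rw [← hl]; exact h _
    · rintro ⟨h1, h2⟩ i
      induction i using Fin.lastCases with
      | last => rw [hl]; exact h2
      | cast i => rw [hg i]; exact (depth_step_emb_le_iff (T.comp X) s).2 (h1 i)

theorem depthField_le_comp {U : Type*} [Field U] (n : ℕ) :
    ∀ {L : DiffField.{u}} (X : PiSigmaTower K L) (j : L →+* U),
      T.depthField (j.comp X.emb) n ≤ (T.comp X).depthField j n
  | _, .base, _ => le_rfl
  | _, .step X s, j => (depthField_le_comp n X (j.comp s.emb)).trans le_sup_left

end StepDepth

/-! ### Transporting single sums and towers to and from the ambient field -/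

section Embedding

variable {K L U : DiffField.{u}} {s : PiSigmaStep K L} {j : K →+* U}

/-- Otherwise t - b is a constant, so it lies in K, and t does too. -/
theorem not_summable_step (hs : s.IsSigma) (b : K) : K.σ b - b ≠ s.a := by
  intro hb
  obtain ⟨c, -, hc⟩ := s.const (s.t - s.emb b) (by
    rw [map_sub, hs, s.emb_σ, ← hb, map_sub]; ring)
  have h0 := s.transcendental (Polynomial.X - Polynomial.C (c + b)) (by
    rw [Polynomial.eval₂_sub, Polynomial.eval₂_X, Polynomial.eval₂_C, map_add, hc]; ring)
  exact Polynomial.X_sub_C_ne_zero _ h0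

/-- A transcendental sum in `U` realizes a single `Σ*`-extension. -/
theorem exists_hom_step (hj : ∀ x, U.σ (j x) = j (K.σ x)) (hs : s.IsSigma) {y : U}
    (hy : U.σ y - y = j s.a) (hT : TransOver j.fieldRange y) :
    ∃ j' : L →+* U, j'.comp s.emb = j ∧ ∀ x, U.σ (j' x) = j' (L.σ x) := by
  let f : Polynomial K →+* L := Polynomial.eval₂RingHom s.emb s.t
  let g : Polynomial K →+* U := Polynomial.eval₂RingHom j y
  have hf : Function.Injective f := (injective_iff_map_eq_zero f).2 fun p hp => s.transcendental p hp
  have hg : Function.Injective g := (injective_iff_map_eq_zero g).2 fun p hp => by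
    have h1 : p.map j = 0 := hT _ (fun i => by rw [Polynomial.coeff_map]; exact ⟨_, rfl⟩) (by
      rw [Polynomial.eval_map]; exact hp)
    exact (Polynomial.map_eq_zero_iff j.injective).1 h1
  let _ := f.toAlgebra
  have : FaithfulSMul (Polynomial K) L := (faithfulSMul_iff_algebraMap_injective _ _).2 hf
  -- Regard L as the fraction field of K[X] with X ↦ t; then evaluation at y extends to L.
  have : IsFractionRing (Polynomial K) L := by
    refine IsFractionRing.of_field _ _ fun z => ?_
    have hz : z ∈ adj ((RingHom.id L).comp s.emb).fieldRange ((RingHom.id L) s.t) := by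
      rw [← fieldRange_step]; exact ⟨z, rfl⟩
    obtain ⟨A, D, hA, hD, -, -, rfl⟩ := exists_eq_div_of_mem_adj hz
    have hlift : ∀ {P : Polynomial L}, CoeffIn ((RingHom.id L).comp s.emb).fieldRange P →
        ∃ p : Polynomial K, p.map s.emb = P := fun {P} hP => by
      have := Polynomial.mem_map_range s.emb (p := P)
      rw [RingHom.mem_range] at this
      exact this.2 hP
    obtain ⟨a, rfl⟩ := hlift hA
    obtain ⟨d, rfl⟩ := hlift hD
    refine ⟨a, d, ?_⟩
    rw [Polynomial.eval_map, Polynomial.eval_map]; rfl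
  let j' : L →+* U := IsFractionRing.lift (A := Polynomial K) (K := L) hg
  have hj' : ∀ p, j' (f p) = g p := fun p => IsFractionRing.lift_algebraMap hg p
  have hemb : j'.comp s.emb = j := by
    ext x
    have := hj' (Polynomial.C x)
    simpa [f, g] using this
  have ht : j' s.t = y := by
    have := hj' Polynomial.X
    simpa [f, g] using this
  refine ⟨j', hemb, fun x => ?_⟩
  have hcomp : ((U.σ : U →+* U).comp j') = j'.comp (L.σ : L →+* L) := by
    refine RingHom.eq_of_eqOn_of_field_closure_eq_top s.generates ?_
    rintro _ (⟨x, rfl⟩ | rfl)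
    · have h1 : ∀ x, j' (s.emb x) = j x := fun x => RingHom.congr_fun hemb x
      change U.σ (j' (s.emb x)) = j' (L.σ (s.emb x))
      rw [s.emb_σ, h1, h1, hj]
    · have h1 : j' (s.emb s.a) = j s.a := RingHom.congr_fun hemb s.a
      change U.σ (j' s.t) = j' (L.σ s.t)
      rw [hs, map_add, ht, h1, ← hy]; ring
  exact RingHom.congr_fun hcomp x

/-- A sum y in U of the next summand cannot lie in the image already built, by `not_summable_step`.
Since that image contains all constants, y is transcendental over it and realizes the next step. -/
theorem exists_hom_tower (hsum : ∀ a : U, ∃ y, U.σ y - y = a)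
    (hC : ∀ c, U.σ c = c → c ∈ j.fieldRange) (hj : ∀ x, U.σ (j x) = j (K.σ x)) :
    ∀ {L : DiffField.{u}} (X : PiSigmaTower K L), X.IsSigma →
      ∃ j' : L →+* U, j'.comp X.emb = j ∧ ∀ x, U.σ (j' x) = j' (L.σ x)
  | _, .base, _ => ⟨j, rfl, hj⟩
  | _, .step X s, hX => by
    obtain ⟨j₁, hj₁, heq⟩ := exists_hom_tower hsum hC hj X hX.1
    obtain ⟨y, hy⟩ := hsum (j₁ s.a)
    have hle : j.fieldRange ≤ j₁.fieldRange := by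
      rintro _ ⟨x, rfl⟩
      exact ⟨X.emb x, RingHom.congr_fun hj₁ x⟩
    have hT := (mem_or_transOver (isStable_fieldRange heq) (fun c hc => hle (hC c hc))
      (y := y) ⟨s.a, hy.symm⟩).resolve_left (by
        rintro ⟨b, rfl⟩
        rw [heq, ← map_sub] at hy
        exact not_summable_step hX.2 b (j₁.injective hy))
    obtain ⟨j₂, hj₂, heq₂⟩ := exists_hom_step heq hX.2 hy hT
    exact ⟨j₂, by rw [← hj₁, ← hj₂]; rfl, heq₂⟩

/-- The difference subfield of `U` with a given stable underlying field. -/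
noncomputable def _root_.DiffField.ofSubfield (U : DiffField.{u}) (L : Subfield U)
    (hL : IsStable U.σ L) : DiffField.{u} where
  carrier := L
  charZero := (L.subtype.charZero_iff L.subtype.injective).2 inferInstance
  σ :=
    { toFun := fun x => ⟨U.σ x, hL.map_mem x.2⟩
      invFun := fun x => ⟨U.σ.symm x, by rw [← hL]; simp⟩
      left_inv := fun x => Subtype.ext (by simp)
      right_inv := fun x => Subtype.ext (by simp)
      map_mul' := fun x y => Subtype.ext (by simp)
      map_add' := fun x y => Subtype.ext (by simp) }

/-- Adjoining a transcendental sum inside `U` gives a single `Σ*`-extension. -/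
theorem exists_step (hj : ∀ x, U.σ (j x) = j (K.σ x)) (hC : ∀ c, U.σ c = c → c ∈ j.fieldRange)
    {a : K} {y : U} (hy : U.σ y - y = j a) (hT : TransOver j.fieldRange y) :
    ∃ (L : DiffField.{u}) (s : PiSigmaStep K L) (j' : L →+* U), j'.comp s.emb = j ∧ j' s.t = y ∧
      s.a = a ∧ s.IsSigma ∧ ∀ x, U.σ (j' x) = j' (L.σ x) := by
  have hst : IsStable U.σ (adj j.fieldRange y) :=
    (isStep_of_sub_mem (show U.σ y - y ∈ j.fieldRange from ⟨a, hy.symm⟩)).isStable_adj (isStable_fieldRange hj)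
  let L := U.ofSubfield _ hst
  let i : L →+* U := (adj j.fieldRange y).subtype
  have hi : Function.Injective i := Subtype.val_injective
  let e : K →+* L := j.codRestrict (adj j.fieldRange y) fun x => le_adj ⟨x, rfl⟩
  let t : L := ⟨y, self_mem_adj⟩
  have hie : ∀ x, i (e x) = j x := fun _ => rfl
  have hit : i t = y := rfl
  have hiσ : ∀ x, U.σ (i x) = i (L.σ x) := fun _ => rfl
  have hσt : L.σ t = t + e a := hi (by rw [← hiσ, map_add, hie, hit, ← hy]; ring)
  refine ⟨L, ⟨e, fun x => hi ?_, t, fun p hp => ?_, ?_, a, ?_, Or.inl hσt, fun c hc => ?_⟩, i, rfl,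
    rfl, rfl, hσt, hiσ⟩
  · rw [← hiσ, hie, hie, hj]
  · have h1 : p.map j = 0 := hT _ (fun n => by rw [Polynomial.coeff_map]; exact ⟨_, rfl⟩) (by
      have := congrArg i hp
      rw [Polynomial.hom_eval₂, map_zero] at this
      rw [Polynomial.eval_map]; exact this)
    exact (Polynomial.map_eq_zero_iff j.injective).1 h1
  · rw [eq_top_iff]
    rintro x -
    have hx : i x ∈ (Subfield.closure (Set.range e ∪ {t})).map i := by
      refine adj_le (M := (Subfield.closure (Set.range e ∪ {t})).map i) ?_ ?_ x.2
      · rintro _ ⟨z, rfl⟩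
        exact ⟨e z, Subfield.subset_closure (Or.inl ⟨z, rfl⟩), rfl⟩
      · exact ⟨t, Subfield.subset_closure (Or.inr rfl), rfl⟩
    obtain ⟨z, hz, hzx⟩ := hx
    rwa [← hi hzx]
  · rintro rfl
    rw [map_zero, sub_eq_zero] at hy
    have := hT.zpow_notMem one_ne_zero
    rw [zpow_one] at this
    exact this (hC y hy)
  · obtain ⟨c₀, hc₀⟩ := hC (i c) (by rw [hiσ, hc])
    refine ⟨c₀, j.injective ?_, hi (by rw [hie, hc₀])⟩
    rw [← hj, hc₀, hiσ, hc]

end Embedding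

end PiSigmaTower

namespace PiSigmaTower

open DiffAlg

/-! ### Reaching the filtration by depth-optimal extensions -/

section Extension

variable {G K U : DiffField.{u}} {G₀ : Subfield U} {Q P : ℕ → Set U} {T : PiSigmaTower G K}
  {j : K →+* U} {m n : ℕ}

theorem Realizes.ground_le (hR : Realizes G₀ Q T j) : G₀ ≤ j.fieldRange := by
  rw [← hR.ground]
  rintro _ ⟨x, rfl⟩
  exact ⟨T.emb x, rfl⟩

theorem Realizes.const_mem (hA : Ambient U G₀ Q) (hR : Realizes G₀ Q T j) (c : U)
    (hc : U.σ c = c) : c ∈ j.fieldRange := hR.ground_le (hA.const c hc)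

theorem piGens_subset_depthField : ∀ {K : DiffField.{u}} (T : PiSigmaTower G K) (j : K →+* U)
    (n : ℕ), T.piGens j n ⊆ T.depthField j n
  | _, .base, _, _ => Set.empty_subset _
  | _, .step T s, j, n => by
    rintro z (hz | ⟨rfl, -, hn⟩)
    · exact (le_sup_left : T.depthField (j.comp s.emb) n ≤ _)
        (piGens_subset_depthField T (j.comp s.emb) n hz)
    · rw [depthField_step_of_le T s j hn.le]
      exact self_mem_adj

/-- A `Σ*`-extension of depth at most `n` consists of sums up to level `n` of the filtration. -/
theorem fieldRange_le_of_extLE : ∀ {L : DiffField.{u}} (X : PiSigmaTower K L) (j : L →+* U)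
    (_ : ∀ x, U.σ (j x) = j (L.σ x)), X.IsSigma → T.ExtLE X n →
    j.fieldRange ≤ sumFilt U.σ (j.comp (T.comp X).emb).fieldRange (T.piGens (j.comp X.emb)) n ⊔
      (j.comp X.emb).fieldRange
  | _, .base, _, _, _, _ => le_sup_right
  | _, .step X s, j, hj, hX, hn => by
    rw [fieldRange_step s j]
    refine adj_le (fieldRange_le_of_extLE X (j.comp s.emb) (equivariant_step hj) hX.1 hn.1) ?_
    refine (le_sup_left : sumFilt _ _ _ _ ≤ _) (sumFilt_mono hn.2 (sum_mem_sumFilt ?_))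
    rw [sub_step hj hX.2]
    have h := depthField_le_sumFilt (T.comp X) (j.comp s.emb) (equivariant_step hj) _
      (((T.comp X).depth_le_iff (j.comp s.emb)).1 (le_refl ((T.comp X).depth s.a)))
    rwa [funext fun n => piGens_comp_of_isSigma T n X (j.comp s.emb) hX.1] at h

/-- `Y` is a `Σ^δ`-extension of depth at most `n`, realized in `U`. -/
structure Extends (G₀ : Subfield U) (Q : ℕ → Set U) (T : PiSigmaTower G K) (j : K →+* U) (n : ℕ)
    {S : DiffField.{u}} (Y : PiSigmaTower K S) (jS : S →+* U) : Prop where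
  comp_emb : jS.comp Y.emb = j
  isSigma : Y.IsSigma
  isDepthOptimal : T.IsDepthOptimal Y
  extLE : T.ExtLE Y n
  realizes : Realizes G₀ Q (T.comp Y) jS

variable {S : DiffField.{u}} {Y : PiSigmaTower K S} {jS : S →+* U}

theorem Realizes.extends_base (hR : Realizes G₀ Q T j) : Extends G₀ Q T j n .base j :=
  ⟨rfl, trivial, trivial, trivial, hR⟩

theorem Extends.trans {S' : DiffField.{u}} {Z : PiSigmaTower S S'} {jZ : S' →+* U}
    (hY : Extends G₀ Q T j n Y jS) (hZ : Extends G₀ Q (T.comp Y) jS n Z jZ) :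
    Extends G₀ Q T j n (Y.comp Z) jZ where
  comp_emb := by rw [emb_comp, ← RingHom.comp_assoc, hZ.comp_emb, hY.comp_emb]
  isSigma := (isSigma_comp Y Z).2 ⟨hY.isSigma, hZ.isSigma⟩
  isDepthOptimal := (isDepthOptimal_comp T Y Z).2 ⟨hY.isDepthOptimal, hZ.isDepthOptimal⟩
  extLE := (extLE_comp T Y Z).2 ⟨hY.extLE, hZ.extLE⟩
  realizes := by rw [comp_assoc]; exact hZ.realizes

theorem Extends.mono (hmn : m ≤ n) (hY : Extends G₀ Q T j m Y jS) : Extends G₀ Q T j n Y jS :=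
  { hY with extLE := hY.extLE.mono hmn }

theorem Extends.piGens_eq (hY : Extends G₀ Q T j n Y jS) : (T.comp Y).piGens jS = T.piGens j := by
  ext1 n
  rw [piGens_comp_of_isSigma T n Y jS hY.isSigma, hY.comp_emb]

theorem Extends.fieldRange_le (hY : Extends G₀ Q T j n Y jS) : j.fieldRange ≤ jS.fieldRange := by
  rw [← hY.comp_emb]
  rintro _ ⟨x, rfl⟩
  exact ⟨Y.emb x, rfl⟩

theorem Extends.depthField_le (hY : Extends G₀ Q T j n Y jS) (m : ℕ) :
    T.depthField j m ≤ (T.comp Y).depthField jS m := by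
  rw [← hY.comp_emb]; exact depthField_le_comp T m Y jS

variable (G₀ Q P n) in
/-- Every realized tower with products `P` has a `Σ^δ`-extension of depth at most `n` whose elements
of depth at most `n` contain `A`. -/
def Reachable (G : DiffField.{u}) (A : Set U) : Prop :=
  ∀ ⦃K : DiffField.{u}⦄ (T : PiSigmaTower G K) (j : K →+* U), Realizes G₀ Q T j → T.piGens j = P →
    ∃ (S : DiffField.{u}) (Y : PiSigmaTower K S) (jS : S →+* U), Extends G₀ Q T j n Y jS ∧
      A ⊆ (T.comp Y).depthField jS n

/-- Reachability quantifies over all realized towers with products P because Σ-extensions keep the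
products unchanged; the extended tower can therefore be extended again. -/
theorem reachable_of_finite {A : Set U} (hA : A.Finite)
    (h : ∀ a ∈ A, Reachable G₀ Q P n G {a}) : Reachable G₀ Q P n G A := by
  induction A, hA using Set.Finite.induction_on with
  | empty => exact fun K T j hR _ => ⟨K, .base, j, hR.extends_base, Set.empty_subset _⟩
  | @insert a A _ _ ih =>
    intro K T j hR hP
    obtain ⟨S, Y, jS, hY, hAY⟩ := ih (fun b hb => h b (Or.inr hb)) T j hR hP
    obtain ⟨S', Z, jZ, hZ, haZ⟩ := h a (Or.inl rfl) (T.comp Y) jS hY.realizes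
      (hY.piGens_eq.trans hP)
    refine ⟨S', Y.comp Z, jZ, hY.trans hZ, ?_⟩
    rw [comp_assoc]
    rintro b (rfl | hb)
    exacts [haZ rfl, hZ.depthField_le n (hAY hb)]

theorem reachable_of_mem_closure {Z : Set U} {a : U} (ha : a ∈ Subfield.closure Z)
    (h : ∀ z ∈ Z, Reachable G₀ Q P n G {z}) : Reachable G₀ Q P n G {a} := by
  obtain ⟨B, hB, haB⟩ := exists_finset_of_mem_sup_closure ((le_sup_right : Subfield.closure Z ≤ ⊥ ⊔ _) ha)
  rw [bot_sup_eq] at haB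
  intro K T j hR hP
  obtain ⟨S, Y, jS, hY, hBY⟩ := reachable_of_finite B.finite_toSet (fun b hb => h b (hB hb)) T j hR hP
  exact ⟨S, Y, jS, hY, Set.singleton_subset_iff.2 (Subfield.closure_le.2 hBY haB)⟩

variable (G₀ Q n) in
/-- The `n`-th level of the filtration by sums can be reached by `Σ^δ`-extensions. -/
def LevelReachable (G : DiffField.{u}) : Prop :=
  ∀ P : ℕ → Set U, PiAdmissible U.σ G₀ P → ∀ a ∈ sumFilt U.σ G₀ P n, Reachable G₀ Q P n G {a}

theorem LevelReachable.exists_mem_fieldRange (hn : LevelReachable G₀ Q n G)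
    (hR : Realizes G₀ Q T j) {x : U}
    (hx : x ∈ sumFilt U.σ G₀ (T.piGens j) n ⊔ j.fieldRange) :
    ∃ (S : DiffField.{u}) (Y : PiSigmaTower K S) (jS : S →+* U), Extends G₀ Q T j n Y jS ∧
      x ∈ jS.fieldRange := by
  rw [sup_comm, ← Subfield.closure_eq (sumFilt U.σ G₀ (T.piGens j) n)] at hx
  obtain ⟨B, hB, hxB⟩ := exists_finset_of_mem_sup_closure hx
  obtain ⟨S, Y, jS, hY, hBY⟩ := reachable_of_finite B.finite_toSet (fun b hb => hn _ hR.adm b (hB hb)) T j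
    hR rfl
  refine ⟨S, Y, jS, hY, (sup_le hY.fieldRange_le (Subfield.closure_le.2 ?_) : _ ≤ _) hxB⟩
  exact hBY.trans (depthField_le_fieldRange _ _ _)

theorem Realizes.isStable_sup (hA : Ambient U G₀ Q) (hR : Realizes G₀ Q T j) (n : ℕ) :
    IsStable U.σ (sumFilt U.σ G₀ Q n ⊔ j.fieldRange) :=
  (isStable_sumFilt hA.stable hA.adm n).sup (isStable_fieldRange hR.equivariant)

/-- The sum of a depth-optimal summand is transcendental over the levels of smaller depth. -/
theorem LevelReachable.transOver (hn : LevelReachable G₀ Q n G) (hA : Ambient U G₀ Q)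
    (hR : Realizes G₀ Q T j) {a : K} {x : U} (hx : U.σ x - x = j a)
    (hopt : T.IsDepthOptimalSummand a) (hna : n ≤ T.depth a) :
    TransOver (sumFilt U.σ G₀ Q n ⊔ j.fieldRange) x := by
  have hxa : U.σ x - x ∈ j.fieldRange := ⟨a, hx.symm⟩
  refine (mem_or_transOver (hR.isStable_sup hA n) (fun c hc =>
    (le_sup_right : j.fieldRange ≤ _) (hR.const_mem hA c hc))
    ((le_sup_right : j.fieldRange ≤ _) hxa)).resolve_left fun hmem => hopt ?_
  obtain ⟨S, Y, jS, hY, g, rfl⟩ := hn.exists_mem_fieldRange hR (hR.mem_sup_of_sub_mem hA hmem hxa)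
  refine ⟨S, Y, hY.isSigma, ((extDepth_le_iff T Y).2 hY.extLE).trans hna, g, jS.injective ?_⟩
  rw [map_sub, ← hY.realizes.equivariant, hx, ← hY.comp_emb]; rfl

/-- After Δy has been reached as an element a of depth at most n, either y is present, or a is a
depth-optimal summand and y is adjoined, or a shallower Σ*-extension already sums a. -/
theorem reachable_of_sub_mem (hA : Ambient U G₀ Q) (hlev : ∀ m ≤ n, LevelReachable G₀ Q m G)
    (hP' : PiAdmissible U.σ G₀ P) {y : U} (hy : U.σ y - y ∈ sumFilt U.σ G₀ P n) : Reachable G₀ Q P (n + 1) G {y} := by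
  intro K T j hR hP
  obtain ⟨S, Y, jS, hY, hYy⟩ := hlev n le_rfl P hP' _ hy T j hR hP
  rw [Set.singleton_subset_iff] at hYy
  -- It suffices to get y into the field: y lies in level n + 1, and `Realizes.fieldRange_inf_le`
  -- turns this into the depth bound.
  have hfin : ∀ {S' : DiffField.{u}} {Z : PiSigmaTower S S'} {jZ : S' →+* U} {m : ℕ}, m ≤ n →
      Extends G₀ Q (T.comp Y) jS m Z jZ → y ∈ jZ.fieldRange → ∃ (S : DiffField.{u})
        (Y : PiSigmaTower K S) (jS : S →+* U), Extends G₀ Q T j (n + 1) Y jS ∧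
          {y} ⊆ ((T.comp Y).depthField jS (n + 1) : Set U) := by
    intro S' Z jZ m hm hZ hyZ
    refine ⟨S', Y.comp Z, jZ, (hY.mono (Nat.le_succ n)).trans (hZ.mono (hm.trans (Nat.le_succ n))),
      Set.singleton_subset_iff.2 ?_⟩
    rw [comp_assoc]
    refine hZ.realizes.fieldRange_inf_le (n + 1) ⟨hyZ, sum_mem_sumFilt ?_⟩
    rw [← hP] at hy
    exact hR.sumFilt_le n hy
  obtain ⟨a, ha⟩ := depthField_le_fieldRange _ _ _ hYy
  have han : (T.comp Y).depth a ≤ n := by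
    rw [depth_le_iff _ jS, ha]; exact hYy
  have heq := hY.realizes.equivariant
  have hconst := hY.realizes.const_mem hA
  by_cases hmem : y ∈ jS.fieldRange
  · exact hfin le_rfl hY.realizes.extends_base hmem
  by_cases hopt : (T.comp Y).IsDepthOptimalSummand a
  · have hyT := (mem_or_transOver (isStable_fieldRange heq) hconst ⟨a, ha⟩).resolve_left hmem
    obtain ⟨L, s, j', hj', ht, rfl, hs, heq'⟩ := exists_step heq hconst ha.symm hyT
    have hY' := hY.mono (Nat.le_succ n)
    refine ⟨L, Y.step s, j', ⟨?_, ⟨hY.isSigma, hs⟩, ⟨hY.isDepthOptimal, fun _ => hopt⟩,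
      ⟨hY'.extLE, Nat.succ_le_succ han⟩, heq', ?_, fun m => ?_, ?_, fun m hm => ?_⟩, ?_⟩
    · rw [← hY.comp_emb, ← hj']; rfl
    · rw [← hY.realizes.ground, ← hj']; rfl
    · refine Set.union_subset ?_ ?_
      · rw [hj']; exact hY.realizes.pi m
      · rintro _ ⟨-, hs', -⟩
        exact absurd hs hs'
    · rw [hj']; exact hY.realizes.indep
    · rw [hj', ht]
      -- Independence of the new generator is needed only for levels m ≤ δ(a) ≤ n, which are
      -- available by induction.
      exact (hlev m (hm.trans han)).transOver hA hY.realizes ha.symm hopt hm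
    · rw [Set.singleton_subset_iff, ← ht]
      exact ((depth_le_iff _ j').1 ((depth_step_t_le_iff (T.comp Y) s).2 (Nat.succ_le_succ han)))
  · rw [IsDepthOptimalSummand, not_not] at hopt
    obtain ⟨E, X, hX, hXd, g, hg⟩ := hopt
    obtain ⟨jE, hjE, heqE⟩ := exists_hom_tower hA.summable hconst heq X hX
    have hle := fieldRange_le_of_extLE X jE heqE hX ((extDepth_le_iff _ X).1 hXd)
    rw [emb_comp, ← RingHom.comp_assoc, hjE, hY.realizes.ground] at hle
    -- Both y and the image of g sum a, so they differ by a constant. Hence y lies in level δ(a)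
    -- joined with the current field.
    have hc : y - jE g ∈ jS.fieldRange := hconst _ (by
      have h1 : jE (X.emb a) = jS a := RingHom.congr_fun hjE a
      rw [map_sub, heqE, sub_eq_sub_iff_sub_eq_sub, ← map_sub, hg, h1, ha])
    have hy' := add_mem ((le_sup_right : jS.fieldRange ≤ _) hc) (hle ⟨g, rfl⟩)
    rw [sub_add_cancel] at hy'
    obtain ⟨S', Z, jZ, hZ, hyZ⟩ := (hlev _ han).exists_mem_fieldRange hY.realizes hy'
    exact hfin han hZ hyZ

theorem levelReachable (hA : Ambient U G₀ Q) (n : ℕ) : LevelReachable G₀ Q n G := by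
  induction n using Nat.strong_induction_on with
  | _ n ih =>
    cases n with
    | zero =>
      intro P _ a ha K T j hR _
      refine ⟨K, .base, j, hR.extends_base, Set.singleton_subset_iff.2 ?_⟩
      refine ground_le_depthField T j 0 ?_
      rwa [hR.ground]
    | succ n =>
      have hlev : ∀ m ≤ n, LevelReachable G₀ Q m G := fun m hm => ih m (Nat.lt_succ_of_le hm)
      intro P hP' a ha
      -- Level n is stable, so its elements are themselves sums over level n. Sums and products
      -- alone generate level n + 1.
      have hle : sumFilt U.σ G₀ P (n + 1) ≤
          Subfield.closure ({y | U.σ y - y ∈ sumFilt U.σ G₀ P n} ∪ P (n + 1)) := by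
        refine sup_le (fun y hy => Subfield.subset_closure (Or.inl ?_)) le_rfl
        exact (isStable_sumFilt hA.stable hP' n).sub_mem hy
      refine reachable_of_mem_closure (hle ha) ?_
      rintro z (hz | hz)
      · exact reachable_of_sub_mem hA hlev hP' hz
      · intro K T j hR hP
        refine ⟨K, .base, j, hR.extends_base, Set.singleton_subset_iff.2 ?_⟩
        rw [← hP] at hz
        exact piGens_subset_depthField T j _ hz

end Extension

end PiSigmaTower

namespace DiffAlg

/-- With no products in the filtration, adjoining sums creates no new homogeneous solutions at any
level. -/
theorem mem_of_homogeneous_sumFilt {U : Type*} [Field U] [CharZero U] {σ : U ≃+* U}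
    {L : Subfield U} {γ u : U} (hL : IsStable σ L) (hC : ∀ c, σ c = c → c ∈ L) (hγ : γ ∈ L)
    (he : γ * σ u = u) {n : ℕ} (hu : u ∈ sumFilt σ L (fun _ => ∅) n) : u ∈ L := by
  induction n with
  | zero => exact hu
  | succ n ih =>
    refine ih (mem_of_homogeneous_closure (isStable_sumFilt hL (fun _ _ h => h.elim) n)
      (fun c hc => le_sumFilt n (hC c hc)) (fun z hz => ?_) (le_sumFilt n hγ) hu he)
    exact hz.resolve_right id

end DiffAlg

namespace PiSigmaTower

open DiffAlg

/-! ### Independence of products and the theorem inside the ambient field -/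

section Independence

variable {G U : DiffField.{u}}

theorem isStable_depthField : ∀ {K : DiffField.{u}} (T : PiSigmaTower G K) (j : K →+* U)
    (_ : ∀ x, U.σ (j x) = j (K.σ x)) (n : ℕ), IsStable U.σ (T.depthField j n)
  | _, .base, _, hj, _ => isStable_fieldRange hj
  | _, .step T s, j, hj, n => by
    have ih := isStable_depthField T (j.comp s.emb) (equivariant_step hj) n
    by_cases hn : T.depth s.a + 1 ≤ n
    · have ha := (T.depth_le_iff (j.comp s.emb)).1 ((Nat.le_succ _).trans hn)
      rw [depthField_step_of_le T s j hn]
      by_cases hs : s.IsSigma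
      · refine (isStep_of_sub_mem ?_).isStable_adj ih
        rwa [sub_step hj hs]
      · exact (isPi_step hj hs ha).isStep.isStable_adj ih
    · rwa [depthField_step_of_not_le T s j hn]

/-- Going down the tower, each generator of depth at most n is transcendental over the field below
and disappears upon intersection; deeper ones do not occur. -/
theorem sup_depthField_inf_le {K : DiffField.{u}} (T : PiSigmaTower G K) (n : ℕ) :
    ∀ {L : DiffField.{u}} (Y : PiSigmaTower K L) (j : L →+* U) {N : Subfield U},
      N ≤ (j.comp Y.emb).fieldRange → (N ⊔ (T.comp Y).depthField j n) ⊓ (j.comp Y.emb).fieldRange ≤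
        N ⊔ T.depthField (j.comp Y.emb) n
  | _, .base, _, _, _ => inf_le_left
  | _, .step Y s, j, N, hN => by
    have ih := sup_depthField_inf_le T n Y (j.comp s.emb) hN
    by_cases hn : (T.comp Y).depth s.a + 1 ≤ n
    · rw [comp, depthField_step_of_le _ s j hn, sup_adj]
      have hle : (j.comp (Y.step s).emb).fieldRange ≤ (j.comp s.emb).fieldRange := by
        rintro _ ⟨x, rfl⟩
        exact ⟨Y.emb x, rfl⟩
      refine fun z hz => ih ⟨adj_inf_le (sup_le (hN.trans hle) (depthField_le_fieldRange _ _ n))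
        (transOver_step s j) ⟨hz.1, hle hz.2⟩, hz.2⟩
    · rw [comp, depthField_step_of_not_le _ s j hn]
      exact ih

theorem const_mem_emb : ∀ {K : DiffField.{u}} (T : PiSigmaTower G K) {c : K}, K.σ c = c →
    ∃ c₀, T.emb c₀ = c
  | _, .base, c, _ => ⟨c, rfl⟩
  | _, .step T s, c, hc => by
    obtain ⟨c₁, hc₁, rfl⟩ := s.const c hc
    obtain ⟨c₀, rfl⟩ := const_mem_emb T hc₁
    exact ⟨c₀, rfl⟩

variable {E : DiffField.{u}} {jE : E →+* U} {G₀ : Subfield U} {Q : ℕ → Set U}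

/-- A product of the tower is transcendental over the levels of smaller depth. -/
theorem transOver_of_pi (hA : Ambient U G₀ Q) (heq : ∀ x, U.σ (jE x) = jE (E.σ x))
    {K L : DiffField.{u}} (T : PiSigmaTower G K) (s : PiSigmaStep K L) (Y : PiSigmaTower L E)
    (hs : ¬ s.IsSigma) (hQ : ((T.step s).comp Y).piGens jE = Q)
    (hG : G₀ ≤ ((jE.comp Y.emb).comp s.emb).fieldRange)
    {n : ℕ} (hn : n ≤ T.depth s.a) :
    TransOver (sumFilt U.σ G₀ Q n ⊔ ((jE.comp Y.emb).comp s.emb).fieldRange)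
      ((jE.comp Y.emb) s.t) := by
  set j := jE.comp Y.emb with hj
  have heqj : ∀ x, U.σ (j x) = j (L.σ x) := fun x => by
    rw [hj, RingHom.comp_apply, heq, emb_σ]; rfl
  set N := (j.comp s.emb).fieldRange with hN
  set D := ((T.step s).comp Y).depthField jE n with hD
  have hNst : IsStable U.σ N := isStable_fieldRange (equivariant_step heqj)
  have hDst : IsStable U.σ (N ⊔ D) := hNst.sup (isStable_depthField _ jE heq n)
  have hπ : IsPi U.σ N (j s.t) := isPi_step heqj hs ⟨s.a, rfl⟩
  have htrans := transOver_step s j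
  have ht0 : j s.t ≠ 0 := htrans.ne_zero
  by_contra hT
  -- An algebraic product has a positive power t^k in W_n N, to be pushed down to N.
  obtain ⟨k, hk, hmem⟩ := exists_pow_mem_of_not_transOver
    ((isStable_sumFilt hA.stable hA.adm n).sup hNst)
    (fun c hc => (le_sup_right : N ≤ _) (hG (hA.const c hc))) (hπ.mono le_sup_right) ht0 hT
  -- Putting all generators of depth at most n into the ground field absorbs the products of W_n and
  -- leaves a filtration by sums only.
  have hle : sumFilt U.σ G₀ Q n ⊔ N ≤ sumFilt U.σ (N ⊔ D) (fun _ => ∅) n := by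
    refine sup_le (sumFilt_le (hG.trans le_sup_left) sumFilt_mono
      (fun _ _ _ h => sum_mem_sumFilt h) fun m hm z hz => ?_) (le_sup_left.trans (le_sumFilt n))
    rw [← hQ] at hz
    exact ((le_sup_right : D ≤ N ⊔ D).trans (le_sumFilt _))
      (depthField_mono _ jE hm (piGens_subset_depthField _ jE _ hz))
  obtain ⟨α, hα, hα0, hσ⟩ := hπ
  have h1 : j s.t ^ k ∈ N ⊔ D := by
    refine mem_of_homogeneous_sumFilt hDst (fun c hc => (le_sup_left : N ≤ _) (hG (hA.const c hc)))
      (γ := (α ^ k)⁻¹) ((le_sup_left : N ≤ _) (inv_mem (pow_mem hα k))) ?_ (hle hmem)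
    rw [map_pow, hσ, mul_pow, inv_mul_cancel_left₀ (pow_ne_zero k hα0)]
  have hNle : N ≤ (jE.comp Y.emb).fieldRange := by
    rintro _ ⟨x, rfl⟩
    exact ⟨s.emb x, rfl⟩
  -- Intersecting N D with the field L removes the generators above t, and t itself is deeper than
  -- n, so t^k lies in N.
  have h2 := sup_depthField_inf_le (T.step s) n Y jE hNle ⟨h1, ⟨s.t ^ k, map_pow j _ _⟩⟩
  rw [depthField_step_of_not_le T s _ (by omega), sup_eq_left.2 (depthField_le_fieldRange _ _ n)]
    at h2
  refine htrans.zpow_notMem (k := k) (by exact_mod_cast hk) ?_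
  rw [zpow_natCast]
  exact h2

/-- Induction along the tower: once the lower part is realized, its reachability results give
independence of the next sum, while products use `transOver_of_pi`. -/
theorem realizes_of_isDepthOptimal (hA : Ambient U G₀ Q) (heq : ∀ x, U.σ (jE x) = jE (E.σ x)) :
    ∀ {K : DiffField.{u}} (T : PiSigmaTower G K) (Y : PiSigmaTower K E),
      (base : PiSigmaTower G G).IsDepthOptimal T → (T.comp Y).piGens jE = Q →
      (jE.comp (T.comp Y).emb).fieldRange = G₀ → Realizes G₀ Q T (jE.comp Y.emb) := by
  have hmain : ∀ {K : DiffField.{u}} (T : PiSigmaTower G K) (Y : PiSigmaTower K E),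
      (T.comp Y).piGens jE = Q → (jE.comp (T.comp Y).emb).fieldRange = G₀ →
      IndepOver (sumFilt U.σ G₀ Q) T (jE.comp Y.emb) → Realizes G₀ Q T (jE.comp Y.emb) := by
    intro K T Y hQ hG hI
    refine ⟨fun x => ?_, ?_, fun n => ?_, hI⟩
    · rw [RingHom.comp_apply, heq, emb_σ]; rfl
    · rw [RingHom.comp_assoc, ← emb_comp, hG]
    · rw [← hQ]; exact piGens_subset_comp T n Y jE
  intro K T
  induction T with
  | base => exact fun Y _ hQ hG => hmain _ Y hQ hG trivial
  | @step K L T s ih =>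
    intro Y hopt hQ hG
    refine hmain _ Y hQ hG ?_
    have hT : T.comp ((base.step s).comp Y) = (T.step s).comp Y := comp_assoc T (base.step s) Y
    have hR := ih ((base.step s).comp Y) hopt.1 (by rw [hT, hQ]) (by rw [hT, hG])
    have hemb : jE.comp ((base.step s).comp Y).emb = (jE.comp Y.emb).comp s.emb := by
      rw [emb_comp]; rfl
    rw [hemb] at hR
    have heqj : ∀ x, U.σ ((jE.comp Y.emb) x) = (jE.comp Y.emb) (L.σ x) := fun x => by
      rw [RingHom.comp_apply, heq, emb_σ]; rfl
    refine ⟨hR.indep, fun n hn => ?_⟩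
    by_cases hs : s.IsSigma
    · have hopt' := hopt.2 hs
      rw [base_comp] at hopt'
      exact (levelReachable hA n).transOver hA hR (sub_step heqj hs) hopt' hn
    · exact transOver_of_pi hA heq T s Y hs hQ hR.ground_le hn

/-- The theorem, inside a difference field containing `E` with the same constants and in which every
element is summable. -/
theorem exists_isDepthOptimal_of_ambient {F : DiffField.{u}} (heq : ∀ x, U.σ (jE x) = jE (E.σ x))
    (hC : ∀ c, U.σ c = c → c ∈ jE.fieldRange) (hsum : ∀ a : U, ∃ y, U.σ y - y = a)
    (T : PiSigmaTower G F) (hT : (base : PiSigmaTower G G).IsDepthOptimal T)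
    (X : PiSigmaTower F E) (f : F) (g : E) (hg : E.σ g - g = X.emb f) :
    ∃ (S : DiffField.{u}) (Y : PiSigmaTower F S), Y.IsSigma ∧ T.IsDepthOptimal Y ∧
      ∃ g' : S, S.σ g' - g' = Y.emb f ∧ (T.comp Y).depth g' ≤ (T.comp X).depth g := by
  set G₀ := (jE.comp (T.comp X).emb).fieldRange with hG₀
  set Q := (T.comp X).piGens jE with hQ
  have hA : Ambient U G₀ Q := by
    refine ⟨isStable_fieldRange fun x => ?_, fun c hc => ?_, piAdmissible_piGens _ _ heq, hsum⟩
    · rw [RingHom.comp_apply, heq, emb_σ]; rfl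
    · obtain ⟨e, rfl⟩ := hC c hc
      rw [heq] at hc
      obtain ⟨c₀, rfl⟩ := const_mem_emb (T.comp X) (jE.injective hc)
      exact ⟨c₀, rfl⟩
  have hR : Realizes G₀ Q T (jE.comp X.emb) := realizes_of_isDepthOptimal hA heq T X hT rfl rfl
  set d := (T.comp X).depth g with hd
  have hgW : jE g ∈ sumFilt U.σ G₀ Q d :=
    depthField_le_sumFilt (T.comp X) jE heq d (((T.comp X).depth_le_iff jE).1 le_rfl)
  have hΔ : U.σ (jE g) - jE g = (jE.comp X.emb) f := by
    rw [heq, ← map_sub, hg]; rfl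
  -- Depth-optimality of F enters here: f lies in F and in level d, so its depth is at most d and
  -- its image needs only the products of F.
  have hfV : U.σ (jE g) - jE g ∈ sumFilt U.σ G₀ (T.piGens (jE.comp X.emb)) d := by
    refine hR.depthField_le d (hR.fieldRange_inf_le d ⟨⟨f, hΔ.symm⟩, ?_⟩)
    exact (isStable_sumFilt hA.stable hA.adm d).sub_mem hgW
  have hgV := (hR.descends hA d).descent (jE g) ((le_sup_right : sumFilt U.σ G₀ Q d ≤ _) hgW) hfV
  obtain ⟨S, Y, jS, hY, hgY⟩ := levelReachable hA d _ hR.adm _ hgV T _ hR rfl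
  rw [Set.singleton_subset_iff] at hgY
  obtain ⟨g', hg'⟩ := depthField_le_fieldRange _ _ _ hgY
  refine ⟨S, Y, hY.isSigma, hY.isDepthOptimal, g', jS.injective ?_, ?_⟩
  · have h1 : jS (Y.emb f) = (jE.comp X.emb) f := RingHom.congr_fun hY.comp_emb f
    rw [map_sub, ← hY.realizes.equivariant, hg', hΔ, h1]
  · rw [depth_le_iff _ jS, hg']
    exact hgY

end Independence

end PiSigmaTower

/-! ### Construction of an ambient field in which everything is summable -/

namespace DiffField

open DiffAlg

/-- The field of constants. -/
def const (E : DiffField.{u}) : Subfield E where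
  carrier := {c | E.σ c = c}
  mul_mem' ha hb := by rw [Set.mem_ofPred_eq] at *; rw [map_mul, ha, hb]
  one_mem' := map_one _
  add_mem' ha hb := by rw [Set.mem_ofPred_eq] at *; rw [map_add, ha, hb]
  zero_mem' := map_zero _
  neg_mem' ha := by rw [Set.mem_ofPred_eq] at *; rw [map_neg, ha]
  inv_mem' a ha := by rw [Set.mem_ofPred_eq] at *; rw [map_inv₀, ha]

theorem mem_const {E : DiffField.{u}} {c : E} : c ∈ E.const ↔ E.σ c = c := Iff.rfl

/-- The forward difference operator. -/
def diff (E : DiffField.{u}) : E →ₗ[E.const] E where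
  toFun x := E.σ x - x
  map_add' x y := by rw [map_add]; ring
  map_smul' c x := by
    rw [Subfield.smul_def, smul_eq_mul, map_mul, mem_const.1 c.2, RingHom.id_apply,
      Subfield.smul_def, smul_eq_mul, mul_sub]

variable {E E' : DiffField.{u}} {e : E →+* E'} {ι : Type*} {b : ι → E} {s : ι → E'}

/-- The two claims feed each other: the description of attainable differences, with independence of
the b i modulo Δ(E), shows that the next b i has no sum so far. Hence adjoining its sum creates no
constant, which in turn gives the description for the larger set. -/
theorem sum_mem_of_mem_adjoin (he : ∀ x, E'.σ (e x) = e (E.σ x))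
    (hs : ∀ i, E'.σ (s i) - s i = e (b i))
    (hb : LinearIndependent E.const ((LinearMap.range E.diff).mkQ ∘ b)) (t : Finset ι) :
    (∀ c ∈ e.fieldRange ⊔ Subfield.closure (s '' t), E'.σ c = c → c ∈ e.fieldRange) ∧
    ∀ h ∈ e.fieldRange ⊔ Subfield.closure (s '' t), E'.σ h - h ∈ e.fieldRange →
      ∃ v ∈ Submodule.span E.const (b '' t), ∃ l, E'.σ h - h = e (E.diff l + v) := by
  classical
  induction t using Finset.induction_on with
  | empty =>
    rw [Finset.coe_empty, Set.image_empty, Subfield.closure_empty, sup_bot_eq]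
    refine ⟨fun c hc _ => hc, ?_⟩
    rintro _ ⟨l, rfl⟩ -
    refine ⟨0, zero_mem _, l, ?_⟩
    rw [add_zero, he, ← map_sub]; rfl
  | @insert i t hi ih =>
    rw [Finset.coe_insert, Set.image_insert_eq, Set.image_insert_eq, sup_closure_insert]
    set L := e.fieldRange ⊔ Subfield.closure (s '' t) with hL
    have heL : e.fieldRange ≤ L := le_sup_left
    have hst : IsStable E'.σ L := by
      refine isStable_closure (PiSigmaTower.isStable_fieldRange he) ?_
      rintro _ ⟨j, -, rfl⟩
      exact isStep_of_sub_mem ⟨b j, (hs j).symm⟩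
    have hsi : E'.σ (s i) - s i ∈ L := heL ⟨b i, (hs i).symm⟩
    have hconst : ∀ c ∈ adj L (s i), E'.σ c = c → c ∈ L := by
      refine fun c hc hσ => const_mem_of_not_summable hst hsi (fun w hw hΔ => ?_) hc hσ
      obtain ⟨v, hv, l, hl⟩ := ih.2 w hw ⟨b i, by rw [hΔ, hs]⟩
      rw [hΔ, hs] at hl
      have hbi := e.injective hl
      refine hb.notMem_span_image (s := (t : Set ι)) (x := i) (by simpa using hi) ?_
      have hq : (LinearMap.range E.diff).mkQ (b i) = (LinearMap.range E.diff).mkQ v := by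
        rw [hbi, map_add, add_eq_right]
        exact (Submodule.Quotient.mk_eq_zero _).2 ⟨l, rfl⟩
      rw [Function.comp_apply, hq, Set.image_comp, ← Submodule.map_span]
      exact ⟨v, hv, rfl⟩
    refine ⟨fun c hc hσ => ih.1 c (hconst c hc hσ) hσ, fun h hh hΔ => ?_⟩
    obtain ⟨c, hcL, hσc, l, hl, rfl⟩ := exists_eq_mul_add_of_sub_mem hst hconst hsi hh (heL hΔ)
    obtain ⟨c, rfl⟩ := ih.1 c hcL hσc
    have hc : c ∈ E.const := by
      rw [he] at hσc
      exact e.injective hσc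
    have heq : E'.σ (e c * s i + l) - (e c * s i + l) = e (c * b i) + (E'.σ l - l) := by
      rw [map_add, map_mul, hσc, map_mul, ← hs]; ring
    rw [heq] at hΔ ⊢
    have hΔl : E'.σ l - l ∈ e.fieldRange := by
      have := sub_mem hΔ (show e (c * b i) ∈ e.fieldRange from ⟨_, rfl⟩)
      rwa [add_sub_cancel_left] at this
    obtain ⟨v, hv, m, hm⟩ := ih.2 l hl hΔl
    refine ⟨c * b i + v, ?_, m, ?_⟩
    · refine add_mem (Submodule.smul_mem _ (⟨c, hc⟩ : E.const)
        (Submodule.subset_span (Set.mem_insert _ _))) ?_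
      exact Submodule.span_mono (Set.subset_insert _ _) hv
    · rw [hm, ← map_add]
      congr 1
      ring

theorem const_mem_of_adjoin_sums (he : ∀ x, E'.σ (e x) = e (E.σ x))
    (hs : ∀ i, E'.σ (s i) - s i = e (b i))
    (hb : LinearIndependent E.const ((LinearMap.range E.diff).mkQ ∘ b))
    (htop : e.fieldRange ⊔ Subfield.closure (Set.range s) = ⊤) (c : E') (hc : E'.σ c = c) :
    c ∈ e.fieldRange := by
  classical
  have hc' : c ∈ e.fieldRange ⊔ Subfield.closure (Set.range s) := by rw [htop]; trivial
  obtain ⟨t, ht, hct⟩ := exists_finset_of_mem_sup_closure hc'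
  obtain ⟨t', -, rfl⟩ := Finset.subset_set_image_iff.1 (show (t : Set E') ⊆ s '' Set.univ by
    rwa [Set.image_univ])
  rw [Finset.coe_image] at hct
  exact (sum_mem_of_mem_adjoin he hs hb _).1 c hct hc

/-- The elements of E summable in E' form a subspace over the constants; it contains Δ(E) and
representatives spanning E/Δ(E). -/
theorem exists_sum_of_span (he : ∀ x, E'.σ (e x) = e (E.σ x))
    (hs : ∀ i, E'.σ (s i) - s i = e (b i))
    (hb : ⊤ ≤ Submodule.span E.const (Set.range ((LinearMap.range E.diff).mkQ ∘ b))) (a : E) :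
    ∃ y, E'.σ y - y = e a := by
  let S : Submodule E.const E :=
    { carrier := {a | ∃ y, E'.σ y - y = e a}
      zero_mem' := ⟨0, by simp⟩
      add_mem' := by
        rintro a a' ⟨y, hy⟩ ⟨y', hy'⟩
        exact ⟨y + y', by rw [map_add, map_add, ← hy, ← hy']; ring⟩
      smul_mem' := by
        rintro c a ⟨y, hy⟩
        refine ⟨e c * y, ?_⟩
        rw [map_mul, he, mem_const.1 c.2, Subfield.smul_def, smul_eq_mul, map_mul, ← hy]; ring }
  have hr : LinearMap.range E.diff ≤ S := by
    rintro _ ⟨x, rfl⟩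
    exact ⟨e x, by rw [he, ← map_sub]; rfl⟩
  have h1 : S.map (LinearMap.range E.diff).mkQ = ⊤ := by
    refine top_le_iff.1 (hb.trans (Submodule.span_le.2 ?_))
    rintro _ ⟨i, rfl⟩
    exact ⟨b i, ⟨s i, hs i⟩, rfl⟩
  have h2 := Submodule.comap_map_mkQ (LinearMap.range E.diff) S
  rw [h1, Submodule.comap_top, sup_eq_right.2 hr] at h2
  have : a ∈ S := by rw [← h2]; trivial
  exact this

section Free

open MvPolynomial

/-- The automorphism `X i ↦ X i + b i` of the polynomial ring over `E`. -/
noncomputable def shift (E : DiffField.{u}) (b : ι → E) : MvPolynomial ι E ≃+* MvPolynomial ι E :=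
  RingEquiv.ofRingHom
    (eval₂Hom (C.comp (E.σ : E →+* E)) fun i => X i + C (b i))
    (eval₂Hom (C.comp (E.σ.symm : E →+* E)) fun i => X i - C (E.σ.symm (b i)))
    (by ext <;> simp) (by ext <;> simp)

theorem exists_adjoin_sums {ι : Type u} (b : ι → E) : ∃ (E' : DiffField.{u}) (e : E →+* E')
    (s : ι → E'), (∀ x, E'.σ (e x) = e (E.σ x)) ∧ (∀ i, E'.σ (s i) - s i = e (b i)) ∧
      e.fieldRange ⊔ Subfield.closure (Set.range s) = ⊤ := by
  let R := MvPolynomial ι E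
  let F := FractionRing R
  let φ : R →+* F := algebraMap R F
  let E' : DiffField.{u} :=
    { carrier := F
      charZero := ((φ.comp C).charZero_iff (φ.comp C).injective).1 inferInstance
      σ := IsFractionRing.ringEquivOfRingEquiv (A := R) (K := F) (B := R) (L := F) (shift E b) }
  let e : E →+* E' := φ.comp C
  let s : ι → E' := fun i => φ (X i)
  have hσ : ∀ p, E'.σ (φ p) = φ (shift E b p) := fun p =>
    IsFractionRing.ringEquivOfRingEquiv_algebraMap _ _
  refine ⟨E', e, s, fun x => ?_, fun i => ?_, ?_⟩
  · refine (hσ (C x)).trans (congrArg φ ?_)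
    simp [shift]
  · have h : shift E b (X i) = X i + C (b i) := by simp [shift]
    have h1 : E'.σ (s i) = s i + e (b i) := by
      refine (hσ (X i)).trans ?_
      rw [h, map_add]; rfl
    rw [h1, add_sub_cancel_left]
  · rw [eq_top_iff]
    rintro z -
    have hp : ∀ p : R, φ p ∈ e.fieldRange ⊔ Subfield.closure (Set.range s) := by
      intro p
      induction p using MvPolynomial.induction_on with
      | C a => exact (le_sup_left : e.fieldRange ≤ _) ⟨a, rfl⟩
      | add p q hp hq => rw [map_add]; exact add_mem hp hq
      | mul_X p i hp =>
        rw [map_mul]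
        exact mul_mem hp ((le_sup_right : Subfield.closure (Set.range s) ≤ _)
          (Subfield.subset_closure ⟨i, rfl⟩))
    obtain ⟨p, q, -, rfl⟩ := IsFractionRing.div_surjective (A := R) (K := F) z
    exact div_mem (hp p) (hp q)

end Free

/-- Every difference field embeds into one with the same constants, in which all its elements are
summable. -/
theorem exists_summable_extension (E : DiffField.{u}) : ∃ (E' : DiffField.{u}) (e : E →+* E'),
    (∀ x, E'.σ (e x) = e (E.σ x)) ∧ (∀ c, E'.σ c = c → c ∈ e.fieldRange) ∧
      ∀ a, ∃ y, E'.σ y - y = e a := by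
  let B := Module.Basis.ofVectorSpace E.const (E ⧸ LinearMap.range E.diff)
  choose b hb using fun i => Submodule.mkQ_surjective (LinearMap.range E.diff) (B i)
  have hB : (LinearMap.range E.diff).mkQ ∘ b = B := funext hb
  obtain ⟨E', e, s, he, hs, htop⟩ := exists_adjoin_sums b
  refine ⟨E', e, he, const_mem_of_adjoin_sums he hs ?_ htop, exists_sum_of_span he hs ?_⟩
  · rw [hB]; exact B.linearIndependent
  · rw [hB]; exact B.span_eq.ge

end DiffField

namespace DiffField

open DiffAlg

/-! ### The limit of iterated summable extensions -/

section Limit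

variable (K : ℕ → DiffField.{u}) (e : ∀ n, K n →+* K (n + 1))

/-- The composed embeddings of a sequence of field extensions. -/
def transition (m n : ℕ) (h : m ≤ n) : K m →+* K n :=
  Nat.leRec (motive := fun n _ => K m →+* K n) (RingHom.id _) (fun n _ f => (e n).comp f) h

theorem transition_self (m : ℕ) : transition K e m m le_rfl = RingHom.id _ := Nat.leRec_self _ _

theorem transition_succ {m n : ℕ} (h : m ≤ n) :
    transition K e m (n + 1) (h.trans (Nat.le_succ n)) = (e n).comp (transition K e m n h) :=
  Nat.leRec_succ _ _ _

instance : DirectedSystem (fun n => K n) (fun m n h => transition K e m n h) where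
  map_self m x := by rw [transition_self]; rfl
  map_map {k j i} hij hjk x := by
    induction hjk with
    | refl => rw [transition_self]; rfl
    | @step k hk ih => rw [transition_succ K e hk, transition_succ K e (hij.trans hk)]; simp [ih]

theorem σ_transition (he : ∀ n x, (K (n + 1)).σ (e n x) = e n ((K n).σ x)) {m n : ℕ} (h : m ≤ n)
    (x : K m) : (K n).σ (transition K e m n h x) = transition K e m n h ((K m).σ x) := by
  induction h with
  | refl => rw [transition_self]; rfl
  | @step k hk ih => rw [transition_succ K e hk]; simp [he, ih]

theorem exists_limit (he : ∀ n x, (K (n + 1)).σ (e n x) = e n ((K n).σ x)) :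
    ∃ (U : DiffField.{u}) (j : ∀ n, K n →+* U), (∀ n x, U.σ (j n x) = j n ((K n).σ x)) ∧
      (∀ n x, j (n + 1) (e n x) = j n x) ∧ ∀ x, ∃ n y, j n y = x := by
  let f : ∀ m n (_ : m ≤ n), K m →+* K n := transition K e
  let D := DirectLimit (fun n => (K n : Type u)) f
  let j : ∀ n, K n →+* D := fun n =>
    { toFun := fun x => ⟦⟨n, x⟩⟧
      map_one' := (DirectLimit.one_def n).symm
      map_mul' := fun x y => by
        exact (DirectLimit.mul_def (f := f) n x y).symm
      map_zero' := (DirectLimit.zero_def n).symm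
      map_add' := fun x y => by
        exact (DirectLimit.add_def (f := f) n x y).symm }
  have hj : ∀ x : D, ∃ n y, j n y = x := fun x => by
    obtain ⟨n, y, rfl⟩ := DirectLimit.exists_eq_mk f x
    exact ⟨n, y, rfl⟩
  have hσ : ∀ m n h x, f m n h ((K m).σ x) = (K n).σ (f m n h x) :=
    fun m n h x => (σ_transition K e he h x).symm
  have hσ' : ∀ m n h x, f m n h ((K m).σ.symm x) = (K n).σ.symm (f m n h x) := fun m n h x => by
    rw [RingEquiv.eq_symm_apply, ← hσ, RingEquiv.apply_symm_apply]
  let s : D → D := DirectLimit.map f f (fun n x => (K n).σ x) hσ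
  let s' : D → D := DirectLimit.map f f (fun n x => (K n).σ.symm x) hσ'
  have hs : ∀ n x, s (j n x) = j n ((K n).σ x) := fun _ _ => rfl
  have hs' : ∀ n x, s' (j n x) = j n ((K n).σ.symm x) := fun _ _ => rfl
  have hj2 : ∀ x y : D, ∃ n x' y', j n x' = x ∧ j n y' = y := fun x y => by
    obtain ⟨n, x', y', rfl, rfl⟩ := DirectLimit.exists_eq_mk₂ f x y
    exact ⟨n, x', y', rfl, rfl⟩
  let U : DiffField.{u} :=
    { carrier := D
      charZero := ((j 0).charZero_iff (j 0).injective).1 inferInstance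
      σ :=
        { toFun := s
          invFun := s'
          left_inv := fun x => by
            obtain ⟨n, y, rfl⟩ := hj x
            rw [hs, hs', RingEquiv.symm_apply_apply]
          right_inv := fun x => by
            obtain ⟨n, y, rfl⟩ := hj x
            rw [hs', hs, RingEquiv.apply_symm_apply]
          map_mul' := fun x y => by
            obtain ⟨n, x, y, rfl, rfl⟩ := hj2 x y
            rw [← map_mul, hs, hs, hs, map_mul, map_mul]
          map_add' := fun x y => by
            obtain ⟨n, x, y, rfl, rfl⟩ := hj2 x y
            rw [← map_add, hs, hs, hs, map_add, map_add] } }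
  refine ⟨U, j, hs, fun n x => ?_, hj⟩
  have h := DirectLimit.mk_apply (f := f) n (n + 1) x (Nat.le_succ n)
  have hf : f n (n + 1) (Nat.le_succ n) x = e n x := by
    change transition K e n (n + 1) ((le_refl n).trans (Nat.le_succ n)) x = _
    rw [transition_succ K e le_rfl, transition_self]; rfl
  rw [hf] at h
  exact h

variable {K e} in
theorem exists_summable_limit (he : ∀ n x, (K (n + 1)).σ (e n x) = e n ((K n).σ x))
    (hconst : ∀ n c, (K (n + 1)).σ c = c → c ∈ (e n).fieldRange)
    (hsum : ∀ n a, ∃ y, (K (n + 1)).σ y - y = e n a) :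
    ∃ (U : DiffField.{u}) (j : K 0 →+* U), (∀ x, U.σ (j x) = j ((K 0).σ x)) ∧
      (∀ c, U.σ c = c → c ∈ j.fieldRange) ∧ ∀ a : U, ∃ y, U.σ y - y = a := by
  obtain ⟨U, j, hj, hcomp, hsurj⟩ := exists_limit K e he
  refine ⟨U, j 0, hj 0, fun c hc => ?_, fun a => ?_⟩
  · obtain ⟨n, x, rfl⟩ := hsurj c
    rw [hj] at hc
    have hx := (j n).injective hc
    clear hc
    induction n with
    | zero => exact ⟨x, rfl⟩
    | succ n ih =>
      obtain ⟨y, rfl⟩ := hconst n x hx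
      rw [hcomp]
      exact ih y ((e n).injective (by rw [← he]; exact hx))
  · obtain ⟨n, x, rfl⟩ := hsurj a
    obtain ⟨y, hy⟩ := hsum n x
    exact ⟨j (n + 1) y, by rw [hj, ← map_sub, hy, hcomp]⟩

end Limit

/-- Every difference field embeds into one with the same constants, in which every element is
summable. -/
theorem exists_summable_closure (E : DiffField.{u}) : ∃ (U : DiffField.{u}) (j : E →+* U),
    (∀ x, U.σ (j x) = j (E.σ x)) ∧ (∀ c, U.σ c = c → c ∈ j.fieldRange) ∧
      ∀ a : U, ∃ y, U.σ y - y = a := by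
  choose next emb hemb hconst hsum using exists_summable_extension.{u}
  exact exists_summable_limit (K := fun n => Nat.rec E (fun _ L => next L) n)
    (e := fun n => emb _) (fun n => hemb _) (fun n => hconst _) (fun n => hsum _)

end DiffField

theorem mainTheorem8 (G F E : DiffField.{u})
    (T : PiSigmaTower G F) (hT : (PiSigmaTower.base : PiSigmaTower G G).IsDepthOptimal T)
    (X : PiSigmaTower F E) (f : F) (g : E) (hg : E.σ g - g = X.emb f) :
    ∃ (S : DiffField.{u}) (Y : PiSigmaTower F S),
      Y.IsSigma ∧ T.IsDepthOptimal Y ∧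
      ∃ g' : S, S.σ g' - g' = Y.emb f ∧ (T.comp Y).depth g' ≤ (T.comp X).depth g := by
  obtain ⟨U, j, hj, hC, hsum⟩ := E.exists_summable_closure
  exact PiSigmaTower.exists_isDepthOptimal_of_ambient hj hC hsum T hT X f g hg
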